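/- **Setting.** Let $|\cdot|$ be the Euclidean norm on $\mathbb Z^2$. Let $k_{\rm F}>0$, $B_{\rm F}=\{k\in\mathbb Z^2: |k|<k_{\rm F}\}$, $B_{\rm F}^c=\mathbb Z^2\setminus B_{\rm F}$, with $k_{\rm F}^2=\tfrac12\big(\inf_{p\in B_{\rm F}^c}|p|^2+\sup_{q\in B_{\rm F}}|q|^2\big)$; put $N=|B_{\rm F}|$ and $\hbar=N^{-1/2}$. Let $\hat V:\mathbb Z^2\to[0,\infty)$ satisfy $\hat V(-k)=\hat V(k)$. On the fermionic Fock space $\mathcal F$ over $L^2([0,2\pi]^2)$ let $a_p^*,a_p$ be the creation and annihilation operators of the plane waves $e_p(x)=(2\pi)^{-1}e^{ip\cdot x}$, $\mathcal N=\sum_p a_p^*a_p$, and let $R$ be the unitary particle--hole transformation, $R^*a_pR=a_p$ for $p\in B_{\rm F}^c$, $R^*a_pR=a_p^*$ for $p\in B_{\rm F}$, which maps the vacuum to the Slater determinant $\psi_{\rm FS}$ of the plane waves $e_p$, $p\in B_{\rm F}$. For $k\in\mathbb Z^2$ let $$d(k)=\sum_{p\in B_{\rm F}^c\cap(B_{\rm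 F}^c+k)}a_{p-k}^*a_p-\sum_{h\in B_{\rm F}\cap(B_{\rm F}-k)}a_{h+k}^*a_h ,$$ $$\mathcal E_1=\frac1{2(2\pi)^2N}\sum_{k\ne0}\hat V(k)\,d^*(k)d(k),\qquad \widetilde{\mathcal E}_1=\frac1{2(2\pi)^2N}\sum_{k\neq0,\ |k|<\Lambda N^{1/2}}\hat V(k)\,d^*(k)d(k),$$ where $\Lambda>0$ is a fixed constant. **(i)** If $\sum_{k}|k|^{2-b}\hat V(k)^2<\infty$ for some $b\in(0,1)$, then there is a constant $C>0$, independent of $k_{\rm F}$ (hence of $N$) and of $\xi$, such that for all $\xi\in\mathcal F$ $$|\langle\xi,\widetilde{\mathcal E}_1\xi\rangle|\le C N^{-1+\frac b4}\langle\xi,\mathcal N^2\xi\rangle .$$ **(ii)** Suppose $\sum_k|k|\hat V(k)<\infty$. Let $V(x)=(2\pi)^{-2}\sum_k\hat V(k)e^{ik\cdot x}$ be the periodic potential with Fourier coefficients $\int_{[0,2\pi]^2}V(x)e^{-ik\cdot x}\,dx=\hat V(k)$, let $$H_N=\hbar^2\sum_{j=1}^N(-\Delta_{x_j})+\frac1N\sum_{1\le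 i<j\le N}V(x_i-x_j)$$ on the antisymmetric subspace of $L^2([0,2\pi]^2)^{\otimes N}$ with periodic boundary conditions, and let $E_{\rm FS}=\langle\psi_{\rm FS},H_N\psi_{\rm FS}\rangle$. Then for every $C_0\in\mathbb R$ and every $\varepsilon>0$ there is a constant $C_\varepsilon>0$, independent of $k_{\rm F}$, $N$, $\xi$ and $k$, such that the following holds for all $\xi\in\mathcal F$ with $\|\xi\|=1$: if $R\xi$ is an $N$-particle state, $\langle R\xi,H_NR\xi\rangle-E_{\rm FS}\le C_0\hbar$, and $R\xi$ is an eigenvector of $H_N$, then $$\|d(k)\xi\|^2\le C_\varepsilon N^{\frac12-\frac1{68}+\varepsilon}\quad\text{for all }k\in\mathbb Z^2,\qquad |\langle\xi,\mathcal E_1\xi\rangle|\le C_\varepsilon\,\hbar\,N^{-\frac1{68}+\varepsilon}.$$ -/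

import Mathlib

namespace FermiGas

noncomputable section

/-! ### Momenta, Fermi ball -/

/-- Momenta, i.e. points of the lattice `ℤ²`. The lexicographic order is used only to fix the order
of the factors in Slater determinants and the resulting signs. -/
abbrev Mode := ℤ ×ₗ ℤ

/-- `|p|²`. -/
def normSq (p : Mode) : ℝ := ((ofLex p).1 : ℝ) ^ 2 + ((ofLex p).2 : ℝ) ^ 2

/-- The Euclidean length `|p|`. -/
def modeNorm (p : Mode) : ℝ := Real.sqrt (normSq p)

/-- The Fermi ball `B_F = {p ∈ ℤ² : |p| < k_F}`. -/
def fermiBall (kF : ℝ) : Finset Mode :=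
  ((Finset.Icc (-⌈kF⌉) ⌈kF⌉ ×ˢ Finset.Icc (-⌈kF⌉) ⌈kF⌉).map toLex.toEmbedding).filter
    (fun p => modeNorm p < kF)

theorem mem_fermiBall {kF : ℝ} {p : Mode} : p ∈ fermiBall kF ↔ modeNorm p < kF := by
  unfold fermiBall
  rw [Finset.mem_filter]
  refine ⟨fun h => h.2, fun h => ⟨?_, h⟩⟩
  have hpos : 0 ≤ modeNorm p := Real.sqrt_nonneg _
  have hsq : modeNorm p ^ 2 = normSq p := by
    unfold modeNorm normSq
    exact Real.sq_sqrt (by positivity)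
  have hc : kF ≤ (⌈kF⌉ : ℝ) := Int.le_ceil kF
  have h1 : |((ofLex p).1 : ℝ)| ≤ (⌈kF⌉ : ℝ) := by
    refine abs_le_of_sq_le_sq (le_trans ?_ (pow_le_pow_left₀ hpos (h.le.trans hc) 2))
      (hpos.trans (h.le.trans hc))
    rw [hsq]; unfold normSq; nlinarith [sq_nonneg ((ofLex p).2 : ℝ)]
  have h2 : |((ofLex p).2 : ℝ)| ≤ (⌈kF⌉ : ℝ) := by
    refine abs_le_of_sq_le_sq (le_trans ?_ (pow_le_pow_left₀ hpos (h.le.trans hc) 2))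
      (hpos.trans (h.le.trans hc))
    rw [hsq]; unfold normSq; nlinarith [sq_nonneg ((ofLex p).1 : ℝ)]
  rw [abs_le] at h1 h2
  rw [Finset.mem_map]
  refine ⟨ofLex p, ?_, rfl⟩
  rw [Finset.mem_product, Finset.mem_Icc, Finset.mem_Icc]
  exact ⟨⟨by exact_mod_cast h1.1, by exact_mod_cast h1.2⟩,
    ⟨by exact_mod_cast h2.1, by exact_mod_cast h2.2⟩⟩

/-- `k_F` is an admissible Fermi momentum: `k_F > 0` and
`k_F² = (inf_{p ∉ B_F} |p|² + sup_{q ∈ B_F} |q|²) / 2`. -/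
def IsFermiMomentum (kF : ℝ) : Prop :=
  0 < kF ∧
    kF ^ 2 = (sInf (normSq '' {p | p ∉ fermiBall kF}) + sSup (normSq '' {q | q ∈ fermiBall kF})) / 2

/-- The particle number `N = |B_F|`. -/
def particleNumber (kF : ℝ) : ℕ := (fermiBall kF).card

/-- `ħ = N^{-1/2}`. -/
def hbar (N : ℕ) : ℝ := (N : ℝ) ^ (-(1 / 2) : ℝ)

/-! ### Fock space in the plane-wave occupation representation -/

/-- The fermionic Fock space over `L²(𝕋²)`, in the orthonormal basis `|S⟩ = a*_{p₁} ⋯ a*_{pₙ} Ω`,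
where `S = {p₁ < ⋯ < pₙ}` runs over the finite sets of momenta; `|S⟩` is the Slater determinant
`slater n S` below. A vector is given by its square summable amplitudes `ξ S`. -/
abbrev Fock := lp (fun _ : Finset Mode => ℂ) 2

/-- `(-1)^{#{q ∈ S : q < p}}`. -/
def jwSign (p : Mode) (S : Finset Mode) : ℂ := (-1) ^ (S.filter (fun q => q < p)).card

/-- The annihilation operator `a_p` on amplitudes: `a_p |S⟩ = ± |S \ {p}⟩` if `p ∈ S`, and
`a_p |S⟩ = 0` otherwise. -/
def ann (p : Mode) (ξ : Finset Mode → ℂ) : Finset Mode → ℂ :=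
  fun S => if p ∈ S then 0 else jwSign p S * ξ (insert p S)

/-- The creation operator `a*_p` on amplitudes: `a*_p |S⟩ = ± |S ∪ {p}⟩` if `p ∉ S`, and
`a*_p |S⟩ = 0` otherwise. -/
def cre (p : Mode) (ξ : Finset Mode → ℂ) : Finset Mode → ℂ :=
  fun S => if p ∈ S then jwSign p S * ξ (S.erase p) else 0

/-- The sign in `R |S⟩ = ± |S ∆ B_F⟩`. -/
def phSign (B S : Finset Mode) : ℂ := ∏ p ∈ S, jwSign p B

theorem norm_phSign (B S : Finset Mode) : ‖phSign B S‖ = 1 := by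
  simp [phSign, jwSign]

/-- The unitary particle--hole transformation, `R |S⟩ = ± |S ∆ B|`. It satisfies `R Ω = |B⟩` and
`R* a_p R = a_p` for `p ∉ B`, `R* a_p R = a*_p` for `p ∈ B` (see `ann_particleHole`). -/
def particleHole (B : Finset Mode) (ξ : Fock) : Fock :=
  ⟨fun S => phSign B (symmDiff S B) * ξ (symmDiff S B), by
    have h : Memℓp (fun S => ξ S) 2 := lp.memℓp ξ
    have h2 : 0 < (2 : ENNReal).toReal := by norm_num
    change Memℓp (fun S => phSign B (symmDiff S B) * ξ (symmDiff S B)) 2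
    rw [memℓp_gen_iff h2] at h ⊢
    have hinv : Function.Involutive (fun S : Finset Mode => symmDiff S B) :=
      fun S => symmDiff_symmDiff_cancel_right B S
    have := (hinv.toPerm _).summable_iff.mpr h
    refine this.congr fun S => ?_
    simp [norm_phSign, Function.Involutive.toPerm]⟩

theorem jwSign_symmDiff (p : Mode) (S B : Finset Mode) :
    jwSign p (symmDiff S B) = jwSign p S * jwSign p B := by
  unfold jwSign
  rw [← pow_add]
  have h : (S.filter (fun q => q < p)).card + (B.filter (fun q => q < p)).card
      = ((symmDiff S B).filter (fun q => q < p)).card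
        + 2 * ((S ∩ B).filter (fun q => q < p)).card := by
    have h1 : (symmDiff S B).filter (fun q => q < p)
        = (S.filter (fun q => q < p) \ B.filter (fun q => q < p))
          ∪ (B.filter (fun q => q < p) \ S.filter (fun q => q < p)) := by
      ext x; simp only [Finset.mem_filter, Finset.mem_symmDiff, Finset.mem_union,
        Finset.mem_sdiff]; tauto
    have h2 : (S ∩ B).filter (fun q => q < p)
        = S.filter (fun q => q < p) ∩ B.filter (fun q => q < p) := by
      ext x; simp only [Finset.mem_filter, Finset.mem_inter]; tauto
    rw [h1, h2, Finset.card_union_of_disjoint disjoint_sdiff_sdiff]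
    have h3 := Finset.card_sdiff_add_card_inter (S.filter (fun q => q < p))
      (B.filter (fun q => q < p))
    have h4 := Finset.card_sdiff_add_card_inter (B.filter (fun q => q < p))
      (S.filter (fun q => q < p))
    rw [Finset.inter_comm] at h4
    omega
  rw [h, pow_add, pow_mul]
  simp

/-- The defining property of the particle--hole transformation, as `a_p R = R (R* a_p R)`. -/
theorem ann_particleHole (B : Finset Mode) (ξ η : Fock) (p : Mode)
    (hη : (η : Finset Mode → ℂ) = if p ∈ B then cre p ξ else ann p ξ) :
    ann p (particleHole B ξ) = particleHole B η := by
  have hjj : ∀ S, jwSign p S * jwSign p S = 1 := fun S => by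
    simp [jwSign, ← mul_pow]
  funext S
  change (if p ∈ S then 0 else jwSign p S *
    (phSign B (symmDiff (insert p S) B) * ξ (symmDiff (insert p S) B)))
      = phSign B (symmDiff S B) * η (symmDiff S B)
  rw [hη]
  by_cases hB : p ∈ B <;> by_cases hS : p ∈ S
  · have : p ∉ symmDiff S B := by simp [Finset.mem_symmDiff, hB, hS]
    simp [hB, hS, cre, this]
  · have hm : p ∈ symmDiff S B := by simp [Finset.mem_symmDiff, hB, hS]
    have he : symmDiff (insert p S) B = (symmDiff S B).erase p := by
      ext x; by_cases hx : x = p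
      · subst hx; simp [Finset.mem_symmDiff, hB]
      · simp [Finset.mem_symmDiff, hx]
    have hp : phSign B (symmDiff S B) = jwSign p B * phSign B ((symmDiff S B).erase p) := by
      unfold phSign; rw [Finset.mul_prod_erase _ (fun q => jwSign q B) hm]
    simp only [hB, hS, cre, hm, if_true, if_false, he, hp, jwSign_symmDiff]
    linear_combination (-jwSign p S * phSign B ((symmDiff S B).erase p) *
      ξ ((symmDiff S B).erase p)) * hjj B
  · have : p ∈ symmDiff S B := by simp [Finset.mem_symmDiff, hB, hS]
    simp [hB, hS, ann, this]
  · have hm : p ∉ symmDiff S B := by simp [Finset.mem_symmDiff, hB, hS]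
    have he : symmDiff (insert p S) B = insert p (symmDiff S B) := by
      ext x; by_cases hx : x = p
      · subst hx; simp [Finset.mem_symmDiff, hB]
      · simp [Finset.mem_symmDiff, hx]
    have hp : phSign B (insert p (symmDiff S B)) = jwSign p B * phSign B (symmDiff S B) := by
      unfold phSign; rw [Finset.prod_insert hm]
    simp only [hB, hS, ann, hm, if_false, he, hp, jwSign_symmDiff]
    ring

/-- `⟨ξ, A ξ⟩` for an operator `A` on amplitudes. -/
def expect (A : (Finset Mode → ℂ) → (Finset Mode → ℂ)) (ξ : Finset Mode → ℂ) : ℂ :=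
  ∑' S, starRingEnd ℂ (ξ S) * A ξ S

/-! ### The operators `d(k)`, `𝓔₁` and its truncation -/

/-- `d(k) = ∑_{p ∈ B_Fᶜ ∩ (B_Fᶜ + k)} a*_{p-k} a_p - ∑_{h ∈ B_F ∩ (B_F - k)} a*_{h+k} a_h`.
For each `S` only finitely many terms contribute to the first sum (those with `p - k ∈ S`). -/
def dOp (B : Finset Mode) (k : Mode) (ξ : Finset Mode → ℂ) : Finset Mode → ℂ :=
  fun S => (∑ᶠ (p : Mode) (_ : p ∉ B ∧ p - k ∉ B), cre (p - k) (ann p ξ) S)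
    - ∑ h ∈ B.filter (fun h => h + k ∈ B), cre (h + k) (ann h ξ) S

/-- The adjoint
`d*(k) = ∑_{p ∈ B_Fᶜ ∩ (B_Fᶜ + k)} a*_p a_{p-k} - ∑_{h ∈ B_F ∩ (B_F - k)} a*_h a_{h+k}`. -/
def dStar (B : Finset Mode) (k : Mode) (ξ : Finset Mode → ℂ) : Finset Mode → ℂ :=
  fun S => (∑ᶠ (p : Mode) (_ : p ∉ B ∧ p - k ∉ B), cre p (ann (p - k) ξ) S)
    - ∑ h ∈ B.filter (fun h => h + k ∈ B), cre h (ann (h + k) ξ) S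

/-- `(2 (2π)² N)⁻¹ ∑_{k ∈ K} V̂(k) d*(k) d(k)` for a set `K` of momenta. -/
def opE1On (Vhat : Mode → ℝ) (kF : ℝ) (K : Set Mode) (ξ : Finset Mode → ℂ) : Finset Mode → ℂ :=
  fun S => ((1 / (2 * (2 * Real.pi) ^ 2 * (particleNumber kF : ℝ)) : ℝ) : ℂ) *
    ∑' k : K, (Vhat k : ℂ) * dStar (fermiBall kF) k (dOp (fermiBall kF) k ξ) S

/-- `𝓔₁`, the sum over all `k ≠ 0`. -/
def opE1 (Vhat : Mode → ℝ) (kF : ℝ) : (Finset Mode → ℂ) → (Finset Mode → ℂ) :=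
  opE1On Vhat kF {k | k ≠ 0}

/-- The truncation of `𝓔₁`, the sum over `k ≠ 0` with `|k| < Λ N^{1/2}`. -/
def opE1Trunc (Vhat : Mode → ℝ) (kF Λ : ℝ) : (Finset Mode → ℂ) → (Finset Mode → ℂ) :=
  opE1On Vhat kF {k | k ≠ 0 ∧ modeNorm k < Λ * (particleNumber kF : ℝ) ^ (1 / 2 : ℝ)}

/-! ### The `N`-particle Hamiltonian -/

/-- `k · x`. -/
def modeDot (k : Mode) (x : Fin 2 → ℝ) : ℝ := ((ofLex k).1 : ℝ) * x 0 + ((ofLex k).2 : ℝ) * x 1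

/-- The `2π`-periodic pair potential with Fourier coefficients
`∫_{[0,2π]²} V(x) e^{-ik·x} dx = V̂(k)`, that is `V(x) = (2π)⁻² ∑_k V̂(k) e^{ik·x}`. As `V̂` is
even, `e^{ik·x}` may be replaced by its real part. -/
def potential (Vhat : Mode → ℝ) (x : Fin 2 → ℝ) : ℝ :=
  (1 / (2 * Real.pi) ^ 2) * ∑' k : Mode, Vhat k * Real.cos (modeDot k x)

/-- `e_p(x) = (2π)⁻¹ e^{ip·x}`. -/
def planeWave (p : Mode) (x : Fin 2 → ℝ) : ℂ :=
  ((1 / (2 * Real.pi) : ℝ) : ℂ) * Complex.exp (Complex.I * (modeDot p x : ℂ))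

/-- Sets of `n` momenta. -/
abbrev NConf (n : ℕ) := {S : Finset Mode // S.card = n}

/-- The Slater determinant `(n!)^{-1/2} det (e_{p_j}(x_l))_{j,l}` for `S = {p₁ < ⋯ < pₙ}`. -/
def slater (n : ℕ) (S : NConf n) (x : Fin n → Fin 2 → ℝ) : ℂ :=
  (((n.factorial : ℝ) ^ (-(1 / 2) : ℝ) : ℝ) : ℂ) *
    Matrix.det (Matrix.of fun j l : Fin n => planeWave (S.1.orderEmbOfFin S.2 j) (x l))

/-- The differential operator
`H_n = ħ² ∑_j (-Δ_{x_j}) + n⁻¹ ∑_{i<j} V(x_i - x_j)` with `ħ = n^{-1/2}`, on smooth functions. -/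
def hamDiff (V : (Fin 2 → ℝ) → ℝ) (n : ℕ) (φ : (Fin n → Fin 2 → ℝ) → ℂ)
    (x : Fin n → Fin 2 → ℝ) : ℂ :=
  ((hbar n ^ 2 : ℝ) : ℂ) * (∑ j : Fin n, -(∑ i : Fin 2, iteratedDeriv 2
      (fun t : ℝ => φ (Function.update x j (Function.update (x j) i t))) (x j i)))
    + ((1 / (n : ℝ) : ℝ) : ℂ) *
      (∑ i : Fin n, ∑ j : Fin n, if i < j then (V (x i - x j) : ℂ) * φ x else 0)

/-- The matrix element `⟨S, H_n T⟩` in `L²([0,2π]^{2n})`. -/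
def hamMatrix (V : (Fin 2 → ℝ) → ℝ) (n : ℕ) (S T : NConf n) : ℂ :=
  ∫ x in Set.Icc (0 : Fin n → Fin 2 → ℝ) (fun _ _ => 2 * Real.pi),
    starRingEnd ℂ (slater n S x) * hamDiff V n (slater n T) x

/-- `ψ` lies in the `n`-particle subspace of Fock space. -/
def InSector (n : ℕ) (ψ : Fock) : Prop := ∀ S, S.card ≠ n → ψ S = 0

/-- `ψ` is in the domain of the self-adjoint operator `H_n` and `H_n ψ = η`. This is the graph of
the maximal operator of the matrix of `H_n` in the Slater basis, i.e. of the adjoint of `H_n`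
restricted to finite linear combinations of Slater determinants. For a bounded potential the
latter is essentially self-adjoint, so that this is the usual operator on the Sobolev space `H²`. -/
def IsHamImage (V : (Fin 2 → ℝ) → ℝ) (n : ℕ) (ψ η : Fock) : Prop :=
  InSector n ψ ∧ InSector n η ∧
    ∀ S : NConf n, HasSum (fun T : NConf n => hamMatrix V n S T * ψ T.1) (η S.1)

/-- `ψ` is an eigenvector of `H_n`. -/
def IsEigenvector (V : (Fin 2 → ℝ) → ℝ) (n : ℕ) (ψ : Fock) : Prop :=
  ψ ≠ 0 ∧ ∃ E : ℝ, IsHamImage V n ψ ((E : ℂ) • ψ)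

/-- `E_FS = ⟨ψ_FS, H_N ψ_FS⟩`, where `ψ_FS` is the Slater determinant of the Fermi ball. -/
def fermiSeaEnergy (V : (Fin 2 → ℝ) → ℝ) (kF : ℝ) : ℝ :=
  (hamMatrix V (particleNumber kF) ⟨fermiBall kF, rfl⟩ ⟨fermiBall kF, rfl⟩).re

/-- `ξ` belongs to an approximate ground state `R ξ`, with constant `C`: `R ξ` is an `N`-particle
state, `‖ξ‖ = 1` and `⟨R ξ, H_N R ξ⟩ - E_FS ≤ C ħ`. -/
def BelongsToApproxGroundState (V : (Fin 2 → ℝ) → ℝ) (kF C : ℝ) (ξ : Fock) : Prop :=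
  InSector (particleNumber kF) (particleHole (fermiBall kF) ξ) ∧ ‖ξ‖ = 1 ∧
    ∃ η : Fock, IsHamImage V (particleNumber kF) (particleHole (fermiBall kF) ξ) η ∧
      (inner ℂ (particleHole (fermiBall kF) ξ) η).re - fermiSeaEnergy V kF
        ≤ C * hbar (particleNumber kF)

end

end FermiGas

namespace FermiGas
open Zsqrtd

/-! ### Lattice points on circles -/

/-! For `k ≠ 0` every operator here is a sum of hops: one momentum of an occupied set moves by `±k`,
with an amplitude of modulus at most one. All estimates therefore replace amplitudes by absolute
values (`dAbs`) and bound hop sums by a Schur test (`tsum_hop_sq_le`): the squared norm is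
controlled by the number of admissible hops out of a set times the number of admissible hops into a
set. In `ℝ≥0∞` sums can be exchanged freely, and summability of the true series follows from
finiteness of the bound.

(i) If both hop counts are bounded by the particle number, the majorant of `d(k)` has squared norm
at most `4⟨𝒩²⟩`. Cauchy–Schwarz with weights `|k|^{±(2-b)/2}` bounds the sum of `V̂` over `0 < |k| <
X` by `C X^{b/2}`, since the sum of `|k|^{b-2}` over this range is `O(X^b)`. With `X = Λ N^{1/2}`
this is `N^{b/4}`, and the prefactor of the operator supplies `N⁻¹`.

(ii) Let `ψ = Rξ`, let `n(S) = |S ∆ B_F|` count the excitations of a configuration, and let `T(S) =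
ħ² ∑_{p ∈ S ∆ B_F} ||p|² - k_F²|` be their kinetic energy. In the Slater basis `H_N` is kinetic
energy plus a constant plus `c ∑_{k≠0} V̂(k) ρ_k* ρ_k` (`exists_hamMatrix_eq`). The interaction part
is non-negative, and in the Fermi sea it is only `O(ħ)`, because `O(|k| √N)` momenta can leave the
ball (`exitCount_le`). Hence `⟨T⟩ = O(ħ)`. Testing the eigenvalue equation against `nψ` and
commuting `n` through `ρ_k` costs only hops across the Fermi surface, so `⟨n T⟩ ≤ C ħ (⟨n⟩ + 1)`
(`EigenState.energy_bounds`). This is where the eigenvector property is essential.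

Lattice point counts then convert energy into numbers. Write `N = t^200`. By the divisor bound for
points on circles, the shell `||p|² - k_F²| ≤ t^50` has at most `C t^51` points, while each
excitation outside it costs at least `ħ² t^50 = t^{-150}`; so `⟨n⟩ ≤ C t^51`
(`exists_card_le_excEnergy`). For `d(k)`, call `p` high if `||p|² - k_F²| > t^54`. Hops with a high
end contribute, besides a term of order `⟨n⟩`, at most a multiple of `⟨n · #high⟩ ≤ t^146 ⟨n T⟩ ≤ C
t^{146-100+51} = C t^97`. Hops with two low ends are few: two thin annuli shifted by `k` share at
most `C t^48` lattice points, because points in a short piece of a thin annulus are collinear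
(`exists_card_pair_le`), which contributes `t^96`. Altogether `‖d(k)ξ‖² ≤ C N^{97/200}`, and `97/200
= 1/2 - 3/200 < 1/2 - 1/68`. Summing against `V̂` gives the bound on `𝓔₁`. -/

theorem finite_gaussianInt_norm_eq (n : ℕ) : {z : GaussianInt | z.norm = n}.Finite := by
  have hinj : Function.Injective (fun z : GaussianInt => (z.re, z.im)) := by
    intro z w h
    simp only [Prod.mk.injEq] at h
    exact Zsqrtd.ext h.1 h.2
  refine Set.Finite.of_finite_image (f := fun z : GaussianInt => (z.re, z.im)) ?_ hinj.injOn
  refine (Set.finite_Icc ((-n : ℤ), (-n : ℤ)) ((n : ℤ), (n : ℤ))).subset ?_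
  rintro _ ⟨z, hz, rfl⟩
  simp only [Set.mem_ofPred_eq, Zsqrtd.norm_def] at hz
  have h1 : |z.re| ≤ z.re * z.re := by rw [← abs_mul_abs_self]; nlinarith [abs_nonneg z.re, Int.le_self_sq |z.re|]
  have h2 : |z.im| ≤ z.im * z.im := by rw [← abs_mul_abs_self]; nlinarith [abs_nonneg z.im, Int.le_self_sq |z.im|]
  have h3 := abs_le.1 (show |z.re| ≤ n by nlinarith [mul_self_nonneg z.im])
  have h4 := abs_le.1 (show |z.im| ≤ n by nlinarith [mul_self_nonneg z.re])
  exact ⟨⟨h3.1, h4.1⟩, ⟨h3.2, h4.2⟩⟩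

theorem gaussianInt_mul_star_eq_norm (z : GaussianInt) : z * star z = (z.norm : GaussianInt) := by
  rw [Zsqrtd.norm_eq_mul_conj]

/-- If `a > 0`, then `π` divides `z * star z`, so `π` or `star π` divides `z`. Cancelling that
factor removes `p ^ f` from the norm, and one inducts on `a`. Keeping `f` general avoids any case
distinction between split, inert and ramified primes. -/
theorem gaussianInt_factor (p m : ℕ) (hp : p.Prime) (hpm : ¬ p ∣ m) (π : GaussianInt)
    (hπ : Prime π) (hπp : π ∣ (p : GaussianInt)) (f : ℕ) (hf0 : 0 < f)
    (hf : π.norm = (p : ℤ) ^ f) (a : ℕ) :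
    ∀ z : GaussianInt, z.norm = (p : ℤ) ^ a * m →
      ∃ i j w, f * (i + j) = a ∧ z = π ^ i * star π ^ j * w ∧ w.norm = m := by
  have hp0 : (p : ℤ) ≠ 0 := by exact_mod_cast hp.ne_zero
  have hsn : (star π).norm = (p : ℤ) ^ f := by rw [Zsqrtd.norm_conj, hf]
  induction a using Nat.strong_induction_on with
  | _ a ih =>
    intro z hz
    rcases Nat.eq_zero_or_pos a with rfl | ha
    · exact ⟨0, 0, z, by simp, by simp, by simpa using hz⟩
    have hdvd : π ∣ z * star z := by
      rw [gaussianInt_mul_star_eq_norm, hz]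
      refine hπp.trans ?_
      push_cast
      exact Dvd.dvd.mul_right (dvd_pow_self _ ha.ne') _
    have key : ∀ u z' : GaussianInt, u.norm = (p : ℤ) ^ f → z = u * z' →
        f ≤ a ∧ z'.norm = (p : ℤ) ^ (a - f) * m := by
      intro u z' hu hzu
      have h1 : (p : ℤ) ^ f * z'.norm = (p : ℤ) ^ a * m := by
        rw [← hz, hzu, Zsqrtd.norm_mul, hu]
      have h2 : p ^ f ∣ p ^ a * m := by
        have : (p : ℤ) ^ f ∣ (p : ℤ) ^ a * m := ⟨_, h1.symm⟩
        exact_mod_cast this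
      have h3 : p ^ f ∣ p ^ a :=
        (Nat.Coprime.pow_left f ((Nat.Prime.coprime_iff_not_dvd hp).2 hpm)).dvd_of_dvd_mul_right h2
      have h4 : f ≤ a := (Nat.pow_dvd_pow_iff_le_right hp.one_lt).1 h3
      refine ⟨h4, ?_⟩
      have h5 : (p : ℤ) ^ a = (p : ℤ) ^ f * (p : ℤ) ^ (a - f) := by
        rw [← pow_add, Nat.add_sub_cancel' h4]
      rw [h5, mul_assoc] at h1
      exact mul_left_cancel₀ (pow_ne_zero _ hp0) h1
    rcases hπ.dvd_or_dvd hdvd with ⟨z', h⟩ | h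
    · obtain ⟨hfa, hn⟩ := key π z' hf h
      obtain ⟨i, j, w, hij, hw, hwn⟩ := ih (a - f) (by omega) z' hn
      refine ⟨i + 1, j, w, ?_, ?_, hwn⟩
      · have : f * (i + 1 + j) = f * (i + j) + f := by ring
        omega
      · rw [h, hw]; ring
    · obtain ⟨z', h⟩ := h
      have h' : z = star π * star z' := by
        rw [← star_star z, h, star_mul, mul_comm]
      obtain ⟨hfa, hn⟩ := key _ _ hsn h'
      obtain ⟨i, j, w, hij, hw, hwn⟩ := ih (a - f) (by omega) _ hn
      refine ⟨i, j + 1, w, ?_, ?_, hwn⟩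
      · have : f * (i + (j + 1)) = f * (i + j) + f := by ring
        omega
      · rw [h', hw]; ring

/-- In the factorization of `gaussianInt_factor` the sum `i + j = a / f` is fixed, so `z` is
determined by `i ≤ a` and by the cofactor `w`. A prime power thus costs a factor `a + 1`, as it does
for the number of divisors. -/
theorem ncard_gaussianInt_norm_le (p a m : ℕ) (hp : p.Prime) (hpm : ¬ p ∣ m) :
    {z : GaussianInt | z.norm = (p ^ a * m : ℕ)}.ncard
      ≤ (a + 1) * {z : GaussianInt | z.norm = m}.ncard := by
  have hpu : ¬ IsUnit (p : GaussianInt) := by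
    intro h
    rw [← Zsqrtd.norm_eq_one_iff, Zsqrtd.norm_natCast] at h
    have h2 := hp.two_le
    rw [Int.natAbs_mul] at h
    simp at h
    omega
  have hp0 : (p : GaussianInt) ≠ 0 := by exact_mod_cast hp.ne_zero
  obtain ⟨π, hπ, hπp⟩ := WfDvdMonoid.exists_irreducible_factor hpu hp0
  have hπ' : Prime π := hπ.prime
  obtain ⟨c, hc⟩ := hπp
  have hn : π.norm * c.norm = (p : ℤ) ^ 2 := by
    rw [← Zsqrtd.norm_mul, ← hc, Zsqrtd.norm_natCast, sq]
  have hd : π.norm.natAbs ∣ p ^ 2 := by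
    have : π.norm ∣ (p : ℤ) ^ 2 := ⟨_, hn.symm⟩
    have := Int.natAbs_dvd_natAbs.2 this
    simpa [Int.natAbs_pow] using this
  obtain ⟨f, -, hf⟩ := (Nat.dvd_prime_pow hp).1 hd
  have hf' : π.norm = (p : ℤ) ^ f := by
    have := GaussianInt.abs_natCast_norm π
    rw [← this, hf]; simp
  have hf0 : 0 < f := by
    rcases Nat.eq_zero_or_pos f with rfl | h
    · exact absurd (Zsqrtd.norm_eq_one_iff.1 (by simpa using hf)) hπ.not_isUnit
    · exact h
  set S := {z : GaussianInt | z.norm = m}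
  have hS : S.Finite := finite_gaussianInt_norm_eq m
  have hsub : {z : GaussianInt | z.norm = (p ^ a * m : ℕ)} ⊆
      (fun x : ℕ × GaussianInt => π ^ x.1 * star π ^ (a / f - x.1) * x.2) ''
        ((Set.Iio (a + 1)) ×ˢ S) := by
    intro z hz
    obtain ⟨i, j, w, hij, hw, hwn⟩ := gaussianInt_factor p m hp hpm π hπ' ⟨c, hc⟩ f hf0 hf' a z
      (by rw [Set.mem_ofPred_eq] at hz; rw [hz]; push_cast; ring)
    refine ⟨(i, w), ⟨?_, hwn⟩, ?_⟩
    · simp only [Set.mem_Iio]; nlinarith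
    · have : a / f = i + j := by rw [← hij, Nat.mul_div_cancel_left _ hf0]
      simp only [this, Nat.add_sub_cancel_left, hw]
  have hfin : ((Set.Iio (a + 1)) ×ˢ S).Finite := (Set.finite_Iio _).prod hS
  calc _ ≤ _ := Set.ncard_le_ncard hsub (hfin.image _)
    _ ≤ _ := Set.ncard_image_le hfin
    _ = _ := by rw [Set.ncard_prod, Set.ncard_eq_toFinset_card']; simp

/-- The classical proof of the divisor bound. The threshold `P` makes `p ^ ε ≥ 2` for `p ≥ P`, so
such primes satisfy `a + 1 ≤ 2 ^ a ≤ p ^ (a ε)` and lose nothing. Each smaller prime loses the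
factor `K`, chosen with `K ε log 2 ≥ 1`, and there are at most `P` of them. -/
theorem ncard_gaussianInt_norm_isBigO (ε : ℝ) (hε : 0 < ε) :
    ∃ C : ℝ, 0 < C ∧ ∀ n : ℕ, 0 < n →
      ({z : GaussianInt | z.norm = n}.ncard : ℝ) ≤ C * (n : ℝ) ^ ε := by
  set P : ℕ := ⌈(2 : ℝ) ^ (1 / ε)⌉₊ with hP
  set K : ℝ := max 1 (1 / (ε * Real.log 2)) with hK
  have hlog : 0 < Real.log 2 := Real.log_pos (by norm_num)
  have hK1 : 1 ≤ K := le_max_left _ _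
  have hKe : 1 ≤ K * (ε * Real.log 2) := by
    have : 1 / (ε * Real.log 2) ≤ K := le_max_right _ _
    rwa [div_le_iff₀ (by positivity)] at this
  set r : ℕ → ℝ := fun n => ({z : GaussianInt | z.norm = n}.ncard : ℝ) with hr
  have hsmall : ∀ p a : ℕ, 2 ≤ p → ((a : ℝ) + 1) ≤ K * ((p : ℝ) ^ a) ^ ε := by
    intro p a hp
    have h2 : (2 : ℝ) ≤ p := by exact_mod_cast hp
    have h1 : ((2 : ℝ) ^ a) ^ ε ≤ ((p : ℝ) ^ a) ^ ε := by gcongr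
    have h3 : 1 + a * (ε * Real.log 2) ≤ ((2 : ℝ) ^ a) ^ ε := by
      rw [← Real.rpow_natCast, ← Real.rpow_mul (by norm_num), Real.rpow_def_of_pos (by norm_num)]
      have := Real.add_one_le_exp (Real.log 2 * (a * ε))
      linarith
    have ha : (0 : ℝ) ≤ a := Nat.cast_nonneg _
    calc (a : ℝ) + 1 ≤ K * (1 + a * (ε * Real.log 2)) := by nlinarith
      _ ≤ _ := by gcongr; exact h3.trans h1
  have hlarge : ∀ p a : ℕ, P ≤ p → ((a : ℝ) + 1) ≤ ((p : ℝ) ^ a) ^ ε := by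
    intro p a hp
    have h1 : (2 : ℝ) ^ (1 / ε) ≤ p := (Nat.le_ceil _).trans (by exact_mod_cast hp)
    have h2 : (2 : ℝ) ≤ (p : ℝ) ^ ε := by
      calc (2 : ℝ) = ((2 : ℝ) ^ (1 / ε)) ^ ε := by
            rw [← Real.rpow_mul (by norm_num), one_div_mul_cancel hε.ne', Real.rpow_one]
        _ ≤ _ := by gcongr
    have h3 : ((p : ℝ) ^ a) ^ ε = ((p : ℝ) ^ ε) ^ a := by
      rw [← Real.rpow_natCast, ← Real.rpow_natCast, ← Real.rpow_mul (by positivity),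
        ← Real.rpow_mul (by positivity), mul_comm]
    rw [h3]
    have h4 : (a : ℝ) + 1 ≤ 2 ^ a := by exact_mod_cast Nat.lt_two_pow_self
    exact h4.trans (by gcongr)
  have main : ∀ n : ℕ, 0 < n →
      r n ≤ r 1 * K ^ (n.primeFactors.filter (· < P)).card * (n : ℝ) ^ ε := by
    intro n
    induction n using Nat.strong_induction_on with
    | _ n ih =>
      intro hn
      rcases eq_or_ne n 1 with rfl | hn1
      · simp
      obtain ⟨p, hp, hpn⟩ := Nat.exists_prime_and_dvd hn1
      obtain ⟨a, m, hpm, hnm⟩ := Nat.exists_eq_pow_mul_and_not_dvd hn.ne' p hp.ne_one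
      have ha : a ≠ 0 := by
        rintro rfl
        exact hpm (by simpa [hnm] using hpn)
      have hm : 0 < m := by
        rcases Nat.eq_zero_or_pos m with rfl | h
        · simp at hpm
        · exact h
      have hmn : m < n := by
        rw [hnm]
        have : 1 < p ^ a := Nat.one_lt_pow ha hp.one_lt
        nlinarith
      have h1 : r n ≤ (a + 1) * r m := by
        have := ncard_gaussianInt_norm_le p a m hp hpm
        rw [← hnm] at this
        simp only [hr]
        exact_mod_cast this
      have h2 := ih m hmn hm
      have hpf : n.primeFactors = insert p m.primeFactors := by
        rw [hnm, Nat.primeFactors_mul (pow_ne_zero _ hp.ne_zero) hm.ne',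
          Nat.primeFactors_prime_pow ha hp]
        rfl
      have hpnm : p ∉ m.primeFactors := fun h => hpm (Nat.dvd_of_mem_primeFactors h)
      have hpow : (n : ℝ) ^ ε = ((p : ℝ) ^ a) ^ ε * (m : ℝ) ^ ε := by
        rw [hnm]; push_cast; rw [Real.mul_rpow (by positivity) (by positivity)]
      have hr1 : 0 ≤ r 1 := by simp only [hr]; positivity
      have hK0 : 0 ≤ K := zero_le_one.trans hK1
      rw [hpf, Finset.filter_insert, hpow]
      split_ifs with hpP
      · rw [Finset.card_insert_of_notMem (by simp [hpnm])]
        calc r n ≤ (a + 1) * r m := h1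
          _ ≤ (K * ((p : ℝ) ^ a) ^ ε) *
              (r 1 * K ^ (m.primeFactors.filter (· < P)).card * (m : ℝ) ^ ε) := by
            have := hsmall p a hp.two_le
            gcongr
          _ = _ := by ring
      · calc r n ≤ (a + 1) * r m := h1
          _ ≤ (((p : ℝ) ^ a) ^ ε) *
              (r 1 * K ^ (m.primeFactors.filter (· < P)).card * (m : ℝ) ^ ε) := by
            have := hlarge p a (by omega)
            gcongr
          _ = _ := by ring
  refine ⟨(r 1 + 1) * K ^ P, by simp only [hr]; positivity, fun n hn => (main n hn).trans ?_⟩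
  have h1 : (n.primeFactors.filter (· < P)).card ≤ P := by
    calc _ ≤ (Finset.range P).card := Finset.card_le_card (fun x hx => by
            simp only [Finset.mem_filter] at hx; simpa using hx.2)
      _ = P := Finset.card_range P
  have hr1 : 0 ≤ r 1 := by simp only [hr]; positivity
  gcongr
  · linarith

/-- `|p|²` as an integer. -/
def normSqInt (p : Mode) : ℤ := (ofLex p).1 ^ 2 + (ofLex p).2 ^ 2

theorem normSq_eq_cast (p : Mode) : normSq p = normSqInt p := by
  simp [normSq, normSqInt]

theorem normSqInt_nonneg (p : Mode) : 0 ≤ normSqInt p := by unfold normSqInt; positivity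

theorem card_le_of_normSqInt_eq (ε : ℝ) (hε : 0 < ε) :
    ∃ C : ℝ, 1 ≤ C ∧ ∀ (Y : ℝ), 1 ≤ Y → ∀ (n : ℤ), (n : ℝ) ≤ Y → ∀ F : Finset Mode,
      (∀ p ∈ F, normSqInt p = n) → (F.card : ℝ) ≤ C * Y ^ ε := by
  obtain ⟨C, hC, h⟩ := ncard_gaussianInt_norm_isBigO ε hε
  refine ⟨C + 1, by linarith, fun Y hY n hn F hF => ?_⟩
  have hY' : 1 ≤ Y ^ ε := Real.one_le_rpow hY hε.le
  rcases F.eq_empty_or_nonempty with rfl | ⟨p0, hp0⟩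
  · simp; positivity
  have hn0 : 0 ≤ n := by rw [← hF p0 hp0]; exact normSqInt_nonneg _
  lift n to ℕ using hn0
  have hinj : Function.Injective (fun p : Mode => (⟨(ofLex p).1, (ofLex p).2⟩ : GaussianInt)) := by
    intro p q hpq
    simp only [Zsqrtd.mk.injEq] at hpq
    exact ofLex.injective (Prod.ext hpq.1 hpq.2)
  have hcard : F.card ≤ {z : GaussianInt | z.norm = n}.ncard := by
    rw [← Set.ncard_coe_finset, ← Set.ncard_image_of_injective _ hinj]
    refine Set.ncard_le_ncard ?_ (finite_gaussianInt_norm_eq n)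
    rintro _ ⟨p, hp, rfl⟩
    have := hF p hp
    simp only [Set.mem_ofPred_eq, Zsqrtd.norm_def, ← this, normSqInt]
    ring
  rcases Nat.eq_zero_or_pos n with rfl | hn1
  · have : F.card ≤ 1 := by
      rw [Finset.card_le_one]
      have hz : ∀ p ∈ F, p = 0 := by
        intro p hp
        have := hF p hp
        unfold normSqInt at this
        have h1 : (ofLex p).1 = 0 := by
          push_cast at this
          nlinarith [sq_nonneg (ofLex p).1, sq_nonneg (ofLex p).2]
        have h2 : (ofLex p).2 = 0 := by
          push_cast at this
          nlinarith [sq_nonneg (ofLex p).1, sq_nonneg (ofLex p).2]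
        exact ofLex.injective (Prod.ext h1 h2)
      intro a ha b hb
      rw [hz a ha, hz b hb]
    have : (F.card : ℝ) ≤ 1 := by exact_mod_cast this
    nlinarith
  · calc (F.card : ℝ) ≤ ({z : GaussianInt | z.norm = n}.ncard : ℝ) := by exact_mod_cast hcard
      _ ≤ C * (n : ℝ) ^ ε := h n hn1
      _ ≤ (C + 1) * Y ^ ε := by
        have hn' : (n : ℝ) ≤ Y := by exact_mod_cast hn
        gcongr
        linarith

/-- On the shell `|p|²` takes at most `2δ + 1` integer values, and each value is a circle covered by
the divisor bound. -/
theorem card_shell_le (ε : ℝ) (hε : 0 < ε) :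
    ∃ C : ℝ, 1 ≤ C ∧ ∀ (X δ : ℝ), 0 ≤ δ → 1 ≤ X + δ → ∀ F : Finset Mode,
      (∀ p ∈ F, |normSq p - X| ≤ δ) → (F.card : ℝ) ≤ (2 * δ + 1) * (C * (X + δ) ^ ε) := by
  obtain ⟨C, hC, h⟩ := card_le_of_normSqInt_eq ε hε
  refine ⟨C, hC, fun X δ hδ hX F hF => ?_⟩
  have him : ∀ p ∈ F, normSqInt p ∈ Finset.Icc ⌈X - δ⌉ ⌊X + δ⌋ := by
    intro p hp
    have := abs_le.1 (hF p hp)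
    rw [normSq_eq_cast] at this
    rw [Finset.mem_Icc, Int.ceil_le, Int.le_floor]
    constructor <;> linarith
  rw [Finset.card_eq_sum_card_fiberwise him]
  push_cast
  calc _ ≤ ∑ n ∈ Finset.Icc ⌈X - δ⌉ ⌊X + δ⌋, C * (X + δ) ^ ε := by
        refine Finset.sum_le_sum fun n hn => ?_
        rw [Finset.mem_Icc, Int.le_floor] at hn
        exact h (X + δ) hX n hn.2 _ (fun p hp => (Finset.mem_filter.1 hp).2)
    _ = ((Finset.Icc ⌈X - δ⌉ ⌊X + δ⌋).card : ℝ) * (C * (X + δ) ^ ε) := by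
        rw [Finset.sum_const, nsmul_eq_mul]
    _ ≤ _ := by
        have : 0 ≤ C * (X + δ) ^ ε := by positivity
        refine mul_le_mul_of_nonneg_right ?_ this
        rw [Int.card_Icc]
        have h1 : ((⌊X + δ⌋ + 1 - ⌈X - δ⌉ : ℤ) : ℝ) ≤ 2 * δ + 1 := by
          push_cast
          have := Int.floor_le (X + δ)
          have := Int.le_ceil (X - δ)
          linarith
        have h2 : ((⌊X + δ⌋ + 1 - ⌈X - δ⌉).toNat : ℝ) = max ((⌊X + δ⌋ + 1 - ⌈X - δ⌉ : ℤ) : ℝ) 0 := by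
          rw [← Int.cast_natCast, Int.toNat_eq_max]; push_cast; rfl
        rw [h2]
        exact max_le h1 (by positivity)

end FermiGas

namespace FermiGas

/-! ### Geometry of lattice points -/

/-- First coordinate of a momentum. -/
def cx (p : Mode) : ℤ := (ofLex p).1

/-- Second coordinate of a momentum. -/
def cy (p : Mode) : ℤ := (ofLex p).2

@[simp] theorem cx_add (p q : Mode) : cx (p + q) = cx p + cx q := rfl
@[simp] theorem cy_add (p q : Mode) : cy (p + q) = cy p + cy q := rfl
@[simp] theorem cx_sub (p q : Mode) : cx (p - q) = cx p - cx q := rfl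
@[simp] theorem cy_sub (p q : Mode) : cy (p - q) = cy p - cy q := rfl
@[simp] theorem cx_neg (p : Mode) : cx (-p) = -cx p := rfl
@[simp] theorem cy_neg (p : Mode) : cy (-p) = -cy p := rfl
@[simp] theorem cx_zero : cx 0 = 0 := rfl
@[simp] theorem cy_zero : cy 0 = 0 := rfl

theorem mode_ext {p q : Mode} (h1 : cx p = cx q) (h2 : cy p = cy q) : p = q :=
  ofLex.injective (Prod.ext h1 h2)

theorem normSq_def (p : Mode) : normSq p = (cx p : ℝ) ^ 2 + (cy p : ℝ) ^ 2 := rfl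

theorem normSq_nonneg (p : Mode) : 0 ≤ normSq p := by rw [normSq_def]; positivity

theorem normSq_neg (p : Mode) : normSq (-p) = normSq p := by simp [normSq_def]

theorem modeNorm_neg (p : Mode) : modeNorm (-p) = modeNorm p := by simp [modeNorm, normSq_neg]

theorem modeNorm_nonneg (p : Mode) : 0 ≤ modeNorm p := Real.sqrt_nonneg _

theorem modeNorm_sq (p : Mode) : modeNorm p ^ 2 = normSq p := Real.sq_sqrt (normSq_nonneg p)

theorem one_le_normSq {p : Mode} (hp : p ≠ 0) : 1 ≤ normSq p := by
  have h : cx p ≠ 0 ∨ cy p ≠ 0 := by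
    by_contra! h
    exact hp (mode_ext h.1 h.2)
  rw [normSq_def]
  have : (1 : ℤ) ≤ cx p ^ 2 + cy p ^ 2 := by
    rcases h with h | h
    · have := Int.one_le_abs h
      nlinarith [sq_abs (cx p), sq_nonneg (cy p), abs_nonneg (cx p)]
    · have := Int.one_le_abs h
      nlinarith [sq_abs (cy p), sq_nonneg (cx p), abs_nonneg (cy p)]
  exact_mod_cast this

theorem one_le_modeNorm {p : Mode} (hp : p ≠ 0) : 1 ≤ modeNorm p := by
  rw [modeNorm, Real.one_le_sqrt]; exact one_le_normSq hp

theorem mem_fermiBall_iff_normSq {kF : ℝ} (h : 0 < kF) {p : Mode} :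
    p ∈ fermiBall kF ↔ normSq p < kF ^ 2 := by
  rw [mem_fermiBall, modeNorm, Real.sqrt_lt' h]

theorem abs_cx_le {p : Mode} {Y : ℝ} (hY : 0 ≤ Y) (h : normSq p ≤ Y ^ 2) : |(cx p : ℝ)| ≤ Y := by
  rw [normSq_def] at h
  exact abs_le_of_sq_le_sq (by nlinarith [sq_nonneg (cy p : ℝ)]) hY

theorem abs_cy_le {p : Mode} {Y : ℝ} (hY : 0 ≤ Y) (h : normSq p ≤ Y ^ 2) : |(cy p : ℝ)| ≤ Y := by
  rw [normSq_def] at h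
  exact abs_le_of_sq_le_sq (by nlinarith [sq_nonneg (cx p : ℝ)]) hY

/-- The condition `a ≤ b + 1` only keeps the bound non-negative when the interval contains no
integer. -/
theorem card_le_of_int_range {α : Type*} (F : Finset α) (f : α → ℤ) (hf : Set.InjOn f F) (a b : ℝ)
    (hab : a ≤ b + 1) (h : ∀ p ∈ F, a ≤ f p ∧ (f p : ℝ) ≤ b) : (F.card : ℝ) ≤ b - a + 1 := by
  classical
  have h1 : F.card ≤ (Finset.Icc ⌈a⌉ ⌊b⌋).card := by
    refine Finset.card_le_card_of_injOn f (fun p hp => ?_) hf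
    rw [Finset.mem_coe, Finset.mem_Icc, Int.ceil_le, Int.le_floor]
    exact h p hp
  have h2 : ((Finset.Icc ⌈a⌉ ⌊b⌋).card : ℝ) ≤ b - a + 1 := by
    rw [Int.card_Icc, ← Int.cast_natCast, Int.toNat_eq_max]
    push_cast
    refine max_le ?_ (by linarith)
    have := Int.floor_le b
    have := Int.le_ceil a
    linarith
  exact le_trans (by exact_mod_cast h1) h2

theorem card_le_of_int_pairwise {α : Type*} (F : Finset α) (f : α → ℤ) (hf : Set.InjOn f F) (D : ℝ)
    (hD : 0 ≤ D) (h : ∀ p ∈ F, ∀ q ∈ F, (f p : ℝ) - f q ≤ D) : (F.card : ℝ) ≤ D + 1 := by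
  rcases F.eq_empty_or_nonempty with rfl | hne
  · simp; linarith
  obtain ⟨m, hm, hmin⟩ := F.exists_min_image f hne
  have := card_le_of_int_range F f hf (f m) (f m + D) (by linarith) (fun p hp =>
    ⟨by exact_mod_cast hmin p hp, by linarith [h p hp m hm]⟩)
  linarith

theorem card_le_of_normSq_le (F : Finset Mode) (Y : ℝ) (hY : 0 ≤ Y)
    (h : ∀ p ∈ F, normSq p ≤ Y ^ 2) : (F.card : ℝ) ≤ (2 * Y + 1) ^ 2 := by
  classical
  have h1 : ((F.image cx).card : ℝ) ≤ Y - (-Y) + 1 := by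
    refine card_le_of_int_range (F.image cx) id Function.injective_id.injOn _ _ (by linarith) ?_
    intro x hx
    obtain ⟨p, hp, rfl⟩ := Finset.mem_image.1 hx
    exact abs_le.1 (abs_cx_le hY (h p hp))
  have h2 : ((F.image cy).card : ℝ) ≤ Y - (-Y) + 1 := by
    refine card_le_of_int_range (F.image cy) id Function.injective_id.injOn _ _ (by linarith) ?_
    intro x hx
    obtain ⟨p, hp, rfl⟩ := Finset.mem_image.1 hx
    exact abs_le.1 (abs_cy_le hY (h p hp))
  have h3 : F.card ≤ (F.image cx ×ˢ F.image cy).card := by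
    refine Finset.card_le_card_of_injOn (fun p => (cx p, cy p)) (fun p hp => ?_) ?_
    · simp only [Finset.coe_product, Set.mem_prod, Finset.mem_coe]
      exact ⟨Finset.mem_image_of_mem _ hp, Finset.mem_image_of_mem _ hp⟩
    · intro p _ q _ hpq
      simp only [Prod.mk.injEq] at hpq
      exact mode_ext hpq.1 hpq.2
  rw [Finset.card_product] at h3
  calc (F.card : ℝ) ≤ ((F.image cx).card : ℝ) * ((F.image cy).card : ℝ) := by exact_mod_cast h3
    _ ≤ (2 * Y + 1) * (2 * Y + 1) := by gcongr <;> linarith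
    _ = _ := by ring

/-! ### Comparison of the particle number with the square of the Fermi momentum. -/

theorem zero_mem_fermiBall {kF : ℝ} (h : 0 < kF) : (0 : Mode) ∈ fermiBall kF := by
  rw [mem_fermiBall_iff_normSq h]
  simp [normSq_def]
  positivity

theorem one_le_particleNumber {kF : ℝ} (h : 0 < kF) : 1 ≤ particleNumber kF :=
  Finset.card_pos.2 ⟨0, zero_mem_fermiBall h⟩

/-- The origin lies in the ball, so the infimum over the complement is at least one. This is the
only use of the midpoint condition: it excludes tiny `kF`, for which `N = 1` would not be `O(kF²)`.
-/
theorem half_le_sq_of_isFermiMomentum {kF : ℝ} (h : IsFermiMomentum kF) : 1 / 2 ≤ kF ^ 2 := by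
  obtain ⟨h0, h1⟩ := h
  have hs : 0 ≤ sSup (normSq '' {q | q ∈ fermiBall kF}) := by
    refine Real.sSup_nonneg ?_
    rintro _ ⟨p, _, rfl⟩
    exact normSq_nonneg p
  have hi : 1 ≤ sInf (normSq '' {p | p ∉ fermiBall kF}) := by
    refine le_csInf ?_ ?_
    · obtain ⟨p, hp⟩ := Infinite.exists_notMem_finset (fermiBall kF)
      exact ⟨_, p, hp, rfl⟩
    · rintro _ ⟨p, hp, rfl⟩
      refine one_le_normSq ?_
      rintro rfl
      exact hp (zero_mem_fermiBall h0)
  linarith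

theorem particleNumber_le {kF : ℝ} (h : IsFermiMomentum kF) :
    (particleNumber kF : ℝ) ≤ 50 * kF ^ 2 := by
  have h2 := half_le_sq_of_isFermiMomentum h
  have h0 := h.1
  have h1 := card_le_of_normSq_le (fermiBall kF) kF h0.le
    (fun p hp => ((mem_fermiBall_iff_normSq h0).1 hp).le)
  have h3 : 0.7 ≤ kF := by nlinarith
  have h4 : 2 * kF + 1 ≤ 7 * kF := by linarith
  calc (particleNumber kF : ℝ) ≤ (2 * kF + 1) ^ 2 := h1
    _ ≤ (7 * kF) ^ 2 := by gcongr
    _ ≤ _ := by nlinarith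

/-- A square of half-side `kF / 2` fits in the disc, and with `m = ⌊kF / 2⌋` it contains `(2m + 1)²`
lattice points, where `2m + 1 ≥ m + 1 > kF / 2`. -/
theorem sq_le_particleNumber {kF : ℝ} (h0 : 0 < kF) :
    kF ^ 2 ≤ 4 * (particleNumber kF : ℝ) := by
  set m : ℤ := ⌊kF / 2⌋ with hm
  have hm0 : 0 ≤ m := Int.floor_nonneg.2 (by positivity)
  have hm1 : (m : ℝ) ≤ kF / 2 := Int.floor_le _
  have hm2 : kF / 2 < m + 1 := Int.lt_floor_add_one _
  set I := Finset.Icc (-m) m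
  have hI : I.card = (2 * m + 1).toNat := by
    rw [Int.card_Icc]; congr 1; ring
  have hsub : (I ×ˢ I).card ≤ (fermiBall kF).card := by
    refine Finset.card_le_card_of_injOn toLex (fun x hx => ?_) toLex.injective.injOn
    rw [Finset.mem_coe, Finset.mem_product, Finset.mem_Icc, Finset.mem_Icc] at hx
    rw [Finset.mem_coe, mem_fermiBall_iff_normSq h0]
    change (x.1 : ℝ) ^ 2 + (x.2 : ℝ) ^ 2 < kF ^ 2
    have e1 : |(x.1 : ℝ)| ≤ kF / 2 := (abs_le.2 ⟨by exact_mod_cast hx.1.1, by exact_mod_cast hx.1.2⟩ :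
      |(x.1 : ℝ)| ≤ m).trans hm1
    have e2 : |(x.2 : ℝ)| ≤ kF / 2 := (abs_le.2 ⟨by exact_mod_cast hx.2.1, by exact_mod_cast hx.2.2⟩ :
      |(x.2 : ℝ)| ≤ m).trans hm1
    have e3 : (x.1 : ℝ) ^ 2 ≤ (kF / 2) ^ 2 := sq_le_sq' (abs_le.1 e1).1 (abs_le.1 e1).2
    have e4 : (x.2 : ℝ) ^ 2 ≤ (kF / 2) ^ 2 := sq_le_sq' (abs_le.1 e2).1 (abs_le.1 e2).2
    nlinarith [sq_pos_of_pos h0]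
  rw [Finset.card_product, hI] at hsub
  have h5 : ((2 * m + 1 : ℤ) : ℝ) * ((2 * m + 1 : ℤ) : ℝ) ≤ (particleNumber kF : ℝ) := by
    have : ((2 * m + 1).toNat : ℤ) = 2 * m + 1 := Int.toNat_of_nonneg (by omega)
    rw [← this]
    exact_mod_cast hsub
  push_cast at h5
  have hm0' : (0 : ℝ) ≤ m := by exact_mod_cast hm0
  nlinarith

/-- Number of `q` in the Fermi ball that leave it under translation by `k`. -/
def exitCount (B : Finset Mode) (k : Mode) : ℕ := (B.filter (fun q => q + k ∉ B)).card

/-- A point leaving under `k + l` either leaves under `k`, or lands in `B` after the first step and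
leaves under `l`. Subadditivity reduces the Fermi surface estimate to unit steps. -/
theorem exitCount_add (B : Finset Mode) (k l : Mode) :
    exitCount B (k + l) ≤ exitCount B k + exitCount B l := by
  have h : B.filter (fun q => q + (k + l) ∉ B) ⊆
      B.filter (fun q => q + k ∉ B) ∪ (B.filter (fun q => q + l ∉ B)).image (fun q => q - k) := by
    intro q hq
    rw [Finset.mem_filter] at hq
    by_cases h : q + k ∈ B
    · refine Finset.mem_union_right _ (Finset.mem_image.2 ⟨q + k, Finset.mem_filter.2 ⟨h, ?_⟩, ?_⟩)
      · rw [add_assoc]; exact hq.2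
      · simp
    · exact Finset.mem_union_left _ (Finset.mem_filter.2 ⟨hq.1, h⟩)
  calc exitCount B (k + l) ≤ _ := Finset.card_le_card h
    _ ≤ _ := Finset.card_union_le _ _
    _ ≤ _ := Nat.add_le_add_left Finset.card_image_le _

theorem exitCount_zero (B : Finset Mode) : exitCount B 0 = 0 := by
  simp [exitCount]

theorem exitCount_nsmul (B : Finset Mode) (n : ℕ) (k : Mode) :
    exitCount B (n • k) ≤ n * exitCount B k := by
  induction n with
  | zero => simp [exitCount_zero]
  | succ n ih =>
    rw [succ_nsmul]
    have := exitCount_add B (n • k) k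
    nlinarith

theorem neg_mem_fermiBall {kF : ℝ} {p : Mode} : -p ∈ fermiBall kF ↔ p ∈ fermiBall kF := by
  rw [mem_fermiBall, mem_fermiBall, modeNorm_neg]

theorem exitCount_neg (kF : ℝ) (k : Mode) :
    exitCount (fermiBall kF) (-k) ≤ exitCount (fermiBall kF) k := by
  unfold exitCount
  refine Finset.card_le_card_of_injOn (fun q => -q) (fun q hq => ?_) neg_injective.injOn
  simp only [Finset.coe_filter, Set.mem_ofPred_eq] at hq ⊢
  refine ⟨neg_mem_fermiBall.2 hq.1, ?_⟩
  rw [← neg_mem_fermiBall]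
  convert hq.2 using 2
  abel

theorem exitCount_zsmul (kF : ℝ) (n : ℤ) (k : Mode) :
    exitCount (fermiBall kF) (n • k) ≤ n.natAbs * exitCount (fermiBall kF) k := by
  obtain ⟨m, rfl | rfl⟩ := n.eq_nat_or_neg
  · simpa using exitCount_nsmul (fermiBall kF) m k
  · have h1 := exitCount_neg kF (m • k)
    have h2 := exitCount_nsmul (fermiBall kF) m k
    simpa using h1.trans h2

theorem sq_le_max_of_between {x y : ℝ} {z R c : ℝ} (h1 : x ≤ z) (h2 : z ≤ y)
    (hx : x ^ 2 + c < R) (hy : y ^ 2 + c < R) : z ^ 2 + c < R := by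
  rcases le_total 0 z with h | h
  · nlinarith
  · nlinarith

/-- By convexity each horizontal row of the ball is an interval of integers, so only its right end
point can leave. Exits are therefore distinguished by their second coordinate. -/
theorem exitCount_unit_x {kF : ℝ} (h0 : 0 < kF) :
    (exitCount (fermiBall kF) (toLex (1, 0)) : ℝ) ≤ 2 * kF + 1 := by
  have := card_le_of_int_range ((fermiBall kF).filter (fun q => q + toLex (1, 0) ∉ fermiBall kF))
    cy ?_ (-kF) kF (by linarith) ?_
  · unfold exitCount; linarith
  · have key : ∀ p ∈ fermiBall kF, ∀ q ∈ fermiBall kF, p + toLex (1, 0) ∉ fermiBall kF →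
        cy p = cy q → cx q ≤ cx p := by
      intro p hp q hq hpk hy
      by_contra! hlt
      apply hpk
      rw [mem_fermiBall_iff_normSq h0, normSq_def] at *
      simp only [cx_add, cy_add]
      have e1 : cx (toLex (1, 0) : Mode) = 1 := rfl
      have e2 : cy (toLex (1, 0) : Mode) = 0 := rfl
      rw [e1, e2, add_zero]
      rw [← hy] at hq
      refine sq_le_max_of_between (x := cx p) (y := cx q) ?_ ?_ hp hq
      · push_cast; linarith
      · exact_mod_cast hlt
    intro p hp q hq hpq
    simp only [Finset.coe_filter, Set.mem_ofPred_eq] at hp hq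
    exact mode_ext (le_antisymm (key q hq.1 p hp.1 hq.2 hpq.symm) (key p hp.1 q hq.1 hp.2 hpq)) hpq
  · intro p hp
    rw [Finset.mem_filter, mem_fermiBall_iff_normSq h0] at hp
    exact abs_le.1 (abs_cy_le h0.le hp.1.le)

theorem exitCount_unit_y {kF : ℝ} (h0 : 0 < kF) :
    (exitCount (fermiBall kF) (toLex (0, 1)) : ℝ) ≤ 2 * kF + 1 := by
  have := card_le_of_int_range ((fermiBall kF).filter (fun q => q + toLex (0, 1) ∉ fermiBall kF))
    cx ?_ (-kF) kF (by linarith) ?_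
  · unfold exitCount; linarith
  · have key : ∀ p ∈ fermiBall kF, ∀ q ∈ fermiBall kF, p + toLex (0, 1) ∉ fermiBall kF →
        cx p = cx q → cy q ≤ cy p := by
      intro p hp q hq hpk hy
      by_contra! hlt
      apply hpk
      rw [mem_fermiBall_iff_normSq h0, normSq_def, add_comm] at *
      simp only [cx_add, cy_add]
      have e1 : cx (toLex (0, 1) : Mode) = 0 := rfl
      have e2 : cy (toLex (0, 1) : Mode) = 1 := rfl
      rw [e1, e2, add_zero]
      rw [← hy] at hq
      refine sq_le_max_of_between (x := cy p) (y := cy q) ?_ ?_ hp hq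
      · push_cast; linarith
      · exact_mod_cast hlt
    intro p hp q hq hpq
    simp only [Finset.coe_filter, Set.mem_ofPred_eq] at hp hq
    exact mode_ext hpq (le_antisymm (key q hq.1 p hp.1 hq.2 hpq.symm) (key p hp.1 q hq.1 hp.2 hpq))
  · intro p hp
    rw [Finset.mem_filter, mem_fermiBall_iff_normSq h0] at hp
    exact abs_le.1 (abs_cx_le h0.le hp.1.le)

/-- Decompose `k` into `|cx k| + |cy k| ≤ 2|k|` unit steps, each with at most `2 kF + 1 ≤ 5√N`
exits. This gain of `√N` over `N` controls both the interaction energy of the Fermi sea and the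
commutator of `ρ_k` with the number of excitations. -/
theorem exitCount_le {kF : ℝ} (h0 : 0 < kF) (k : Mode) :
    (exitCount (fermiBall kF) k : ℝ) ≤ 10 * modeNorm k * Real.sqrt (particleNumber kF) := by
  have hk : k = cx k • (toLex (1, 0) : Mode) + cy k • (toLex (0, 1) : Mode) := by
    apply mode_ext
    · change cx k = cx k * 1 + cy k * 0
      ring
    · change cy k = cx k * 0 + cy k * 1
      ring
  have h1 := exitCount_add (fermiBall kF) (cx k • (toLex (1, 0) : Mode)) (cy k • (toLex (0, 1) : Mode))
  rw [← hk] at h1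
  have h2 := exitCount_zsmul kF (cx k) (toLex (1, 0))
  have h3 := exitCount_zsmul kF (cy k) (toLex (0, 1))
  have h4 : (exitCount (fermiBall kF) k : ℝ) ≤ |(cx k : ℝ)| * (2 * kF + 1) + |(cy k : ℝ)| * (2 * kF + 1) := by
    have e1 : ((cx k).natAbs : ℝ) = |(cx k : ℝ)| := by simp [Nat.cast_natAbs]
    have e2 : ((cy k).natAbs : ℝ) = |(cy k : ℝ)| := by simp [Nat.cast_natAbs]
    calc (exitCount (fermiBall kF) k : ℝ) ≤
        ((cx k).natAbs : ℝ) * (exitCount (fermiBall kF) (toLex (1, 0)) : ℝ)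
        + ((cy k).natAbs : ℝ) * (exitCount (fermiBall kF) (toLex (0, 1)) : ℝ) := by
          exact_mod_cast h1.trans (add_le_add h2 h3)
      _ ≤ _ := by
        rw [e1, e2]
        gcongr
        · exact exitCount_unit_x h0
        · exact exitCount_unit_y h0
  have h5 : |(cx k : ℝ)| ≤ modeNorm k := abs_cx_le (modeNorm_nonneg k) (modeNorm_sq k).ge
  have h6 : |(cy k : ℝ)| ≤ modeNorm k := abs_cy_le (modeNorm_nonneg k) (modeNorm_sq k).ge
  set s := Real.sqrt (particleNumber kF) with hs
  have h7 : 1 ≤ s := by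
    rw [hs, Real.one_le_sqrt]
    exact_mod_cast one_le_particleNumber h0
  have h8 : kF ≤ 2 * s := by
    have hss : s ^ 2 = particleNumber kF := Real.sq_sqrt (Nat.cast_nonneg _)
    have := sq_le_particleNumber h0
    exact le_of_sq_le_sq (by nlinarith) (by positivity)
  have h9 : 2 * kF + 1 ≤ 5 * s := by linarith
  have h10 := modeNorm_nonneg k
  calc _ ≤ _ := h4
    _ ≤ modeNorm k * (5 * s) + modeNorm k * (5 * s) := by gcongr
    _ = _ := by ring

end FermiGas

namespace FermiGas

/-! ### Lattice points in thin annuli -/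

/-- The inner product of two momenta. -/
def dot (p q : Mode) : ℝ := (cx p : ℝ) * cx q + (cy p : ℝ) * cy q

/-- The cross product of two momenta. -/
def cross (p q : Mode) : ℤ := cx p * cy q - cy p * cx q

theorem sq_sub_le_abs_sq_sub_sq {a b : ℝ} (h : 0 ≤ a * b) : (a - b) ^ 2 ≤ |a ^ 2 - b ^ 2| := by
  have h1 : |a - b| ≤ |a + b| := sq_le_sq.1 (by nlinarith)
  calc (a - b) ^ 2 = |a - b| * |a - b| := by rw [← sq, sq_abs]
    _ ≤ |a - b| * |a + b| := by gcongr
    _ = _ := by rw [← abs_mul]; ring_nf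

theorem dot_sq_add_cross_sq (u p : Mode) :
    dot u p ^ 2 + (cross u p : ℝ) ^ 2 = normSq u * normSq p := by
  simp only [dot, cross, normSq_def]; push_cast; ring

/-- The points lie on a line parallel to `u`, on one side of the foot of the perpendicular from the
origin. There the squared difference of the coordinates along `u` is at most the difference of their
squares, which equals `|u|²` times the difference of the `|p|²`. So all distances are at most
`√(2δ)`, and a coordinate in which `u` is non-zero separates the points. -/
theorem card_halfline_le (G : Finset Mode) (u : Mode) (hu : u ≠ 0) (X δ : ℝ) (hδ : 0 ≤ δ)
    (hX : ∀ p ∈ G, |normSq p - X| ≤ δ) (hc : ∀ p ∈ G, ∀ q ∈ G, cross u p = cross u q)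
    (hs : ∀ p ∈ G, ∀ q ∈ G, 0 ≤ dot u p * dot u q) : (G.card : ℝ) ≤ Real.sqrt (2 * δ) + 1 := by
  have hu1 : 1 ≤ normSq u := one_le_normSq hu
  have hdist : ∀ p ∈ G, ∀ q ∈ G, normSq (p - q) ≤ 2 * δ := by
    intro p hp q hq
    have h1 := dot_sq_add_cross_sq u p
    have h2 := dot_sq_add_cross_sq u q
    have h3 := dot_sq_add_cross_sq u (p - q)
    have h4 : dot u (p - q) = dot u p - dot u q := by simp [dot]; ring
    have h5 : cross u (p - q) = cross u p - cross u q := by simp [cross]; ring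
    rw [h4, h5, hc p hp q hq, sub_self, Int.cast_zero] at h3
    rw [hc p hp q hq] at h1
    have h6 := sq_sub_le_abs_sq_sub_sq (hs p hp q hq)
    have h7 : dot u p ^ 2 - dot u q ^ 2 = normSq u * (normSq p - normSq q) := by linarith
    rw [h7, abs_mul, abs_of_nonneg (normSq_nonneg u)] at h6
    have h8 : |normSq p - normSq q| ≤ 2 * δ := by
      have e1 := abs_le.1 (hX p hp)
      have e2 := abs_le.1 (hX q hq)
      rw [abs_le]; constructor <;> linarith
    have h9 : normSq u * normSq (p - q) ≤ normSq u * (2 * δ) := by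
      calc _ = (dot u p - dot u q) ^ 2 := by rw [← h3]; ring
        _ ≤ _ := h6
        _ ≤ _ := by gcongr
    exact le_of_mul_le_mul_left h9 (by linarith)
  have hco : cx u ≠ 0 ∨ cy u ≠ 0 := by
    by_contra! h
    exact hu (mode_ext h.1 h.2)
  have hx : ∀ p ∈ G, ∀ q ∈ G, |(cx (p - q) : ℝ)| ≤ Real.sqrt (2 * δ) := fun p hp q hq =>
    abs_cx_le (Real.sqrt_nonneg _) ((hdist p hp q hq).trans (Real.sq_sqrt (by positivity)).ge)
  have hy : ∀ p ∈ G, ∀ q ∈ G, |(cy (p - q) : ℝ)| ≤ Real.sqrt (2 * δ) := fun p hp q hq =>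
    abs_cy_le (Real.sqrt_nonneg _) ((hdist p hp q hq).trans (Real.sq_sqrt (by positivity)).ge)
  rcases hco with h | h
  · refine card_le_of_int_pairwise G cx ?_ _ (Real.sqrt_nonneg _) ?_
    · intro p hp q hq hpq
      have := hc p hp q hq
      unfold cross at this
      rw [hpq] at this
      exact mode_ext hpq (mul_left_cancel₀ h (by linarith))
    · intro p hp q hq
      have := (abs_le.1 (hx p hp q hq)).2
      rw [cx_sub] at this
      push_cast at this
      exact this
  · refine card_le_of_int_pairwise G cy ?_ _ (Real.sqrt_nonneg _) ?_
    · intro p hp q hq hpq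
      have := hc p hp q hq
      unfold cross at this
      rw [hpq] at this
      exact mode_ext (mul_left_cancel₀ h (by linarith)) hpq
    · intro p hp q hq
      have := (abs_le.1 (hy p hp q hq)).2
      rw [cy_sub] at this
      push_cast at this
      exact this

theorem card_le_two_mul_of_split {G : Finset Mode} (f : Mode → ℝ) (D : ℝ)
    (h : ∀ H : Finset Mode, H ⊆ G → (∀ p ∈ H, ∀ q ∈ H, 0 ≤ f p * f q) → (H.card : ℝ) ≤ D) :
    (G.card : ℝ) ≤ 2 * D := by
  classical
  rw [← Finset.card_filter_add_card_filter_not (s := G) (fun p => 0 ≤ f p)]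
  push_cast
  have h1 := h (G.filter (fun p => 0 ≤ f p)) (Finset.filter_subset _ _) (fun p hp q hq =>
    mul_nonneg (Finset.mem_filter.1 hp).2 (Finset.mem_filter.1 hq).2)
  have h2 := h (G.filter (fun p => ¬ 0 ≤ f p)) (Finset.filter_subset _ _) (fun p hp q hq =>
    mul_nonneg_of_nonpos_of_nonpos (not_le.1 (Finset.mem_filter.1 hp).2).le
      (not_le.1 (Finset.mem_filter.1 hq).2).le)
  linarith

theorem card_line_le (G : Finset Mode) (u : Mode) (hu : u ≠ 0) (X δ : ℝ) (hδ : 0 ≤ δ)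
    (hX : ∀ p ∈ G, |normSq p - X| ≤ δ) (hc : ∀ p ∈ G, ∀ q ∈ G, cross u p = cross u q) :
    (G.card : ℝ) ≤ 2 * (Real.sqrt (2 * δ) + 1) :=
  card_le_two_mul_of_split (dot u) _ fun H hH hs =>
    card_halfline_le H u hu X δ hδ (fun p hp => hX p (hH hp))
      (fun p hp q hq => hc p (hH hp) q (hH hq)) hs

theorem abs_cross_le (p u : Mode) : |(cross p u : ℝ)| ≤ modeNorm p * modeNorm u := by
  rw [modeNorm, modeNorm, ← Real.sqrt_mul (normSq_nonneg p), ← dot_sq_add_cross_sq]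
  exact Real.abs_le_sqrt (by nlinarith [sq_nonneg (dot p u)])

/-- Expand `|q|² = |p + (q - p)|²`: a short chord of a thin annulus is nearly tangential. -/
theorem abs_dot_sub_le {X δ : ℝ} {p q : Mode} (hp : |normSq p - X| ≤ δ) (hq : |normSq q - X| ≤ δ) :
    |dot p (q - p)| ≤ δ + normSq (q - p) / 2 := by
  have h1 : normSq q = normSq p + 2 * dot p (q - p) + normSq (q - p) := by
    simp [dot, normSq_def]; ring
  have e1 := abs_le.1 hp
  have e2 := abs_le.1 hq
  have := normSq_nonneg (q - p)
  rw [abs_le]; constructor <;> linarith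

/-- Two chords `u`, `v` from a point `p0` of the cell have radial parts `p0 · u`, `p0 · v` of size
at most `δ + ℓ²/2`, so their cross product is at most `ℓ(2δ + ℓ²)/|p0|`. By `hsmall` this is below
one; being an integer, it vanishes. The cell is collinear and the count on a line applies. -/
theorem card_cell_le (G : Finset Mode) (X δ ℓ r : ℝ) (hδ : 0 ≤ δ) (hℓ : 0 < ℓ) (hr : 0 < r)
    (hrX : r ^ 2 ≤ X - δ) (hsmall : ℓ * (2 * δ + ℓ ^ 2) < r)
    (hX : ∀ p ∈ G, |normSq p - X| ≤ δ) (hd : ∀ p ∈ G, ∀ q ∈ G, normSq (p - q) ≤ ℓ ^ 2) :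
    (G.card : ℝ) ≤ 2 * (Real.sqrt (2 * δ) + 1) := by
  rcases G.eq_empty_or_nonempty with rfl | ⟨p0, hp0⟩
  · simp; positivity
  by_cases hG : ∃ p1 ∈ G, p1 ≠ p0
  · obtain ⟨p1, hp1, hne⟩ := hG
    have hu : p1 - p0 ≠ 0 := sub_ne_zero.2 hne
    have hcol : ∀ p ∈ G, cross (p1 - p0) (p - p0) = 0 := by
      intro p hp
      set u := p1 - p0
      set v := p - p0
      have hid : normSq p0 * (cross u v : ℝ)
          = dot p0 u * (cross p0 v : ℝ) - (cross p0 u : ℝ) * dot p0 v := by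
        simp only [normSq_def, cross, dot]; push_cast; ring
      have hul : modeNorm u ≤ ℓ := by
        rw [modeNorm, Real.sqrt_le_left hℓ.le]; exact hd p1 hp1 p0 hp0
      have hvl : modeNorm v ≤ ℓ := by
        rw [modeNorm, Real.sqrt_le_left hℓ.le]; exact hd p hp p0 hp0
      have h1 : |dot p0 u| ≤ δ + ℓ ^ 2 / 2 :=
        (abs_dot_sub_le (hX p0 hp0) (hX p1 hp1)).trans (by linarith [hd p1 hp1 p0 hp0])
      have h2 : |dot p0 v| ≤ δ + ℓ ^ 2 / 2 :=
        (abs_dot_sub_le (hX p0 hp0) (hX p hp)).trans (by linarith [hd p hp p0 hp0])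
      set m := modeNorm p0
      have hm0 : 0 ≤ m := modeNorm_nonneg p0
      have hmsq : m ^ 2 = normSq p0 := modeNorm_sq p0
      have hrm : r ≤ m := by
        refine le_of_sq_le_sq ?_ hm0
        rw [hmsq]
        linarith [(abs_le.1 (hX p0 hp0)).1]
      have h3 : |(cross p0 u : ℝ)| ≤ m * ℓ := (abs_cross_le p0 u).trans (by gcongr)
      have h4 : |(cross p0 v : ℝ)| ≤ m * ℓ := (abs_cross_le p0 v).trans (by gcongr)
      have h5 : m * (m * |(cross u v : ℝ)|) ≤ m * (ℓ * (2 * δ + ℓ ^ 2)) := by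
        calc m * (m * |(cross u v : ℝ)|) = |normSq p0 * (cross u v : ℝ)| := by
              rw [abs_mul, abs_of_nonneg (normSq_nonneg p0), ← hmsq]; ring
          _ ≤ |dot p0 u| * |(cross p0 v : ℝ)| + |(cross p0 u : ℝ)| * |dot p0 v| := by
              rw [hid, ← abs_mul, ← abs_mul]; exact abs_sub _ _
          _ ≤ (δ + ℓ ^ 2 / 2) * (m * ℓ) + (m * ℓ) * (δ + ℓ ^ 2 / 2) := by gcongr
          _ = _ := by ring
      have h6 : m * |(cross u v : ℝ)| < m * 1 := by
        have := le_of_mul_le_mul_left h5 (by linarith)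
        linarith
      have h7 : |(cross u v : ℝ)| < 1 := lt_of_mul_lt_mul_left h6 hm0
      exact Int.abs_lt_one_iff.1 (by exact_mod_cast h7)
    refine card_line_le G (p1 - p0) hu X δ hδ hX fun p hp q hq => ?_
    have h1 := hcol p hp
    have h2 := hcol q hq
    simp only [cross, cx_sub, cy_sub] at h1 h2 ⊢
    linarith
  · push Not at hG
    have : G.card ≤ 1 := Finset.card_le_one.2 fun a ha b hb => by rw [hG a ha, hG b hb]
    have : (G.card : ℝ) ≤ 1 := by exact_mod_cast this
    have := Real.sqrt_nonneg (2 * δ)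
    linarith

/-- The arc, of length `O(δ)`, is cut into `O(δ/ℓ + 1)` cells along the tangent at one of its
points. The deviation along the normal is at most `(δ + 6δ²)/r ≤ 7δ²/r`, and `hrad` makes this at
most `ℓ/4`, so each cell has diameter at most `ℓ`. -/
theorem card_arc_le (H : Finset Mode) (X δ ℓ r : ℝ) (hδ : 1 ≤ δ) (hℓ : 0 < ℓ) (hr : 0 < r)
    (hrX : r ^ 2 ≤ X - δ) (hsmall : ℓ * (2 * δ + ℓ ^ 2) < r) (hrad : 28 * δ ^ 2 ≤ ℓ * r)
    (hX : ∀ p ∈ H, |normSq p - X| ≤ δ) (hd : ∀ p ∈ H, ∀ q ∈ H, normSq (p - q) ≤ 12 * δ ^ 2) :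
    (H.card : ℝ) ≤ (16 * δ / ℓ + 2) * (2 * (Real.sqrt (2 * δ) + 1)) := by
  classical
  rcases H.eq_empty_or_nonempty with rfl | ⟨p0, hp0⟩
  · simp; positivity
  set m := modeNorm p0 with hm
  have hm0 : 0 ≤ m := modeNorm_nonneg p0
  have hmsq : m ^ 2 = normSq p0 := modeNorm_sq p0
  have hrm : r ≤ m := by
    refine le_of_sq_le_sq ?_ hm0
    rw [hmsq]
    linarith [(abs_le.1 (hX p0 hp0)).1]
  have hm1 : 0 < m := hr.trans_le hrm
  -- Tangential and radial coordinates of `p - p0` in the orthonormal frame at `p0`.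
  set τ : Mode → ℝ := fun p => (cross p0 (p - p0) : ℝ) / m with hτ
  set ρ : Mode → ℝ := fun p => dot p0 (p - p0) / m with hρ
  have hτb : ∀ p ∈ H, |τ p| ≤ 4 * δ := by
    intro p hp
    simp only [hτ]
    rw [abs_div, abs_of_pos hm1, div_le_iff₀ hm1]
    calc _ ≤ m * modeNorm (p - p0) := abs_cross_le _ _
      _ ≤ m * (4 * δ) := by
        gcongr
        rw [modeNorm, Real.sqrt_le_left (by positivity)]
        have := hd p hp p0 hp0
        nlinarith
      _ = _ := by ring
  have hρb : ∀ p ∈ H, |ρ p| ≤ ℓ / 4 := by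
    intro p hp
    simp only [hρ]
    rw [abs_div, abs_of_pos hm1, div_le_iff₀ hm1]
    have h1 := abs_dot_sub_le (hX p0 hp0) (hX p hp)
    have h2 := hd p hp p0 hp0
    nlinarith
  have hpyth : ∀ p q, normSq (p - q) = (ρ p - ρ q) ^ 2 + (τ p - τ q) ^ 2 := by
    intro p q
    have h1 := dot_sq_add_cross_sq p0 (p - q)
    have h2 : dot p0 (p - p0) - dot p0 (q - p0) = dot p0 (p - q) := by simp [dot]; ring
    have h3 : (cross p0 (p - p0) : ℝ) - cross p0 (q - p0) = cross p0 (p - q) := by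
      simp [cross]; ring
    simp only [hτ, hρ]
    rw [← sub_div, ← sub_div, h2, h3, div_pow, div_pow, ← add_div, h1, hmsq, mul_div_assoc,
      mul_div_cancel₀]
    rw [← hmsq]; positivity
  set j : Mode → ℤ := fun p => ⌊τ p * (2 / ℓ)⌋ with hj
  have himg : ((H.image j).card : ℝ) ≤ 16 * δ / ℓ + 2 := by
    have := card_le_of_int_range (H.image j) id Function.injective_id.injOn
      -- The extra `-1` at the lower end accounts for rounding down in `j`.
      (-(8 * δ / ℓ) - 1) (8 * δ / ℓ) (by linarith [show 0 ≤ 8 * δ / ℓ by positivity]) ?_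
    · have e : 16 * δ / ℓ = 2 * (8 * δ / ℓ) := by ring
      linarith
    · intro x hx
      obtain ⟨p, hp, rfl⟩ := Finset.mem_image.1 hx
      have h1 := abs_le.1 (hτb p hp)
      have h2 : 0 < 2 / ℓ := by positivity
      have h3 : τ p * (2 / ℓ) ≤ 8 * δ / ℓ := by
        calc _ ≤ 4 * δ * (2 / ℓ) := by gcongr; exact h1.2
          _ = _ := by ring
      have h4 : -(8 * δ / ℓ) ≤ τ p * (2 / ℓ) := by
        calc -(8 * δ / ℓ) = -(4 * δ) * (2 / ℓ) := by ring
          _ ≤ _ := by gcongr; exact h1.1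
      have h5 := Int.floor_le (τ p * (2 / ℓ))
      have h6 := Int.lt_floor_add_one (τ p * (2 / ℓ))
      simp only [hj, id]
      constructor <;> linarith
  have hfib : ∀ x ∈ H.image j, ((H.filter (fun p => j p = x)).card : ℝ)
      ≤ 2 * (Real.sqrt (2 * δ) + 1) := by
    intro x _
    refine card_cell_le _ X δ ℓ r (by linarith) hℓ hr hrX hsmall
      (fun p hp => hX p (Finset.mem_filter.1 hp).1) fun p hp q hq => ?_
    rw [Finset.mem_filter] at hp hq
    rw [hpyth]
    have h1 : |τ p * (2 / ℓ) - τ q * (2 / ℓ)| < 1 :=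
      Int.abs_sub_lt_one_of_floor_eq_floor (hp.2.trans hq.2.symm)
    have h2 : |τ p - τ q| ≤ ℓ / 2 := by
      rw [← sub_mul, abs_mul, abs_of_pos (show 0 < 2 / ℓ by positivity), ← lt_div_iff₀ (by positivity)] at h1
      have : 1 / (2 / ℓ) = ℓ / 2 := by field_simp
      linarith
    have h3 : |ρ p - ρ q| ≤ ℓ / 2 := by
      have := abs_sub (ρ p) (ρ q)
      linarith [hρb p hp.1, hρb q hq.1]
    have h4 := sq_le_sq' (abs_le.1 h2).1 (abs_le.1 h2).2
    have h5 := sq_le_sq' (abs_le.1 h3).1 (abs_le.1 h3).2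
    nlinarith
  rw [Finset.card_eq_sum_card_image j H]
  push_cast
  calc _ ≤ ∑ x ∈ H.image j, 2 * (Real.sqrt (2 * δ) + 1) := Finset.sum_le_sum hfib
    _ = ((H.image j).card : ℝ) * (2 * (Real.sqrt (2 * δ) + 1)) := by
        rw [Finset.sum_const, nsmul_eq_mul]
    _ ≤ _ := by gcongr

/-- Subtracting the two shell conditions gives `|2 k·p + |k|²| ≤ 2δ`, a strip perpendicular to `k`.
It meets the annulus in at most two arcs, told apart by the sign of `k × p`. On one arc the
difference of `k × p` is controlled through that of its square, and `|k| ≥ 1`, `δ ≥ 1` give diameter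
squared at most `12δ²`, uniformly in `k`. -/
theorem card_pair_le (F : Finset Mode) (k : Mode) (hk : k ≠ 0) (X δ ℓ r : ℝ) (hδ : 1 ≤ δ)
    (hℓ : 0 < ℓ) (hr : 0 < r) (hrX : r ^ 2 ≤ X - δ) (hsmall : ℓ * (2 * δ + ℓ ^ 2) < r)
    (hrad : 28 * δ ^ 2 ≤ ℓ * r) (hX : ∀ p ∈ F, |normSq p - X| ≤ δ)
    (hX' : ∀ p ∈ F, |normSq (p + k) - X| ≤ δ) :
    (F.card : ℝ) ≤ 2 * ((16 * δ / ℓ + 2) * (2 * (Real.sqrt (2 * δ) + 1))) := by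
  refine card_le_two_mul_of_split (fun p => (cross k p : ℝ)) _ fun H hH hs => ?_
  refine card_arc_le H X δ ℓ r hδ hℓ hr hrX hsmall hrad (fun p hp => hX p (hH hp)) ?_
  intro p hp q hq
  have hk1 : 1 ≤ normSq k := one_le_normSq hk
  have hdot : ∀ p ∈ H, |2 * dot k p + normSq k| ≤ 2 * δ := by
    intro p hp
    have h1 : normSq (p + k) = normSq p + 2 * dot k p + normSq k := by
      simp [dot, normSq_def]; ring
    have e1 := abs_le.1 (hX p (hH hp))
    have e2 := abs_le.1 (hX' p (hH hp))
    rw [abs_le]; constructor <;> linarith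
  have h1 := dot_sq_add_cross_sq k p
  have h2 := dot_sq_add_cross_sq k q
  have h3 := dot_sq_add_cross_sq k (p - q)
  have h4 : dot k (p - q) = dot k p - dot k q := by simp [dot]; ring
  have h5 : (cross k (p - q) : ℝ) = cross k p - cross k q := by simp [cross]; ring
  rw [h4, h5] at h3
  have h6 := sq_sub_le_abs_sq_sub_sq (hs p hp q hq)
  have hp2 := abs_le.1 (hdot p hp)
  have hq2 := abs_le.1 (hdot q hq)
  have e1 := abs_le.1 (hX p (hH hp))
  have e2 := abs_le.1 (hX q (hH hq))
  have hdiff : |dot k p - dot k q| ≤ 2 * δ := by rw [abs_le]; constructor <;> linarith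
  have hsum : |dot k p + dot k q| ≤ normSq k + 2 * δ := by rw [abs_le]; constructor <;> linarith
  have hpq : |normSq p - normSq q| ≤ 2 * δ := by rw [abs_le]; constructor <;> linarith
  have h7 : |(cross k p : ℝ) ^ 2 - (cross k q : ℝ) ^ 2|
      ≤ normSq k * (2 * δ) + 2 * δ * (normSq k + 2 * δ) := by
    have : (cross k p : ℝ) ^ 2 - (cross k q : ℝ) ^ 2
        = normSq k * (normSq p - normSq q) - (dot k p - dot k q) * (dot k p + dot k q) := by
      linarith
    rw [this]
    refine (abs_sub _ _).trans ?_
    rw [abs_mul, abs_mul, abs_of_nonneg (normSq_nonneg k)]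
    gcongr
  have h8 : (dot k p - dot k q) ^ 2 ≤ (2 * δ) ^ 2 :=
    sq_le_sq' (abs_le.1 hdiff).1 (abs_le.1 hdiff).2
  have h9 : normSq k * normSq (p - q) ≤ normSq k * (12 * δ ^ 2) := by
    rw [← h3]
    have e3 : δ ≤ δ ^ 2 := by nlinarith
    have e4 : δ ^ 2 ≤ normSq k * δ ^ 2 := by nlinarith [sq_nonneg δ]
    have e5 : normSq k * δ ≤ normSq k * δ ^ 2 := by gcongr
    nlinarith
  exact le_of_mul_le_mul_left h9 (by linarith)

/-- The cell length `ℓ = t^33` is just below the cube root of the radius `r = t^100 / 8`, the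
largest scale on which cells are still collinear. The count is of order `(δ/ℓ)√δ = t^{54-33+27} =
t^48`. For `t < 10`, where the smallness conditions may fail, counting all points of a disc suffices
and accounts for the size of the constant. -/
theorem exists_card_pair_le : ∃ C : ℝ, 1 ≤ C ∧ ∀ kF : ℝ, IsFermiMomentum kF → ∀ t : ℝ, 1 ≤ t →
    (particleNumber kF : ℝ) = t ^ 200 → ∀ k : Mode, k ≠ 0 → ∀ F : Finset Mode,
      (∀ p ∈ F, |normSq p - kF ^ 2| ≤ t ^ 54) → (∀ p ∈ F, |normSq (p + k) - kF ^ 2| ≤ t ^ 54) →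
      (F.card : ℝ) ≤ C * t ^ 48 := by
  refine ⟨49 * 10 ^ 200, by norm_num, fun kF hkF t ht hN k hk F h1 h2 => ?_⟩
  have hup := sq_le_particleNumber hkF.1
  have hlow := particleNumber_le hkF
  rw [hN] at hup hlow
  have ht48 : (1 : ℝ) ≤ t ^ 48 := one_le_pow₀ ht
  rcases le_or_gt 10 t with h10 | h10
  · have hpow : ∀ a b : ℕ, (10 : ℝ) ^ b * t ^ a ≤ t ^ (a + b) := by
      intro a b
      rw [pow_add, mul_comm]
      gcongr
    have h13 : (0 : ℝ) < t := by linarith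
    have := card_pair_le F k hk (kF ^ 2) (t ^ 54) (t ^ 33) (t ^ 100 / 8) (one_le_pow₀ ht)
      (by positivity) (by positivity) ?_ ?_ ?_ h1 h2
    · have hs : Real.sqrt (2 * t ^ 54) ≤ 2 * t ^ 27 := by
        rw [Real.sqrt_le_left (by positivity)]
        have : (2 * t ^ 27) ^ 2 = 4 * t ^ 54 := by ring
        rw [this]
        have : 0 < t ^ 54 := by positivity
        linarith
      have hd : 16 * t ^ 54 / t ^ 33 = 16 * t ^ 21 := by
        rw [div_eq_iff (by positivity)]; ring
      rw [hd] at this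
      have e1 : (1 : ℝ) ≤ t ^ 21 := one_le_pow₀ ht
      have e2 : (1 : ℝ) ≤ t ^ 27 := one_le_pow₀ ht
      calc (F.card : ℝ) ≤ _ := this
        _ ≤ 2 * ((16 * t ^ 21 + 2 * t ^ 21) * (2 * (2 * t ^ 27 + t ^ 27))) := by
          gcongr
          linarith
        _ = 216 * t ^ 48 := by ring
        _ ≤ _ := by gcongr; norm_num
    · have e := hpow 54 146
      have : (t ^ 100 / 8) ^ 2 = t ^ 200 / 64 := by ring
      rw [this]
      norm_num at e
      have : 0 < t ^ 54 := by positivity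
      nlinarith
    · have e := hpow 87 13
      have e' := hpow 99 1
      have : t ^ 33 * (2 * t ^ 54 + (t ^ 33) ^ 2) = 2 * t ^ 87 + t ^ 99 := by ring
      rw [this]
      norm_num at e e'
      have : 0 < t ^ 87 := by positivity
      nlinarith
    · have e := hpow 108 25
      have e1 : t ^ 33 * (t ^ 100 / 8) = t ^ 133 / 8 := by ring
      have e2 : (t ^ 54) ^ 2 = t ^ 108 := by ring
      rw [e1, e2]
      norm_num at e
      have : 0 < t ^ 108 := by positivity
      nlinarith
  · have h0 : 0 ≤ t := by linarith
    have e54 : t ^ 54 ≤ t ^ 200 := pow_le_pow_right₀ ht (by norm_num)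
    have e100 : (1 : ℝ) ≤ t ^ 100 := one_le_pow₀ ht
    have := card_le_of_normSq_le F (3 * t ^ 100) (by positivity) fun p hp => by
      have := (abs_le.1 (h1 p hp)).2
      have e : (3 * t ^ 100) ^ 2 = 9 * t ^ 200 := by ring
      rw [e]
      have : 0 < t ^ 200 := by positivity
      linarith
    calc (F.card : ℝ) ≤ (2 * (3 * t ^ 100) + 1) ^ 2 := this
      _ ≤ (7 * t ^ 100) ^ 2 := by gcongr; linarith
      _ = 49 * t ^ 200 := by ring
      _ ≤ 49 * 10 ^ 200 * 1 := by rw [mul_one]; gcongr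
      _ ≤ _ := by gcongr

end FermiGas

namespace FermiGas
open scoped ENNReal

/-! ### Hopping sums -/

section hop
open Classical in
/-- The sum of `a (S - q + (q + k))` over the `q ∈ S` with `q + k ∉ S` and `P q`. -/
noncomputable def hop (P : Mode → Prop) (k : Mode) (a : Finset Mode → ℝ≥0∞) (S : Finset Mode) : ℝ≥0∞ :=
  ∑ q ∈ S.filter (fun q => q + k ∉ S ∧ P q), a (insert (q + k) (S.erase q))

theorem symmDiff_pair_eq {S : Finset Mode} {q p : Mode} (hq : q ∈ S) (hp : p ∉ S) :
    symmDiff S {q, p} = insert p (S.erase q) := by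
  ext x
  simp only [Finset.mem_symmDiff, Finset.mem_insert, Finset.mem_singleton, Finset.mem_erase]
  by_cases h1 : x = q
  · subst h1
    have : x ≠ p := fun h => hp (h ▸ hq)
    simp [this, hq]
  · by_cases h2 : x = p
    · subst h2; simp [hp]
    · simp [h1, h2]

theorem mem_symmDiff_pair_left {S : Finset Mode} {q p : Mode} :
    q ∈ symmDiff S {q, p} ↔ q ∉ S := by
  simp [Finset.mem_symmDiff]

theorem mem_symmDiff_pair_right {S : Finset Mode} {q p : Mode} :
    p ∈ symmDiff S {q, p} ↔ p ∉ S := by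
  simp [Finset.mem_symmDiff]

theorem sum_filter_eq_tsum (S : Finset Mode) (P : Mode → Prop) [DecidablePred P] (f : Mode → ℝ≥0∞) :
    ∑ q ∈ S.filter P, f q = ∑' q, if q ∈ S ∧ P q then f q else 0 := by
  rw [tsum_eq_sum (s := S.filter P)]
  · exact Finset.sum_congr rfl fun q hq => by rw [if_pos (Finset.mem_filter.1 hq)]
  · intro q hq
    rw [if_neg (fun h => hq (Finset.mem_filter.2 h))]

-- For fixed `q`, the involution `S ↦ S ∆ {q, q + k}` exchanges the sets containing `q` but not `q +
-- k` with those containing `q + k` but not `q`. This is the change of variables from the set before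
-- a hop to the set after it.
open Classical in
theorem tsum_hop_exchange (P : Mode → Prop) (k : Mode)
    (g : Finset Mode → Finset Mode → Mode → ℝ≥0∞) :
    ∑' S : Finset Mode, ∑ q ∈ S.filter (fun q => q + k ∉ S ∧ P q),
        g S (insert (q + k) (S.erase q)) q
      = ∑' T : Finset Mode, ∑ p ∈ T.filter (fun p => p - k ∉ T ∧ P (p - k)),
        g (insert (p - k) (T.erase p)) T (p - k) := by
  simp only [sum_filter_eq_tsum]
  rw [ENNReal.tsum_comm, ENNReal.tsum_comm (α := Finset Mode) (β := Mode)
    (f := fun T p => if p ∈ T ∧ p - k ∉ T ∧ P (p - k)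
      then g (insert (p - k) (T.erase p)) T (p - k) else 0)]
  symm
  rw [← (Equiv.addRight k).tsum_eq]
  refine tsum_congr fun q => ?_
  symm
  have hinv : Function.Involutive (fun S : Finset Mode => symmDiff S {q, q + k}) :=
    fun S => symmDiff_symmDiff_cancel_right _ S
  rw [← (hinv.toPerm _).tsum_eq]
  refine tsum_congr fun T => ?_
  simp only [Function.Involutive.coe_toPerm, Equiv.coe_addRight, add_sub_cancel_right,
    mem_symmDiff_pair_left, mem_symmDiff_pair_right, not_not]
  by_cases h : q ∉ T ∧ q + k ∈ T
  · by_cases hP : P q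
    · rw [if_pos ⟨h.1, h.2, hP⟩, if_pos ⟨h.2, h.1, hP⟩]
      congr 1
      · rw [Finset.pair_comm, symmDiff_pair_eq h.2 h.1]
      · rw [← symmDiff_pair_eq (mem_symmDiff_pair_left.2 h.1)
          (fun hh => mem_symmDiff_pair_right.1 hh h.2), symmDiff_symmDiff_cancel_right]
    · rw [if_neg (fun hh => hP hh.2.2), if_neg (fun hh => hP hh.2.2)]
  · rw [if_neg (fun hh => h ⟨hh.1, hh.2.1⟩), if_neg (fun hh => h ⟨hh.2.1, hh.1⟩)]

theorem ENNReal_sq_sum_le {ι : Type*} (s : Finset ι) (f : ι → ℝ≥0∞) :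
    (∑ i ∈ s, f i) ^ 2 ≤ s.card * ∑ i ∈ s, f i ^ 2 := by
  have := ENNReal.rpow_sum_le_const_mul_sum_rpow s f (p := 2) (by norm_num)
  norm_num at this
  exact this

theorem ENNReal_add_sq_le (a b : ℝ≥0∞) : (a + b) ^ 2 ≤ 2 * (a ^ 2 + b ^ 2) := by
  have := ENNReal_sq_sum_le (Finset.univ : Finset (Fin 2)) ![a, b]
  simpa [Fin.sum_univ_two] using this

-- A Schur test. Cauchy–Schwarz produces the number `i S` of hops from `S`, the sums are exchanged,
-- and the hops arriving at `T` are counted by `o T`. Since `i` is then evaluated at the other end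
-- of the hop, `j` is needed to express it through `T`.
open Classical in
theorem tsum_hop_sq_le (P : Mode → Prop) (k : Mode) (a i j o : Finset Mode → ℝ≥0∞)
    (hi : ∀ S F : Finset Mode, (∀ q ∈ F, q ∈ S ∧ q + k ∉ S ∧ P q) → (F.card : ℝ≥0∞) ≤ i S)
    (hj : ∀ T p, p ∈ T → p - k ∉ T → P (p - k) → i (insert (p - k) (T.erase p)) ≤ j T)
    (ho : ∀ T F : Finset Mode, (∀ p ∈ F, p ∈ T ∧ p - k ∉ T ∧ P (p - k)) →
      (F.card : ℝ≥0∞) ≤ o T) :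
    ∑' S, hop P k a S ^ 2 ≤ ∑' T, j T * o T * a T ^ 2 := by
  calc ∑' S, hop P k a S ^ 2
      ≤ ∑' S : Finset Mode, ∑ q ∈ S.filter (fun q => q + k ∉ S ∧ P q),
          i S * a (insert (q + k) (S.erase q)) ^ 2 := by
        refine ENNReal.tsum_le_tsum fun S => ?_
        rw [← Finset.mul_sum]
        exact (ENNReal_sq_sum_le _ _).trans (by
          gcongr; exact hi S _ fun q hq => Finset.mem_filter.1 hq)
    _ = ∑' T : Finset Mode, ∑ p ∈ T.filter (fun p => p - k ∉ T ∧ P (p - k)),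
          i (insert (p - k) (T.erase p)) * a T ^ 2 :=
        tsum_hop_exchange P k (fun S T _ => i S * a T ^ 2)
    _ ≤ _ := by
        refine ENNReal.tsum_le_tsum fun T => ?_
        calc _ ≤ ∑ p ∈ T.filter (fun p => p - k ∉ T ∧ P (p - k)), j T * a T ^ 2 := by
              refine Finset.sum_le_sum fun p hp => ?_
              rw [Finset.mem_filter] at hp
              gcongr
              exact hj T p hp.1 hp.2.1 hp.2.2
          _ = ((T.filter (fun p => p - k ∉ T ∧ P (p - k))).card : ℝ≥0∞) * (j T * a T ^ 2) := by
              rw [Finset.sum_const, nsmul_eq_mul]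
          _ ≤ o T * (j T * a T ^ 2) := by
              gcongr; exact ho T _ fun q hq => Finset.mem_filter.1 hq
          _ = _ := by ring

theorem hop_mono {P : Mode → Prop} {k : Mode} {a b : Finset Mode → ℝ≥0∞} (h : ∀ S, a S ≤ b S)
    (S : Finset Mode) : hop P k a S ≤ hop P k b S :=
  Finset.sum_le_sum fun _ _ => h _

theorem tsum_mul_hop (P P' : Mode → Prop) (k : Mode) (hP : ∀ p, P' p ↔ P (p - k))
    (a b : Finset Mode → ℝ≥0∞) :
    ∑' S, b S * hop P k a S = ∑' T, hop P' (-k) b T * a T := by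
  classical
  unfold hop
  simp only [Finset.mul_sum, Finset.sum_mul]
  have := tsum_hop_exchange P k (fun S T _ => b S * a T)
  refine this.trans (tsum_congr fun T => ?_)
  simp only [hP, ← sub_eq_add_neg]

theorem card_hop {S : Finset Mode} {p q : Mode} (hp : p ∈ S) (hq : q ∉ S) :
    (insert q (S.erase p)).card = S.card := by
  rw [Finset.card_insert_of_notMem (fun h => hq (Finset.mem_of_mem_erase h)),
    Finset.card_erase_add_one hp]

theorem hop_le_add_add (P P1 P2 P3 : Mode → Prop) (k : Mode) (a : Finset Mode → ℝ≥0∞)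
    (S : Finset Mode) (h : ∀ q, P q → P1 q ∨ P2 q ∨ P3 q) :
    hop P k a S ≤ hop P1 k a S + hop P2 k a S + hop P3 k a S := by
  classical
  unfold hop
  simp only [Finset.sum_filter]
  rw [← Finset.sum_add_distrib, ← Finset.sum_add_distrib]
  refine Finset.sum_le_sum fun q _ => ?_
  by_cases h0 : q + k ∉ S
  · by_cases hp : P q
    · rw [if_pos ⟨h0, hp⟩]
      rcases h q hp with h1 | h1 | h1
      · rw [if_pos (c := _ ∧ P1 q) ⟨h0, h1⟩, add_assoc]
        exact le_self_add
      · rw [if_pos (c := _ ∧ P2 q) ⟨h0, h1⟩]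
        exact le_self_add.trans' le_add_self
      · rw [if_pos (c := _ ∧ P3 q) ⟨h0, h1⟩]
        exact le_add_self
    · rw [if_neg (fun h => hp h.2)]; exact zero_le
  · rw [if_neg (fun h => h0 h.1)]; exact zero_le

end hop

/-! ### Bounds for `d(k)` -/

theorem norm_jwSign (p : Mode) (S : Finset Mode) : ‖jwSign p S‖ = 1 := by simp [jwSign]

theorem enorm_cre_ann {k : Mode} (hk : k ≠ 0) (q : Mode) (ξ : Finset Mode → ℂ) (S : Finset Mode) :
    ‖cre q (ann (q + k) ξ) S‖ₑ
      = if q ∈ S ∧ q + k ∉ S then ‖ξ (insert (q + k) (S.erase q))‖ₑ else 0 := by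
  have hne : q + k ≠ q := by simpa using hk
  have hs : ∀ p T, ‖jwSign p T‖ₑ = 1 := fun p T => by
    rw [← ofReal_norm, norm_jwSign, ENNReal.ofReal_one]
  unfold cre ann
  by_cases h1 : q ∈ S
  · by_cases h2 : q + k ∈ S
    · simp [h1, h2, hne]
    · simp [h1, h2, enorm_mul, hs]
  · simp [h1]

open Classical in
theorem sum_enorm_cre_ann_le {k : Mode} (hk : k ≠ 0) (X : Mode → Prop) (ξ : Finset Mode → ℂ)
    (S : Finset Mode) :
    ∑ q ∈ S.filter X, ‖cre q (ann (q + k) ξ) S‖ₑ ≤ hop X k (fun T => ‖ξ T‖ₑ) S := by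
  unfold hop
  simp only [enorm_cre_ann hk, ← Finset.sum_filter, Finset.filter_filter]
  refine Finset.sum_le_sum_of_subset fun q hq => ?_
  simp only [Finset.mem_filter] at hq ⊢
  tauto

/-- The creation operator kills all terms with `q ∉ S`, so the support is finite and the `finsum`
does not take its default value. The shift `c` makes one statement serve all the sums in `d(k)` and
`d*(k)`. -/
theorem finsum_cre_ann {k : Mode} (c : Mode) (X Y : Mode → Prop) (hXY : ∀ q, Y q ↔ X (q - c))
    (ξ : Finset Mode → ℂ) (S : Finset Mode) [DecidablePred Y] :
    ∑ᶠ (p : Mode) (_ : X p), cre (p + c) (ann (p + c + k) ξ) S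
      = ∑ q ∈ S.filter Y, cre q (ann (q + k) ξ) S := by
  classical
  have h1 : ∑ᶠ (p : Mode) (_ : X p), cre (p + c) (ann (p + c + k) ξ) S
      = ∑ᶠ q : Mode, if Y q then cre q (ann (q + k) ξ) S else 0 := by
    rw [← finsum_comp_equiv (Equiv.addRight c)
      (f := fun q => if Y q then cre q (ann (q + k) ξ) S else 0)]
    refine finsum_congr fun p => ?_
    rw [finsum_eq_if]
    simp [hXY]
  rw [h1, finsum_eq_sum_of_support_subset (s := S.filter Y)]
  · exact Finset.sum_congr rfl fun q hq => by rw [if_pos (Finset.mem_filter.1 hq).2]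
  · intro q hq
    rw [Function.mem_support] at hq
    by_cases hY : Y q
    · rw [if_pos hY] at hq
      by_cases hS : q ∈ S
      · simp [hS, hY]
      · exact absurd (by simp [cre, hS]) hq
    · rw [if_neg hY] at hq; exact absurd rfl hq

theorem enorm_finsum_cre_ann_le {k : Mode} (hk : k ≠ 0) (c : Mode) (X Y : Mode → Prop)
    (hXY : ∀ q, Y q ↔ X (q - c)) (ξ : Finset Mode → ℂ) (S : Finset Mode) :
    ‖∑ᶠ (p : Mode) (_ : X p), cre (p + c) (ann (p + c + k) ξ) S‖ₑ
      ≤ hop Y k (fun T => ‖ξ T‖ₑ) S := by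
  classical
  rw [finsum_cre_ann c X Y hXY]
  exact (enorm_sum_le _ _).trans (sum_enorm_cre_ann_le hk Y ξ S)

theorem enorm_sum_cre_ann_le {k : Mode} (hk : k ≠ 0) (c : Mode) (F : Finset Mode) (Y : Mode → Prop)
    (hXY : ∀ q, Y q ↔ q - c ∈ F) (ξ : Finset Mode → ℂ) (S : Finset Mode) :
    ‖∑ p ∈ F, cre (p + c) (ann (p + c + k) ξ) S‖ₑ ≤ hop Y k (fun T => ‖ξ T‖ₑ) S := by
  have : ∑ p ∈ F, cre (p + c) (ann (p + c + k) ξ) S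
      = ∑ᶠ (p : Mode) (_ : p ∈ F), cre (p + c) (ann (p + c + k) ξ) S := by
    rw [finsum_mem_finset_eq_sum]
  rw [this]
  exact enorm_finsum_cre_ann_le hk c _ Y hXY ξ S

/-- The majorant of `d(k)` acting on absolute values of amplitudes. -/
noncomputable def dAbs (B : Finset Mode) (k : Mode) (a : Finset Mode → ℝ≥0∞) (S : Finset Mode) : ℝ≥0∞ :=
  hop (fun q => q ∉ B ∧ q + k ∉ B) k a S + hop (fun q => q ∈ B ∧ q + -k ∈ B) (-k) a S

/-- The majorant of `d*(k)`. -/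
noncomputable def dStarAbs (B : Finset Mode) (k : Mode) (a : Finset Mode → ℝ≥0∞) (S : Finset Mode) : ℝ≥0∞ :=
  hop (fun q => q ∉ B ∧ q + -k ∉ B) (-k) a S + hop (fun q => q ∈ B ∧ q + k ∈ B) k a S

theorem enorm_dOp_le (B : Finset Mode) {k : Mode} (hk : k ≠ 0) (ξ : Finset Mode → ℂ)
    (S : Finset Mode) : ‖dOp B k ξ S‖ₑ ≤ dAbs B k (fun T => ‖ξ T‖ₑ) S := by
  unfold dOp dAbs
  refine enorm_sub_le.trans (add_le_add ?_ ?_)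
  · have := enorm_finsum_cre_ann_le hk (-k) (fun p => p ∉ B ∧ p - k ∉ B)
      (fun q => q ∉ B ∧ q + k ∉ B) (fun q => by simp [and_comm]) ξ S
    simpa [sub_eq_add_neg] using this
  · have := enorm_sum_cre_ann_le (neg_ne_zero.2 hk) k (B.filter (fun h => h + k ∈ B))
      (fun q => q ∈ B ∧ q + -k ∈ B) (fun q => by simp [and_comm, sub_eq_add_neg]) ξ S
    simpa using this

theorem enorm_dStar_le (B : Finset Mode) {k : Mode} (hk : k ≠ 0) (ξ : Finset Mode → ℂ)
    (S : Finset Mode) : ‖dStar B k ξ S‖ₑ ≤ dStarAbs B k (fun T => ‖ξ T‖ₑ) S := by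
  unfold dStar dStarAbs
  refine enorm_sub_le.trans (add_le_add ?_ ?_)
  · have := enorm_finsum_cre_ann_le (neg_ne_zero.2 hk) 0 (fun p => p ∉ B ∧ p - k ∉ B)
      (fun q => q ∉ B ∧ q + -k ∉ B) (fun q => by simp [sub_eq_add_neg]) ξ S
    simpa [sub_eq_add_neg] using this
  · have := enorm_sum_cre_ann_le hk 0 (B.filter (fun h => h + k ∈ B))
      (fun q => q ∈ B ∧ q + k ∈ B) (fun q => by simp) ξ S
    simpa using this

theorem dStarAbs_mono {B : Finset Mode} {k : Mode} {a b : Finset Mode → ℝ≥0∞} (h : ∀ S, a S ≤ b S)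
    (S : Finset Mode) : dStarAbs B k a S ≤ dStarAbs B k b S :=
  add_le_add (hop_mono h S) (hop_mono h S)

theorem tsum_mul_dStarAbs (B : Finset Mode) (k : Mode) (a b : Finset Mode → ℝ≥0∞) :
    ∑' S, b S * dStarAbs B k a S = ∑' S, dAbs B k b S * a S := by
  unfold dStarAbs dAbs
  simp only [mul_add, add_mul, ENNReal.tsum_add]
  rw [tsum_mul_hop _ (fun q => q ∉ B ∧ q + k ∉ B) (-k) (fun p => by simp [and_comm]),
    tsum_mul_hop _ (fun q => q ∈ B ∧ q + -k ∈ B) k (fun p => by simp [and_comm, sub_eq_add_neg]),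
    neg_neg]

/-- The majorants of `d(k)` and `d*(k)` are adjoint by exchanging sums of non-negative terms. Thus
`⟨ξ, d*(k)d(k)ξ⟩` is bounded, absolute convergence included, without any discussion of domains of
the true operators. -/
theorem tsum_enorm_mul_dStar_dOp_le (B : Finset Mode) {k : Mode} (hk : k ≠ 0)
    (ξ : Finset Mode → ℂ) :
    ∑' S, ‖ξ S‖ₑ * ‖dStar B k (dOp B k ξ) S‖ₑ ≤ ∑' S, dAbs B k (fun T => ‖ξ T‖ₑ) S ^ 2 := by
  calc _ ≤ ∑' S, ‖ξ S‖ₑ * dStarAbs B k (dAbs B k (fun T => ‖ξ T‖ₑ)) S := by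
        refine ENNReal.tsum_le_tsum fun S => ?_
        gcongr
        exact (enorm_dStar_le B hk _ S).trans (dStarAbs_mono (fun T => enorm_dOp_le B hk ξ T) S)
    _ = _ := by
        rw [tsum_mul_dStarAbs]
        simp only [sq]

/-- A hop preserves the number of momenta, which bounds every count in the Schur test. -/
theorem tsum_hop_sq_le_card (P : Mode → Prop) (k : Mode) (a : Finset Mode → ℝ≥0∞) :
    ∑' S, hop P k a S ^ 2 ≤ ∑' T : Finset Mode, (T.card : ℝ≥0∞) ^ 2 * a T ^ 2 := by
  refine (tsum_hop_sq_le P k a (fun S => S.card) (fun S => S.card) (fun S => S.card)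
    (fun S F h => by exact_mod_cast Finset.card_le_card fun q hq => (h q hq).1)
    (fun T p hp hk _ => ?_)
    (fun S F h => by exact_mod_cast Finset.card_le_card fun q hq => (h q hq).1)).trans
    (ENNReal.tsum_le_tsum fun T => by rw [sq (T.card : ℝ≥0∞)])
  rw [card_hop hp hk]

theorem tsum_dAbs_sq_le_card (B : Finset Mode) (k : Mode) (a : Finset Mode → ℝ≥0∞) :
    ∑' S, dAbs B k a S ^ 2 ≤ 4 * ∑' T : Finset Mode, (T.card : ℝ≥0∞) ^ 2 * a T ^ 2 := by
  calc _ ≤ ∑' S, 2 * (hop (fun q => q ∉ B ∧ q + k ∉ B) k a S ^ 2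
        + hop (fun q => q ∈ B ∧ q + -k ∈ B) (-k) a S ^ 2) :=
        ENNReal.tsum_le_tsum fun S => ENNReal_add_sq_le _ _
    _ ≤ 2 * (∑' T : Finset Mode, (T.card : ℝ≥0∞) ^ 2 * a T ^ 2
        + ∑' T : Finset Mode, (T.card : ℝ≥0∞) ^ 2 * a T ^ 2) := by
        rw [ENNReal.tsum_mul_left, ENNReal.tsum_add]
        exact mul_le_mul' le_rfl (add_le_add (tsum_hop_sq_le_card _ _ a) (tsum_hop_sq_le_card _ _ a))
    _ = _ := by ring

theorem tsum_enorm_mul_opE1On_le (Vhat : Mode → ℝ) (hV : ∀ k, 0 ≤ Vhat k) (kF : ℝ) (K : Set Mode)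
    (hK : ∀ k ∈ K, k ≠ 0) (ξ : Finset Mode → ℂ) :
    ∑' S, ‖ξ S‖ₑ * ‖opE1On Vhat kF K ξ S‖ₑ
      ≤ ENNReal.ofReal (1 / (2 * (2 * Real.pi) ^ 2 * (particleNumber kF : ℝ))) *
        ∑' k : K, ENNReal.ofReal (Vhat k) *
          ∑' S, dAbs (fermiBall kF) k (fun T => ‖ξ T‖ₑ) S ^ 2 := by
  set c : ℝ := 1 / (2 * (2 * Real.pi) ^ 2 * (particleNumber kF : ℝ)) with hc
  have hc0 : 0 ≤ c := by positivity
  have he : ∀ r : ℝ, 0 ≤ r → ‖(r : ℂ)‖ₑ = ENNReal.ofReal r := fun r hr => by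
    rw [← ofReal_norm, Complex.norm_real, Real.norm_of_nonneg hr]
  calc _ ≤ ∑' S, ‖ξ S‖ₑ * (ENNReal.ofReal c * ∑' k : K, ENNReal.ofReal (Vhat k) *
        ‖dStar (fermiBall kF) k (dOp (fermiBall kF) k ξ) S‖ₑ) := by
        refine ENNReal.tsum_le_tsum fun S => ?_
        gcongr
        unfold opE1On
        rw [enorm_mul, he c hc0]
        gcongr
        refine enorm_tsum_le_tsum_enorm.trans (ENNReal.tsum_le_tsum fun k => ?_)
        rw [enorm_mul, he _ (hV k)]
    _ = ENNReal.ofReal c * ∑' k : K, ENNReal.ofReal (Vhat k) * ∑' S, ‖ξ S‖ₑ *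
        ‖dStar (fermiBall kF) k (dOp (fermiBall kF) k ξ) S‖ₑ := by
        simp only [← ENNReal.tsum_mul_left]
        rw [ENNReal.tsum_comm]
        refine tsum_congr fun k => tsum_congr fun S => ?_
        ring
    _ ≤ _ := by
        exact mul_le_mul' le_rfl (ENNReal.tsum_le_tsum fun k =>
          mul_le_mul' le_rfl (tsum_enorm_mul_dStar_dOp_le _ (hK k k.2) ξ))

theorem expect_opE1On_le (Vhat : Mode → ℝ) (hV : ∀ k, 0 ≤ Vhat k) (kF : ℝ) (K : Set Mode)
    (hK : ∀ k ∈ K, k ≠ 0) (hsum : Summable (fun k : K => Vhat k)) (ξ : Finset Mode → ℂ) (D : ℝ)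
    (hD0 : 0 ≤ D)
    (hD : ∀ k ∈ K, ∑' S, dAbs (fermiBall kF) k (fun T => ‖ξ T‖ₑ) S ^ 2 ≤ ENNReal.ofReal D) :
    Summable (fun S => starRingEnd ℂ (ξ S) * opE1On Vhat kF K ξ S) ∧
      ‖expect (opE1On Vhat kF K) ξ‖
        ≤ 1 / (2 * (2 * Real.pi) ^ 2 * (particleNumber kF : ℝ)) * ((∑' k : K, Vhat k) * D) := by
  set c : ℝ := 1 / (2 * (2 * Real.pi) ^ 2 * (particleNumber kF : ℝ)) with hc
  have hc0 : 0 ≤ c := by positivity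
  have hV0 : 0 ≤ ∑' k : K, Vhat k := tsum_nonneg fun k : K => hV k
  have hb : ∑' S, ‖starRingEnd ℂ (ξ S) * opE1On Vhat kF K ξ S‖ₑ
      ≤ ENNReal.ofReal (c * ((∑' k : K, Vhat k) * D)) := by
    have e1 : ∀ S, ‖starRingEnd ℂ (ξ S) * opE1On Vhat kF K ξ S‖ₑ
        = ‖ξ S‖ₑ * ‖opE1On Vhat kF K ξ S‖ₑ := fun S => by
      rw [enorm_mul, ← ofReal_norm (starRingEnd ℂ (ξ S)), RCLike.norm_conj, ofReal_norm]
    simp only [e1]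
    refine (tsum_enorm_mul_opE1On_le Vhat hV kF K hK ξ).trans ?_
    rw [ENNReal.ofReal_mul hc0, ENNReal.ofReal_mul hV0,
      ENNReal.ofReal_tsum_of_nonneg (fun k : K => hV k) hsum, ← ENNReal.tsum_mul_right]
    exact mul_le_mul' le_rfl (ENNReal.tsum_le_tsum fun k => mul_le_mul' le_rfl (hD k k.2))
  have hs : Summable (fun S => starRingEnd ℂ (ξ S) * opE1On Vhat kF K ξ S) := by
    refine Summable.of_norm ?_
    have hne : ∑' S, ‖starRingEnd ℂ (ξ S) * opE1On Vhat kF K ξ S‖ₑ ≠ ∞ :=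
      ne_top_of_le_ne_top ENNReal.ofReal_ne_top hb
    have := ENNReal.summable_toReal hne
    simpa using this
  refine ⟨hs, ?_⟩
  have h1 : ‖expect (opE1On Vhat kF K) ξ‖ₑ ≤ ENNReal.ofReal (c * ((∑' k : K, Vhat k) * D)) :=
    enorm_tsum_le_tsum_enorm.trans hb
  rw [← ofReal_norm] at h1
  exact (ENNReal.ofReal_le_ofReal_iff (mul_nonneg hc0 (mul_nonneg hV0 hD0))).1 h1

end FermiGas

namespace FermiGas
open scoped ENNReal

/-! ### The truncated operator -/

/-- A discrete form of `∫ x^{b-1} = x^b / b`: the induction step is `b (J+1)^{b-1} ≤ (J+1)^b - J^b`,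
which is Bernoulli's inequality for the exponent `b ≤ 1`. -/
theorem sum_rpow_sub_one_le {b : ℝ} (hb0 : 0 < b) (hb1 : b < 1) (J : ℕ) :
    ∑ j ∈ Finset.Icc 1 J, (j : ℝ) ^ (b - 1) ≤ (J : ℝ) ^ b / b := by
  induction J with
  | zero => simp [Real.zero_rpow hb0.ne']
  | succ J ih =>
    rw [Finset.sum_Icc_succ_top (by omega)]
    have hJ : (0 : ℝ) < (J : ℝ) + 1 := by positivity
    have h1 : (1 + -(1 / ((J : ℝ) + 1))) ^ b ≤ 1 + b * -(1 / ((J : ℝ) + 1)) :=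
      rpow_one_add_le_one_add_mul_self (by
        have : 1 / ((J : ℝ) + 1) ≤ 1 := by rw [div_le_one hJ]; linarith [Nat.cast_nonneg (α := ℝ) J]
        linarith) hb0.le hb1.le
    have h2 : (J : ℝ) = ((J : ℝ) + 1) * (1 + -(1 / ((J : ℝ) + 1))) := by field_simp; ring
    have h3 : (J : ℝ) ^ b ≤ ((J : ℝ) + 1) ^ b * (1 + b * -(1 / ((J : ℝ) + 1))) := by
      conv_lhs => rw [h2]
      rw [Real.mul_rpow hJ.le (by
        have : 1 / ((J : ℝ) + 1) ≤ 1 := by rw [div_le_one hJ]; linarith [Nat.cast_nonneg (α := ℝ) J]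
        linarith)]
      gcongr
    have h4 : ((J : ℝ) + 1) ^ (b - 1) = ((J : ℝ) + 1) ^ b * (1 / ((J : ℝ) + 1)) := by
      rw [Real.rpow_sub_one hJ.ne']; ring
    rw [le_div_iff₀ hb0] at ih ⊢
    push_cast
    rw [h4]
    nlinarith

/-- Group by the sup norm `j`: a sphere of that norm has `8j` points, and `|k| ≥ j` may be used
because the exponent `b - 2` is negative. -/
theorem sum_modeNorm_rpow_le {b : ℝ} (hb0 : 0 < b) (hb1 : b < 1) (X : ℝ) (hX : 0 ≤ X)
    (F : Finset Mode) (hF : ∀ k ∈ F, k ≠ 0 ∧ modeNorm k < X) :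
    ∑ k ∈ F, modeNorm k ^ (b - 2) ≤ 8 / b * X ^ b := by
  classical
  set s : Mode → ℕ := fun k => max (cx k).natAbs (cy k).natAbs with hs
  have hsn : ∀ k, (s k : ℝ) ≤ modeNorm k := by
    intro k
    simp only [hs, Nat.cast_max, Nat.cast_natAbs, Int.cast_abs]
    exact max_le (abs_cx_le (modeNorm_nonneg k) (modeNorm_sq k).ge)
      (abs_cy_le (modeNorm_nonneg k) (modeNorm_sq k).ge)
  have hs1 : ∀ k, k ≠ 0 → 1 ≤ s k := by
    intro k hk
    by_contra! h
    have h0 : s k = 0 := by omega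
    simp only [hs] at h0
    exact hk (mode_ext (by simp; omega) (by simp; omega))
  have hmap : ∀ k ∈ F, s k ∈ Finset.Icc 1 ⌊X⌋₊ := by
    intro k hk
    obtain ⟨h0, h1⟩ := hF k hk
    rw [Finset.mem_Icc]
    exact ⟨hs1 k h0, Nat.le_floor ((hsn k).trans h1.le)⟩
  rw [← Finset.sum_fiberwise_of_maps_to hmap]
  calc _ ≤ ∑ j ∈ Finset.Icc 1 ⌊X⌋₊, 8 * (j : ℝ) ^ (b - 1) := by
        refine Finset.sum_le_sum fun j hj => ?_
        have hj1 := (Finset.mem_Icc.1 hj).1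
        have hj0 : (0 : ℝ) < j := by exact_mod_cast hj1
        calc _ ≤ ∑ k ∈ F.filter (fun k => s k = j), (j : ℝ) ^ (b - 2) := by
              refine Finset.sum_le_sum fun k hk => ?_
              rw [← (Finset.mem_filter.1 hk).2]
              refine Real.rpow_le_rpow_of_nonpos ?_ (hsn k) (by linarith)
              rw [(Finset.mem_filter.1 hk).2]; exact hj0
          _ = ((F.filter (fun k => s k = j)).card : ℝ) * (j : ℝ) ^ (b - 2) := by
              rw [Finset.sum_const, nsmul_eq_mul]
          _ ≤ (8 * j) * (j : ℝ) ^ (b - 2) := by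
              gcongr
              have h1 : (F.filter (fun k => s k = j)).card ≤ (Finset.box j : Finset (ℤ × ℤ)).card := by
                refine Finset.card_le_card_of_injOn ofLex (fun k hk => ?_) ofLex.injective.injOn
                rw [Finset.mem_coe, Int.mem_box]
                exact (Finset.mem_filter.1 hk).2
              rw [Int.card_box (by omega)] at h1
              exact_mod_cast h1
          _ = 8 * (j : ℝ) ^ (b - 1) := by
              have : b - 1 = (b - 2) + 1 := by ring
              rw [this, Real.rpow_add_one hj0.ne']; ring
    _ = 8 * ∑ j ∈ Finset.Icc 1 ⌊X⌋₊, (j : ℝ) ^ (b - 1) := by rw [Finset.mul_sum]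
    _ ≤ 8 * ((⌊X⌋₊ : ℝ) ^ b / b) := by gcongr; exact sum_rpow_sub_one_le hb0 hb1 _
    _ ≤ 8 * (X ^ b / b) := by gcongr; exact Nat.floor_le hX
    _ = _ := by ring

/-- Cauchy–Schwarz for `V̂ = (|k|^{(2-b)/2} V̂) · |k|^{(b-2)/2}`, a factorization valid because `k ≠
0`. -/
theorem sum_potential_le {Vhat : Mode → ℝ} {b : ℝ} (hb0 : 0 < b)
    (hb1 : b < 1) (hsum : Summable (fun k : Mode => modeNorm k ^ (2 - b) * Vhat k ^ 2)) (X : ℝ)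
    (hX : 0 ≤ X) (F : Finset Mode) (hF : ∀ k ∈ F, k ≠ 0 ∧ modeNorm k < X) :
    ∑ k ∈ F, Vhat k
      ≤ Real.sqrt ((∑' k : Mode, modeNorm k ^ (2 - b) * Vhat k ^ 2) * (8 / b)) * X ^ (b / 2) := by
  set A := ∑' k : Mode, modeNorm k ^ (2 - b) * Vhat k ^ 2
  have hA : ∑ k ∈ F, modeNorm k ^ (2 - b) * Vhat k ^ 2 ≤ A :=
    hsum.sum_le_tsum F (fun k _ => by have := modeNorm_nonneg k; positivity)
  have hA0 : 0 ≤ A := tsum_nonneg fun k => by have := modeNorm_nonneg k; positivity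
  have hcs := Finset.sum_mul_sq_le_sq_mul_sq F (fun k => modeNorm k ^ ((2 - b) / 2) * Vhat k)
    (fun k => modeNorm k ^ ((b - 2) / 2))
  have e1 : ∀ k ∈ F, modeNorm k ^ ((2 - b) / 2) * Vhat k * modeNorm k ^ ((b - 2) / 2) = Vhat k := by
    intro k hk
    have hp : 0 < modeNorm k := zero_lt_one.trans_le (one_le_modeNorm (hF k hk).1)
    rw [mul_right_comm, ← Real.rpow_add hp]
    ring_nf; simp
  have e2 : ∀ k ∈ F, (modeNorm k ^ ((2 - b) / 2) * Vhat k) ^ 2 = modeNorm k ^ (2 - b) * Vhat k ^ 2 := by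
    intro k _
    rw [mul_pow, ← Real.rpow_natCast (modeNorm k ^ ((2 - b) / 2)), ← Real.rpow_mul (modeNorm_nonneg k)]
    norm_num
  have e3 : ∀ k ∈ F, (modeNorm k ^ ((b - 2) / 2)) ^ 2 = modeNorm k ^ (b - 2) := by
    intro k _
    rw [← Real.rpow_natCast, ← Real.rpow_mul (modeNorm_nonneg k)]
    norm_num
  rw [Finset.sum_congr rfl e1, Finset.sum_congr rfl e2, Finset.sum_congr rfl e3] at hcs
  refine abs_le_of_sq_le_sq' ?_ (by positivity) |>.2
  calc _ ≤ _ := hcs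
    _ ≤ A * (8 / b * X ^ b) := by
      gcongr
      · exact Finset.sum_nonneg fun k _ => Real.rpow_nonneg (modeNorm_nonneg k) _
      · exact sum_modeNorm_rpow_le hb0 hb1 X hX F hF
    _ = _ := by
      rw [mul_pow, Real.sq_sqrt (by positivity), ← Real.rpow_natCast (X ^ (b / 2)), ← Real.rpow_mul hX]
      norm_num
      ring

theorem tsum_card_sq_enorm_sq {ξ : Finset Mode → ℂ}
    (hξ : Summable (fun S : Finset Mode => (S.card : ℝ) ^ 2 * ‖ξ S‖ ^ 2)) :
    ∑' S : Finset Mode, (S.card : ℝ≥0∞) ^ 2 * ‖ξ S‖ₑ ^ 2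
      = ENNReal.ofReal (∑' S : Finset Mode, (S.card : ℝ) ^ 2 * ‖ξ S‖ ^ 2) := by
  rw [ENNReal.ofReal_tsum_of_nonneg (fun S => by positivity) hξ]
  refine tsum_congr fun S => ?_
  rw [ENNReal.ofReal_mul (by positivity), ENNReal.ofReal_pow (by positivity),
    ENNReal.ofReal_pow (by positivity), ENNReal.ofReal_natCast, ofReal_norm]

theorem tsum_dAbs_sq_le_ofReal {ξ : Finset Mode → ℂ}
    (hξ : Summable (fun S : Finset Mode => (S.card : ℝ) ^ 2 * ‖ξ S‖ ^ 2)) (B : Finset Mode) (k : Mode) :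
    ∑' S, dAbs B k (fun T => ‖ξ T‖ₑ) S ^ 2
      ≤ ENNReal.ofReal (4 * ∑' S : Finset Mode, (S.card : ℝ) ^ 2 * ‖ξ S‖ ^ 2) := by
  refine (tsum_dAbs_sq_le_card B k _).trans ?_
  rw [tsum_card_sq_enorm_sq hξ, ENNReal.ofReal_mul (by norm_num)]
  norm_num

theorem exists_opE1Trunc_bound (Vhat : Mode → ℝ) (hVnonneg : ∀ k, 0 ≤ Vhat k) (b : ℝ) (hb0 : 0 < b)
    (hb1 : b < 1) (hsum : Summable (fun k : Mode => modeNorm k ^ (2 - b) * Vhat k ^ 2))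
    (Λ : ℝ) (hΛ : 0 < Λ) :
    ∃ C : ℝ, 0 < C ∧ ∀ kF : ℝ, IsFermiMomentum kF → ∀ ξ : Fock,
      Summable (fun S : Finset Mode => (S.card : ℝ) ^ 2 * ‖ξ S‖ ^ 2) →
      Summable (fun S : Finset Mode => starRingEnd ℂ (ξ S) * opE1Trunc Vhat kF Λ ξ S) ∧
      ‖expect (opE1Trunc Vhat kF Λ) ξ‖ ≤ C * (particleNumber kF : ℝ) ^ (-1 + b / 4) *
        ∑' S : Finset Mode, (S.card : ℝ) ^ 2 * ‖ξ S‖ ^ 2 := by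
  set A := Real.sqrt ((∑' k : Mode, modeNorm k ^ (2 - b) * Vhat k ^ 2) * (8 / b)) with hA
  refine ⟨A * Λ ^ (b / 2) + 1, by positivity, fun kF hkF ξ hξ => ?_⟩
  set N : ℝ := (particleNumber kF : ℝ) with hN
  have hN1 : 1 ≤ N := by rw [hN]; exact_mod_cast one_le_particleNumber hkF.1
  have hN0 : 0 < N := by linarith
  set K : Set Mode := {k | k ≠ 0 ∧ modeNorm k < Λ * N ^ (1 / 2 : ℝ)} with hK
  have hKfin : K.Finite := (Finset.finite_toSet (fermiBall (Λ * N ^ (1 / 2 : ℝ)))).subset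
    fun k hk => mem_fermiBall.2 hk.2
  have : Finite K := hKfin
  set M := ∑' S : Finset Mode, (S.card : ℝ) ^ 2 * ‖ξ S‖ ^ 2 with hM
  have hM0 : 0 ≤ M := tsum_nonneg fun S => by positivity
  obtain ⟨h1, h2⟩ := expect_opE1On_le Vhat hVnonneg kF K (fun k hk => hk.1)
    (Summable.of_finite) ξ (4 * M) (by positivity)
    (fun k _ => tsum_dAbs_sq_le_ofReal hξ _ k)
  refine ⟨h1, h2.trans ?_⟩
  have h3 : ∑' k : K, Vhat k ≤ A * (Λ * N ^ (1 / 2 : ℝ)) ^ (b / 2) := by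
    have : ∑' k : K, Vhat k = ∑ k ∈ hKfin.toFinset, Vhat k := by
      conv_lhs => rw [← hKfin.coe_toFinset]
      exact Finset.tsum_subtype' _ Vhat
    rw [this]
    exact sum_potential_le hb0 hb1 hsum _ (by positivity) _ (fun k hk => hKfin.mem_toFinset.1 hk)
  have h4 : (Λ * N ^ (1 / 2 : ℝ)) ^ (b / 2) = Λ ^ (b / 2) * N ^ (b / 4) := by
    rw [Real.mul_rpow hΛ.le (by positivity), ← Real.rpow_mul hN0.le]
    ring_nf
  rw [h4] at h3
  have h5 : N ^ (-1 + b / 4) = N⁻¹ * N ^ (b / 4) := by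
    rw [Real.rpow_add hN0, Real.rpow_neg_one]
  have hpi : 1 ≤ Real.pi := by linarith [Real.pi_gt_three]
  -- The factor `1 / 4` cancels the `4` in the bound by `⟨𝒩²⟩`.
  have h6 : 1 / (2 * (2 * Real.pi) ^ 2 * N) ≤ 1 / 4 * N⁻¹ := by
    rw [one_div, mul_inv]
    gcongr
    rw [one_div]
    gcongr
    nlinarith
  have h7 : 0 ≤ ∑' k : K, Vhat k := tsum_nonneg fun k : K => hVnonneg k
  rw [h5]
  calc _ ≤ (1 / 4 * N⁻¹) * ((A * (Λ ^ (b / 2) * N ^ (b / 4))) * (4 * M)) := by gcongr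
    _ = (A * Λ ^ (b / 2)) * (N⁻¹ * N ^ (b / 4)) * M := by ring
    _ ≤ _ := by gcongr; linarith

end FermiGas

namespace FermiGas
open MeasureTheory Complex

/-! ### Slater determinants -/

/-- The box `[0,2π]^{2n}`. -/
def torusBox (n : ℕ) : Set (Fin n → Fin 2 → ℝ) :=
  Set.Icc (0 : Fin n → Fin 2 → ℝ) (fun _ _ => 2 * Real.pi)

/-- The inner product of `L²([0,2π]^{2n})`. -/
noncomputable def boxInner (n : ℕ) (f g : (Fin n → Fin 2 → ℝ) → ℂ) : ℂ :=
  ∫ x in torusBox n, starRingEnd ℂ (f x) * g x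

theorem integral_exp_int_mul (m : ℤ) :
    ∫ x in Set.Icc (0 : ℝ) (2 * Real.pi), Complex.exp (Complex.I * ((m : ℝ) * x : ℝ))
      = if m = 0 then ((2 * Real.pi : ℝ) : ℂ) else 0 := by
  have h0 : (0 : ℝ) ≤ 2 * Real.pi := by positivity
  rw [integral_Icc_eq_integral_Ioc, ← intervalIntegral.integral_of_le h0]
  split_ifs with h
  · simp [h]
  · have hc : Complex.I * (m : ℂ) ≠ 0 := by simp [h]
    have := integral_exp_mul_complex (a := 0) (b := 2 * Real.pi) hc
    have e : ∀ x : ℝ, Complex.exp (Complex.I * ((m : ℝ) * x : ℝ)) = Complex.exp (Complex.I * m * x) := by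
      intro x; push_cast; ring_nf
    simp only [e]
    rw [this]
    have e1 : Complex.exp (Complex.I * m * ((2 * Real.pi : ℝ) : ℂ)) = 1 := by
      rw [Complex.exp_eq_one_iff]
      exact ⟨m, by push_cast; ring⟩
    rw [e1]
    simp

theorem integral_Icc_pi_prod {m : ℕ} {E : Type*} [MeasureSpace E] [Preorder E]
    [SigmaFinite (volume : Measure E)] (a b : Fin m → E) (f : Fin m → E → ℂ) :
    ∫ x in Set.Icc a b, ∏ i, f i (x i) = ∏ i, ∫ y in Set.Icc (a i) (b i), f i y := by
  rw [← Set.pi_univ_Icc, volume_pi, Measure.restrict_pi_pi, integral_fintype_prod_eq_prod]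

theorem planeWave_def' (p : Mode) (x : Fin 2 → ℝ) :
    planeWave p x = ((1 / (2 * Real.pi) : ℝ) : ℂ) *
      Complex.exp (Complex.I * (((cx p : ℝ) * x 0 + (cy p : ℝ) * x 1 : ℝ) : ℂ)) := rfl

theorem continuous_planeWave (p : Mode) : Continuous (planeWave p) := by
  unfold planeWave modeDot
  fun_prop

theorem integral_planeWave (p q : Mode) :
    ∫ x in Set.Icc (0 : Fin 2 → ℝ) (fun _ => 2 * Real.pi), starRingEnd ℂ (planeWave p x) * planeWave q x
      = if p = q then 1 else 0 := by
  have e : ∀ x : Fin 2 → ℝ, starRingEnd ℂ (planeWave p x) * planeWave q x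
      = ∏ i : Fin 2, ((1 / (2 * Real.pi) : ℝ) : ℂ) *
        Complex.exp (Complex.I * (((![cx q - cx p, cy q - cy p] i : ℤ) : ℝ) * x i : ℝ)) := by
    intro x
    rw [Fin.prod_univ_two, planeWave_def', planeWave_def', map_mul, ← Complex.exp_conj, map_mul,
      Complex.conj_ofReal, Complex.conj_ofReal, Complex.conj_I]
    have : ∀ c A B A' B' : ℂ, A * B = A' * B' → c * A * (c * B) = c * A' * (c * B') := by
      intro c A B A' B' h
      linear_combination c ^ 2 * h
    apply this
    rw [← Complex.exp_add, ← Complex.exp_add]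
    congr 1
    simp
    ring
  simp only [e]
  rw [integral_Icc_pi_prod (0 : Fin 2 → ℝ) (fun _ => 2 * Real.pi)
    (fun i y => ((1 / (2 * Real.pi) : ℝ) : ℂ) *
        Complex.exp (Complex.I * (((![cx q - cx p, cy q - cy p] i : ℤ) : ℝ) * y : ℝ)))]
  have h2 : ∀ i : Fin 2, ∫ y in Set.Icc ((0 : Fin 2 → ℝ) i) (2 * Real.pi), ((1 / (2 * Real.pi) : ℝ) : ℂ) *
        Complex.exp (Complex.I * (((![cx q - cx p, cy q - cy p] i : ℤ) : ℝ) * y : ℝ))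
      = if ![cx q - cx p, cy q - cy p] i = 0 then 1 else 0 := by
    intro i
    rw [integral_const_mul, Pi.zero_apply, integral_exp_int_mul]
    split_ifs
    · rw [← Complex.ofReal_mul]
      have : (1 / (2 * Real.pi)) * (2 * Real.pi) = 1 := by field_simp
      rw [this, Complex.ofReal_one]
    · simp
  rw [Finset.prod_congr rfl fun i _ => h2 i, Fin.prod_univ_two]
  by_cases h : p = q
  · simp [h]
  · rw [if_neg h]
    by_cases hx : cx p = cx q
    · have hy : cy p ≠ cy q := fun hy => h (mode_ext hx hy)
      simp [sub_eq_zero, hx, hy.symm]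
    · simp [sub_eq_zero, Ne.symm hx]

theorem integral_prod_planeWave {n : ℕ} (s t : Fin n → Mode) :
    boxInner n (fun x => ∏ l, planeWave (s l) (x l)) (fun x => ∏ l, planeWave (t l) (x l))
      = if s = t then 1 else 0 := by
  unfold boxInner torusBox
  simp only [map_prod, ← Finset.prod_mul_distrib]
  have := integral_Icc_pi_prod (0 : Fin n → Fin 2 → ℝ) (fun _ _ => 2 * Real.pi)
    (fun l y => starRingEnd ℂ (planeWave (s l) y) * planeWave (t l) y)
  rw [this]
  have h2 : ∀ l, ∫ y in Set.Icc ((0 : Fin n → Fin 2 → ℝ) l) (fun _ => 2 * Real.pi),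
      starRingEnd ℂ (planeWave (s l) y) * planeWave (t l) y = if s l = t l then 1 else 0 :=
    fun l => integral_planeWave (s l) (t l)
  rw [Finset.prod_congr rfl fun i _ => h2 i]
  by_cases h : s = t
  · simp [h]
  · obtain ⟨l, hl⟩ := Function.ne_iff.1 h
    rw [if_neg h]
    exact Finset.prod_eq_zero (Finset.mem_univ l) (by simp [hl])

theorem integrable_box {n : ℕ} {f : (Fin n → Fin 2 → ℝ) → ℂ} (hf : Continuous f) :
    IntegrableOn f (torusBox n) :=
  hf.continuousOn.integrableOn_compact isCompact_Icc

theorem boxInner_sum_right {n : ℕ} {ι : Type*} (J : Finset ι) (f : (Fin n → Fin 2 → ℝ) → ℂ)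
    (g : ι → (Fin n → Fin 2 → ℝ) → ℂ) (c : ι → ℂ) (hf : Continuous f) (hg : ∀ i, Continuous (g i)) :
    boxInner n f (fun x => ∑ i ∈ J, c i * g i x) = ∑ i ∈ J, c i * boxInner n f (g i) := by
  unfold boxInner
  simp only [Finset.mul_sum]
  rw [integral_finsetSum]
  · refine Finset.sum_congr rfl fun i _ => ?_
    rw [← integral_const_mul]
    congr 1; ext x; ring
  · intro i _
    refine integrable_box ?_
    have := hg i
    fun_prop

theorem boxInner_conj {n : ℕ} (f g : (Fin n → Fin 2 → ℝ) → ℂ) :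
    starRingEnd ℂ (boxInner n f g) = boxInner n g f := by
  unfold boxInner
  rw [← integral_conj]
  congr 1; ext x; simp [mul_comm]

theorem boxInner_sum_left {n : ℕ} {ι : Type*} (J : Finset ι) (f : (Fin n → Fin 2 → ℝ) → ℂ)
    (g : ι → (Fin n → Fin 2 → ℝ) → ℂ) (c : ι → ℂ) (hf : Continuous f) (hg : ∀ i, Continuous (g i)) :
    boxInner n (fun x => ∑ i ∈ J, c i * g i x) f
      = ∑ i ∈ J, starRingEnd ℂ (c i) * boxInner n (g i) f := by
  rw [← boxInner_conj, boxInner_sum_right J f g c hf hg, map_sum]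
  simp [boxInner_conj]

/-- The normalized determinant of the plane waves with momenta `t`. -/
noncomputable def detWave {n : ℕ} (t : Fin n → Mode) (x : Fin n → Fin 2 → ℝ) : ℂ :=
  (((n.factorial : ℝ) ^ (-(1 / 2) : ℝ) : ℝ) : ℂ) *
    Matrix.det (Matrix.of fun j l : Fin n => planeWave (t j) (x l))

/-- The increasing enumeration of a configuration. -/
noncomputable def confEmb {n : ℕ} (S : NConf n) : Fin n → Mode := S.1.orderEmbOfFin S.2

theorem slater_eq_detWave {n : ℕ} (S : NConf n) : slater n S = detWave (confEmb S) := rfl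

theorem confEmb_injective {n : ℕ} (S : NConf n) : Function.Injective (confEmb S) :=
  (S.1.orderEmbOfFin S.2).injective

theorem confEmb_mem {n : ℕ} (S : NConf n) (j : Fin n) : confEmb S j ∈ S.1 :=
  Finset.orderEmbOfFin_mem _ _ _

theorem range_confEmb {n : ℕ} (S : NConf n) : Set.range (confEmb S) = S.1 :=
  Finset.range_orderEmbOfFin _ _

theorem detWave_eq_sum {n : ℕ} (t : Fin n → Mode) (x : Fin n → Fin 2 → ℝ) :
    detWave t x = ∑ σ : Equiv.Perm (Fin n),
      ((((n.factorial : ℝ) ^ (-(1 / 2) : ℝ) : ℝ) : ℂ) * ((Equiv.Perm.sign σ : ℤ) : ℂ)) *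
        ∏ l, planeWave (t (σ l)) (x l) := by
  rw [detWave, Matrix.det_apply', Finset.mul_sum]
  simp [mul_assoc]

theorem continuous_prod_planeWave {n : ℕ} (t : Fin n → Mode) :
    Continuous (fun x : Fin n → Fin 2 → ℝ => ∏ l, planeWave (t l) (x l)) :=
  continuous_finsetProd _ fun l _ => (continuous_planeWave (t l)).comp (continuous_apply l)

theorem continuous_detWave {n : ℕ} (t : Fin n → Mode) : Continuous (detWave t) := by
  have : detWave t = fun x => detWave t x := rfl
  rw [this]
  simp only [detWave_eq_sum]
  exact continuous_finsetSum _ fun σ _ => continuous_const.mul (continuous_prod_planeWave _)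

theorem continuous_slater {n : ℕ} (S : NConf n) : Continuous (slater n S) := continuous_detWave _

theorem boxInner_detWave {n : ℕ} (s t : Fin n → Mode) :
    boxInner n (detWave s) (detWave t) = ∑ σ : Equiv.Perm (Fin n), ∑ τ : Equiv.Perm (Fin n),
      ((1 / (n.factorial : ℝ) : ℝ) : ℂ) * ((Equiv.Perm.sign σ : ℤ) : ℂ) * ((Equiv.Perm.sign τ : ℤ) : ℂ)
        * (if s ∘ σ = t ∘ τ then 1 else 0) := by
  have h1 : detWave s = fun x => detWave s x := rfl
  have h2 : detWave t = fun x => detWave t x := rfl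
  have hc : ((n.factorial : ℝ) ^ (-(1 / 2) : ℝ)) * ((n.factorial : ℝ) ^ (-(1 / 2) : ℝ))
      = 1 / (n.factorial : ℝ) := by
    rw [← Real.rpow_add (by positivity)]
    norm_num [Real.rpow_neg_one]
  rw [h1, h2]
  simp only [detWave_eq_sum]
  rw [boxInner_sum_left]
  · refine Finset.sum_congr rfl fun σ _ => ?_
    rw [boxInner_sum_right]
    · rw [Finset.mul_sum]
      refine Finset.sum_congr rfl fun τ _ => ?_
      have := integral_prod_planeWave (fun l => s (σ l)) (fun l => t (τ l))
      rw [this, ← hc]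
      simp only [map_mul, Complex.conj_ofReal, map_intCast, Complex.ofReal_mul, Function.comp_def]
      ring
    · exact continuous_prod_planeWave _
    · exact fun τ => continuous_prod_planeWave _
  · exact continuous_finsetSum _ fun σ _ => continuous_const.mul (continuous_prod_planeWave _)
  · exact fun τ => continuous_prod_planeWave _

/-- A non-zero term requires the two enumerations to have the same range, hence `S = T`. Then
injectivity forces `σ = τ`, leaving `n!` terms equal to `1 / n!`. -/
theorem boxInner_slater {n : ℕ} (S T : NConf n) :
    boxInner n (slater n S) (slater n T) = if S = T then 1 else 0 := by
  rw [slater_eq_detWave, slater_eq_detWave, boxInner_detWave]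
  split_ifs with h
  · subst h
    have h1 : ∀ σ τ : Equiv.Perm (Fin n), confEmb S ∘ σ = confEmb S ∘ τ ↔ σ = τ := by
      intro σ τ
      refine ⟨fun h => Equiv.ext fun l => confEmb_injective S (congrFun h l), fun h => by rw [h]⟩
    simp only [h1, mul_ite, mul_one, mul_zero, Finset.sum_ite_eq, Finset.mem_univ, if_true]
    have h2 : ∀ σ : Equiv.Perm (Fin n), ((Equiv.Perm.sign σ : ℤ) : ℂ) * ((Equiv.Perm.sign σ : ℤ) : ℂ) = 1 := by
      intro σ
      rcases Int.units_eq_one_or (Equiv.Perm.sign σ) with h | h <;> simp [h]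
    simp only [mul_assoc, h2]
    rw [Finset.sum_const, Finset.card_univ, Fintype.card_perm, Fintype.card_fin, nsmul_eq_mul, mul_one]
    have : (n.factorial : ℂ) ≠ 0 := by exact_mod_cast n.factorial_ne_zero
    push_cast
    field_simp
  · refine Finset.sum_eq_zero fun σ _ => Finset.sum_eq_zero fun τ _ => ?_
    rw [if_neg, mul_zero]
    intro heq
    apply h
    apply Subtype.ext
    apply Finset.coe_injective
    rw [← range_confEmb, ← range_confEmb, ← EquivLike.range_comp (confEmb S) σ, heq,
      EquivLike.range_comp]

/-- `ρ_k(x) = ∑_l e^{-ik·x_l}`. -/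
noncomputable def rho {n : ℕ} (k : Mode) (x : Fin n → Fin 2 → ℝ) : ℂ :=
  ∑ l, Complex.exp (-(Complex.I * (modeDot k (x l) : ℂ)))

theorem continuous_rho {n : ℕ} (k : Mode) : Continuous (rho (n := n) k) := by
  unfold rho modeDot
  fun_prop

theorem exp_mul_planeWave (k p : Mode) (y : Fin 2 → ℝ) :
    Complex.exp (-(Complex.I * (modeDot k y : ℂ))) * planeWave p y = planeWave (p - k) y := by
  rw [planeWave_def', planeWave_def', mul_left_comm, ← Complex.exp_add]
  congr 2
  have : modeDot k y = (cx k : ℝ) * y 0 + (cy k : ℝ) * y 1 := rfl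
  rw [this]
  simp
  ring

/-- In the term of `σ`, the phase of particle `l` shifts the momentum with index `j = σ l`; summing
over `l` is summing over `j`. -/
theorem rho_mul_detWave {n : ℕ} (k : Mode) (t : Fin n → Mode) (x : Fin n → Fin 2 → ℝ) :
    rho k x * detWave t x = ∑ j, detWave (Function.update t j (t j - k)) x := by
  simp only [detWave_eq_sum]
  rw [Finset.sum_comm, Finset.mul_sum]
  refine Finset.sum_congr rfl fun σ _ => ?_
  rw [← Finset.mul_sum, mul_left_comm]
  congr 1
  rw [← Equiv.sum_comp σ, rho, Finset.sum_mul]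
  refine Finset.sum_congr rfl fun l _ => ?_
  rw [← Finset.mul_prod_erase _ _ (Finset.mem_univ l), ← mul_assoc, exp_mul_planeWave,
    ← Finset.mul_prod_erase (Finset.univ) (fun l' => planeWave
      (Function.update t (σ l) (t (σ l) - k) (σ l')) (x l')) (Finset.mem_univ l)]
  congr 1
  · simp
  · refine Finset.prod_congr rfl fun l' hl' => ?_
    rw [Function.update_of_ne]
    exact fun h => (Finset.ne_of_mem_erase hl') (σ.injective h)

theorem detWave_eq_zero {n : ℕ} {t : Fin n → Mode} {i j : Fin n} (hij : i ≠ j) (h : t i = t j)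
    (x : Fin n → Fin 2 → ℝ) : detWave t x = 0 := by
  rw [detWave, Matrix.det_zero_of_row_eq hij, mul_zero]
  ext l
  simp [h]

/-- The factor is the sign of the sorting permutation. Only its modulus is recorded: the later
estimates never need the actual fermionic signs of the hopping amplitudes. -/
theorem exists_detWave_eq_slater {n : ℕ} {u : Fin n → Mode} (hu : Function.Injective u) (U : NConf n)
    (hU : ∀ j, u j ∈ U.1) : ∃ s : ℂ, ‖s‖ = 1 ∧ ∀ x, detWave u x = s * slater n U x := by
  have h1 : ∀ j, ∃ i, confEmb U i = u j := by
    intro j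
    have : u j ∈ Set.range (confEmb U) := by rw [range_confEmb]; exact hU j
    exact this
  choose f hf using h1
  have hfi : Function.Injective f := fun a b hab => hu (by rw [← hf a, ← hf b, hab])
  set σ : Equiv.Perm (Fin n) := Equiv.ofBijective f (Finite.injective_iff_bijective.1 hfi)
  refine ⟨((Equiv.Perm.sign σ : ℤ) : ℂ), ?_, fun x => ?_⟩
  · rcases Int.units_eq_one_or (Equiv.Perm.sign σ) with h | h <;> simp [h]
  · have h2 := Matrix.det_permute σ (Matrix.of fun j l : Fin n => planeWave (confEmb U j) (x l))
    have h3 : (Matrix.of fun j l : Fin n => planeWave (u j) (x l))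
        = (Matrix.of fun j l : Fin n => planeWave (confEmb U j) (x l)).submatrix σ id := by
      ext j l
      simp only [Matrix.of_apply, Matrix.submatrix_apply, id]
      rw [show σ j = f j from rfl, hf]
    rw [slater_eq_detWave, detWave, detWave, h3, h2]
    ring

/-- The configuration with one momentum moved, or the original one if this is impossible. -/
noncomputable def moveConf {n : ℕ} (T : NConf n) (p q : Mode) : NConf n :=
  if h : p ∈ T.1 ∧ q ∉ T.1 then ⟨insert q (T.1.erase p), by rw [card_hop h.1 h.2]; exact T.2⟩ else T

theorem moveConf_val {n : ℕ} {T : NConf n} {p q : Mode} (hp : p ∈ T.1) (hq : q ∉ T.1) :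
    (moveConf T p q).1 = insert q (T.1.erase p) := by
  rw [moveConf, dif_pos ⟨hp, hq⟩]

theorem moveConf_injOn {n : ℕ} (T : NConf n) {k : Mode} (hk : k ≠ 0) :
    Set.InjOn (fun p => moveConf T p (p - k)) (T.1.filter (fun p => p - k ∉ T.1)) := by
  intro p hp p' hp' h
  simp only [Finset.coe_filter, Set.mem_ofPred_eq] at hp hp'
  by_contra hne
  have h1 : p ∈ (moveConf T p' (p' - k)).1 := by
    rw [moveConf_val hp'.1 hp'.2]
    exact Finset.mem_insert_of_mem (Finset.mem_erase.2 ⟨hne, hp.1⟩)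
  have h2 : p ∉ (moveConf T p (p - k)).1 := by
    rw [moveConf_val hp.1 hp.2]
    simp only [Finset.mem_insert, Finset.mem_erase, not_or]
    exact ⟨fun h => hk (sub_eq_self.1 h.symm), fun h => h.1 rfl⟩
  simp only at h
  rw [h] at h2
  exact h2 h1

/-- The Pauli principle: shifting a momentum onto an occupied one produces a determinant with two
equal rows. -/
theorem exists_rho_mul_slater {n : ℕ} {k : Mode} (hk : k ≠ 0) (T : NConf n) :
    ∃ s : Mode → ℂ, (∀ p, ‖s p‖ ≤ 1) ∧ ∀ x, rho k x * slater n T x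
      = ∑ p ∈ T.1.filter (fun p => p - k ∉ T.1), s p * slater n (moveConf T p (p - k)) x := by
  classical
  have hgood : ∀ j : Fin n, ∃ s : ℂ, ‖s‖ ≤ 1 ∧ ∀ x,
      detWave (Function.update (confEmb T) j (confEmb T j - k)) x
      = if confEmb T j - k ∉ T.1 then s * slater n (moveConf T (confEmb T j) (confEmb T j - k)) x
        else 0 := by
    intro j
    by_cases h : confEmb T j - k ∉ T.1
    · simp only [if_pos h]
      have h' : ∀ i, confEmb T i ≠ confEmb T j - k := fun i hi => h (hi ▸ confEmb_mem T i)
      have hinj : Function.Injective (Function.update (confEmb T) j (confEmb T j - k)) := by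
        intro a b hab
        by_cases ha : a = j
        · subst ha
          by_contra hb
          rw [Function.update_self, Function.update_of_ne (Ne.symm hb)] at hab
          exact h' b hab.symm
        · by_cases hb : b = j
          · subst hb
            rw [Function.update_self, Function.update_of_ne ha] at hab
            exact absurd hab (h' a)
          · rw [Function.update_of_ne ha, Function.update_of_ne hb] at hab
            exact confEmb_injective T hab
      have hmem : ∀ i, Function.update (confEmb T) j (confEmb T j - k) i
          ∈ (moveConf T (confEmb T j) (confEmb T j - k)).1 := by
        intro i
        rw [moveConf_val (confEmb_mem T j) h]
        by_cases hi : i = j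
        · subst hi; simp
        · rw [Function.update_of_ne hi]
          exact Finset.mem_insert_of_mem (Finset.mem_erase.2
            ⟨fun hh => hi (confEmb_injective T hh), confEmb_mem T i⟩)
      obtain ⟨s, hs, hx⟩ := exists_detWave_eq_slater hinj _ hmem
      exact ⟨s, hs.le, hx⟩
    · refine ⟨0, by simp, fun x => ?_⟩
      rw [if_neg h]
      push Not at h
      have h' : confEmb T j - k ∈ Set.range (confEmb T) := by rw [range_confEmb]; exact h
      obtain ⟨i, hi⟩ := h'
      have hij : i ≠ j := by
        rintro rfl
        apply hk
        have := sub_eq_self.1 hi.symm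
        exact this
      refine detWave_eq_zero hij ?_ x
      rw [Function.update_of_ne hij, Function.update_self, hi]
  choose s hs hx using hgood
  have hT : T.1 = Finset.univ.image (confEmb T) := by
    apply Finset.coe_injective
    rw [← range_confEmb]; simp
  refine ⟨fun p => if h : ∃ j, confEmb T j = p then s h.choose else 0, fun p => ?_, fun x => ?_⟩
  · dsimp only
    split_ifs
    · exact hs _
    · simp
  · rw [slater_eq_detWave, rho_mul_detWave, Finset.sum_filter]
    conv_rhs => rw [hT]
    rw [Finset.sum_image (fun a _ b _ h => confEmb_injective T h), ← hT]
    refine Finset.sum_congr rfl fun j _ => ?_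
    have h1 : ∃ i, confEmb T i = confEmb T j := ⟨j, rfl⟩
    rw [hx]
    dsimp only
    rw [dif_pos h1, confEmb_injective T h1.choose_spec]

end FermiGas

namespace FermiGas
open MeasureTheory Complex

/-! ### Matrix elements of the Hamiltonian -/

/-- The matrix elements of multiplication by `ρ_k` in the Slater basis. -/
noncomputable def hopCoeff {n : ℕ} (k : Mode) (U T : NConf n) : ℂ :=
  boxInner n (slater n U) (fun x => rho k x * slater n T x)

/-- Different moved momenta give different configurations, so the expansion is in distinct
orthonormal vectors and its coefficients are the matrix elements. -/
theorem hopCoeff_moveConf {n : ℕ} {k : Mode} (hk : k ≠ 0) (T : NConf n) :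
    ∃ s : Mode → ℂ, (∀ p, ‖s p‖ ≤ 1) ∧
      (∀ x, rho k x * slater n T x
        = ∑ p ∈ T.1.filter (fun p => p - k ∉ T.1), s p * slater n (moveConf T p (p - k)) x) ∧
      (∀ p ∈ T.1.filter (fun p => p - k ∉ T.1), hopCoeff k (moveConf T p (p - k)) T = s p) ∧
      ∀ U : NConf n, (∀ p ∈ T.1.filter (fun p => p - k ∉ T.1), moveConf T p (p - k) ≠ U) →
        hopCoeff k U T = 0 := by
  obtain ⟨s, hs, hx⟩ := exists_rho_mul_slater hk T
  have hform : ∀ U : NConf n, hopCoeff k U T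
      = ∑ p ∈ T.1.filter (fun p => p - k ∉ T.1), s p * (if U = moveConf T p (p - k) then 1 else 0) := by
    intro U
    unfold hopCoeff
    simp only [hx]
    rw [boxInner_sum_right _ _ _ _ (continuous_slater U) (fun p => continuous_slater _)]
    simp only [boxInner_slater]
  refine ⟨s, hs, hx, fun p hp => ?_, fun U hU => ?_⟩
  · rw [hform, Finset.sum_eq_single p]
    · simp
    · intro p' hp' hne
      rw [if_neg, mul_zero]
      intro h
      exact hne (moveConf_injOn T hk hp' hp h.symm)
    · exact fun h => absurd hp h
  · rw [hform]
    refine Finset.sum_eq_zero fun p hp => ?_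
    rw [if_neg (fun h => hU p hp h.symm), mul_zero]

theorem norm_hopCoeff_le {n : ℕ} {k : Mode} (hk : k ≠ 0) (U T : NConf n) : ‖hopCoeff k U T‖ ≤ 1 := by
  obtain ⟨s, hs, -, h1, h2⟩ := hopCoeff_moveConf hk T
  by_cases h : ∃ p ∈ T.1.filter (fun p => p - k ∉ T.1), moveConf T p (p - k) = U
  · obtain ⟨p, hp, rfl⟩ := h
    rw [h1 p hp]; exact hs p
  · push Not at h
    rw [h2 U h]; simp

theorem exists_of_hopCoeff_ne_zero {n : ℕ} {k : Mode} (hk : k ≠ 0) {U T : NConf n}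
    (h : hopCoeff k U T ≠ 0) :
    ∃ p ∈ T.1, p - k ∉ T.1 ∧ U.1 = insert (p - k) (T.1.erase p) := by
  obtain ⟨s, hs, -, h1, h2⟩ := hopCoeff_moveConf hk T
  by_contra! hc
  refine h (h2 U fun p hp hU => ?_)
  rw [Finset.mem_filter] at hp
  exact hc p hp.1 hp.2 (by rw [← hU, moveConf_val hp.1 hp.2])

theorem exists_of_hopCoeff_ne_zero' {n : ℕ} {k : Mode} (hk : k ≠ 0) {U T : NConf n}
    (h : hopCoeff k U T ≠ 0) :
    ∃ q ∈ U.1, q + k ∉ U.1 ∧ T.1 = insert (q + k) (U.1.erase q) := by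
  obtain ⟨p, hp, hpk, hU⟩ := exists_of_hopCoeff_ne_zero hk h
  have hne : p ≠ p - k := fun hh => hk (sub_eq_self.1 hh.symm)
  refine ⟨p - k, ?_, ?_, ?_⟩
  · rw [hU]; exact Finset.mem_insert_self _ _
  · rw [hU, sub_add_cancel]
    simp [hne]
  · rw [hU, sub_add_cancel, Finset.erase_insert (fun hh => hpk (Finset.mem_of_mem_erase hh)),
      Finset.insert_erase hp]

/-- Since `ρ_k` maps a Slater determinant to a finite combination of Slater determinants, the
resolution of the identity is a finite sum here and completeness of the basis is not needed. -/
theorem boxInner_rho_slater {n : ℕ} {k : Mode} (hk : k ≠ 0) (S T : NConf n) :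
    boxInner n (fun x => rho k x * slater n S x) (fun x => rho k x * slater n T x)
      = ∑' U : NConf n, starRingEnd ℂ (hopCoeff k U S) * hopCoeff k U T := by
  classical
  obtain ⟨s, hs, hx, h1, h2⟩ := hopCoeff_moveConf hk S
  have hc : Continuous (fun x => rho k x * slater n T x) :=
    (continuous_rho k).mul (continuous_slater T)
  have e : boxInner n (fun x => rho k x * slater n S x) (fun x => rho k x * slater n T x)
      = ∑ p ∈ S.1.filter (fun p => p - k ∉ S.1),
        starRingEnd ℂ (hopCoeff k (moveConf S p (p - k)) S) * hopCoeff k (moveConf S p (p - k)) T := by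
    simp only [hx]
    rw [boxInner_sum_left _ _ _ _ hc (fun p => continuous_slater _)]
    refine Finset.sum_congr rfl fun p hp => ?_
    rw [h1 p hp]; rfl
  rw [e, tsum_eq_sum (s := (S.1.filter (fun p => p - k ∉ S.1)).image (fun p => moveConf S p (p - k))),
    Finset.sum_image (moveConf_injOn S hk)]
  intro U hU
  rw [h2 U fun p hp h => hU (Finset.mem_image.2 ⟨p, hp, h⟩)]
  simp

/-! ### The Laplacian on Slater determinants. -/

theorem iteratedDeriv_two_sum_exp {ι : Type*} (s : Finset ι) (A : ι → ℂ) (a : ι → ℝ) (y : ℝ) :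
    iteratedDeriv 2 (fun t : ℝ => ∑ σ ∈ s, A σ * Complex.exp (Complex.I * (a σ : ℂ) * ((t : ℂ) - y))) y
      = ∑ σ ∈ s, -((a σ : ℂ) ^ 2 * A σ) := by
  have hd : ∀ (A : ι → ℂ) (t : ℝ), HasDerivAt
      (fun t : ℝ => ∑ σ ∈ s, A σ * Complex.exp (Complex.I * (a σ : ℂ) * ((t : ℂ) - y)))
      (∑ σ ∈ s, (A σ * (Complex.I * (a σ : ℂ))) * Complex.exp (Complex.I * (a σ : ℂ) * ((t : ℂ) - y))) t := by
    intro A t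
    refine HasDerivAt.fun_sum fun σ _ => ?_
    have h1 : HasDerivAt (fun t : ℝ => (t : ℂ) - y) 1 t := (Complex.ofRealCLM.hasDerivAt).sub_const _
    have h2 := ((h1.const_mul (Complex.I * (a σ : ℂ))).cexp).const_mul (A σ)
    have h3 : A σ * (Complex.exp (Complex.I * (a σ : ℂ) * ((t : ℂ) - y)) * (Complex.I * (a σ : ℂ) * 1))
        = (A σ * (Complex.I * (a σ : ℂ))) * Complex.exp (Complex.I * (a σ : ℂ) * ((t : ℂ) - y)) := by
      ring
    rw [← h3]
    exact h2
  have h1 : ∀ A : ι → ℂ, deriv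
      (fun t : ℝ => ∑ σ ∈ s, A σ * Complex.exp (Complex.I * (a σ : ℂ) * ((t : ℂ) - y)))
      = fun t : ℝ => ∑ σ ∈ s, (A σ * (Complex.I * (a σ : ℂ))) *
          Complex.exp (Complex.I * (a σ : ℂ) * ((t : ℂ) - y)) :=
    fun A => funext fun t => (hd A t).deriv
  rw [iteratedDeriv_succ, iteratedDeriv_one, h1, h1]
  refine Finset.sum_congr rfl fun σ _ => ?_
  simp
  linear_combination (A σ * (a σ : ℂ) ^ 2) * Complex.I_sq

/-- Coordinates of a momentum. -/
def coord (p : Mode) (i : Fin 2) : ℝ := ![(cx p : ℝ), (cy p : ℝ)] i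

theorem planeWave_update (p : Mode) (y : Fin 2 → ℝ) (i : Fin 2) (t : ℝ) :
    planeWave p (Function.update y i t)
      = planeWave p y * Complex.exp (Complex.I * (coord p i : ℂ) * ((t : ℂ) - y i)) := by
  rw [planeWave_def', planeWave_def', mul_assoc, ← Complex.exp_add]
  congr 2
  fin_cases i <;> simp [coord] <;> ring

theorem laplace_slater {n : ℕ} (T : NConf n) (x : Fin n → Fin 2 → ℝ) :
    (∑ j : Fin n, -(∑ i : Fin 2, iteratedDeriv 2
      (fun t : ℝ => slater n T (Function.update x j (Function.update (x j) i t))) (x j i)))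
      = ((∑ p ∈ T.1, normSq p : ℝ) : ℂ) * slater n T x := by
  have hT : ∀ σ : Equiv.Perm (Fin n), ∑ j, normSq (confEmb T (σ j)) = ∑ p ∈ T.1, normSq p := by
    intro σ
    rw [Equiv.sum_comp σ (fun j => normSq (confEmb T j))]
    have hT : T.1 = Finset.univ.image (confEmb T) := by
      apply Finset.coe_injective
      rw [← range_confEmb]; simp
    conv_rhs => rw [hT]
    rw [Finset.sum_image (fun a _ b _ h => confEmb_injective T h)]
  rw [slater_eq_detWave]
  set A : Equiv.Perm (Fin n) → ℂ := fun σ =>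
    ((((n.factorial : ℝ) ^ (-(1 / 2) : ℝ) : ℝ) : ℂ) * ((Equiv.Perm.sign σ : ℤ) : ℂ)) *
        ∏ l, planeWave (confEmb T (σ l)) (x l) with hA
  have h1 : ∀ (j : Fin n) (i : Fin 2) (t : ℝ),
      detWave (confEmb T) (Function.update x j (Function.update (x j) i t))
      = ∑ σ : Equiv.Perm (Fin n), A σ *
        Complex.exp (Complex.I * (coord (confEmb T (σ j)) i : ℂ) * ((t : ℂ) - (x j i : ℝ))) := by
    intro j i t
    rw [detWave_eq_sum]
    refine Finset.sum_congr rfl fun σ _ => ?_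
    rw [hA]
    dsimp only
    rw [mul_assoc _ (∏ l, _)]
    congr 1
    rw [← Finset.mul_prod_erase _ _ (Finset.mem_univ j),
      ← Finset.mul_prod_erase _ (fun l => planeWave (confEmb T (σ l)) (x l)) (Finset.mem_univ j),
      Function.update_self, planeWave_update, mul_right_comm]
    congr 2
    refine Finset.prod_congr rfl fun l hl => ?_
    rw [Function.update_of_ne (Finset.ne_of_mem_erase hl)]
  simp only [h1, iteratedDeriv_two_sum_exp]
  have h2 : detWave (confEmb T) x = ∑ σ, A σ := detWave_eq_sum _ _
  rw [h2, Finset.mul_sum]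
  simp only [Fin.sum_univ_two, ← Finset.sum_add_distrib, ← Finset.sum_neg_distrib]
  rw [Finset.sum_comm]
  refine Finset.sum_congr rfl fun σ _ => ?_
  rw [← hT σ]
  push_cast
  rw [Finset.sum_mul]
  refine Finset.sum_congr rfl fun j _ => ?_
  simp only [coord, normSq_def, Matrix.cons_val_zero, Matrix.cons_val_one]
  push_cast
  ring

/-! ### The pair interaction in terms of the density modes. -/

theorem modeDot_sub (k : Mode) (x y : Fin 2 → ℝ) : modeDot k (x - y) = modeDot k x - modeDot k y := by
  simp [modeDot]; ring

theorem normSq_rho {n : ℕ} (k : Mode) (x : Fin n → Fin 2 → ℝ) :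
    Complex.normSq (rho k x) = ∑ i, ∑ j, Real.cos (modeDot k (x i - x j)) := by
  have h : rho k x = ((∑ l, Real.cos (modeDot k (x l)) : ℝ) : ℂ)
      - ((∑ l, Real.sin (modeDot k (x l)) : ℝ) : ℂ) * Complex.I := by
    rw [rho]
    push_cast
    rw [Finset.sum_mul, ← Finset.sum_sub_distrib]
    refine Finset.sum_congr rfl fun l _ => ?_
    have : -(Complex.I * (modeDot k (x l) : ℂ)) = (-(modeDot k (x l) : ℂ)) * Complex.I := by ring
    rw [this, Complex.exp_mul_I, Complex.cos_neg, Complex.sin_neg]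
    ring
  rw [h, sub_eq_add_neg, ← neg_mul, ← Complex.ofReal_neg, Complex.normSq_add_mul_I, neg_sq, sq, sq,
    Finset.sum_mul_sum, Finset.sum_mul_sum, ← Finset.sum_add_distrib]
  refine Finset.sum_congr rfl fun i _ => ?_
  rw [← Finset.sum_add_distrib]
  refine Finset.sum_congr rfl fun j _ => ?_
  rw [modeDot_sub, Real.cos_sub]

theorem sum_ite_lt_eq {n : ℕ} (w : Fin n → Fin n → ℝ) (hw : ∀ i j, w i j = w j i) :
    ∑ i, ∑ j, (if i < j then w i j else 0) = (1 / 2) * (∑ i, ∑ j, w i j - ∑ i, w i i) := by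
  have h1 : ∑ i, ∑ j, w i j = ∑ i, ∑ j, (if i < j then w i j else 0)
      + ∑ i, ∑ j, (if j < i then w i j else 0) + ∑ i, w i i := by
    rw [← Finset.sum_add_distrib, ← Finset.sum_add_distrib]
    refine Finset.sum_congr rfl fun i _ => ?_
    have : w i i = ∑ j, if i = j then w i j else 0 := by simp
    rw [this, ← Finset.sum_add_distrib, ← Finset.sum_add_distrib]
    refine Finset.sum_congr rfl fun j _ => ?_
    rcases lt_trichotomy i j with h | h | h
    · simp [h, h.not_gt, h.ne]
    · simp [h]
    · simp [h, h.not_gt, h.ne']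
  have h2 : ∑ i, ∑ j, (if j < i then w i j else 0) = ∑ i, ∑ j, (if i < j then w i j else 0) := by
    rw [Finset.sum_comm]
    simp only [hw]
  rw [h1, h2]; ring

theorem summable_potential_mul {Vhat : Mode → ℝ} (hV : ∀ k, 0 ≤ Vhat k) (hs : Summable Vhat)
    {w : Mode → ℝ} {D : ℝ} (hw : ∀ k, |w k| ≤ D) : Summable (fun k => Vhat k * w k) := by
  refine Summable.of_norm_bounded (hs.mul_right D) fun k => ?_
  rw [Real.norm_eq_abs, abs_mul, abs_of_nonneg (hV k)]
  exact mul_le_mul_of_nonneg_left (hw k) (hV k)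

/-- Completing the sum over `i < j` to all pairs gives `|ρ_k|²`; the diagonal terms, each equal to
one, are the subtracted `n`. -/
theorem pair_potential_eq {Vhat : Mode → ℝ} (hV : ∀ k, 0 ≤ Vhat k) (hs : Summable Vhat) {n : ℕ}
    (x : Fin n → Fin 2 → ℝ) :
    ∑ i : Fin n, ∑ j : Fin n, (if i < j then potential Vhat (x i - x j) else 0)
      = (1 / (2 * (2 * Real.pi) ^ 2)) * ∑' k, Vhat k * (Complex.normSq (rho k x) - n) := by
  rw [sum_ite_lt_eq]
  · have hsum : ∀ y, Summable (fun k => Vhat k * Real.cos (modeDot k y)) := fun y =>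
      summable_potential_mul hV hs (fun k => Real.abs_cos_le_one _)
    have h0 : ∀ k, Real.cos (modeDot k 0) = 1 := fun k => by simp [modeDot]
    have h1 : ∑' k, Vhat k * (Complex.normSq (rho k x) - n)
        = ∑ i, ∑ j, ∑' k, Vhat k * Real.cos (modeDot k (x i - x j)) - ∑ i : Fin n, ∑' k, Vhat k := by
      have e2 : ∀ i, ∑ j, ∑' k, Vhat k * Real.cos (modeDot k (x i - x j))
          = ∑' k, ∑ j, Vhat k * Real.cos (modeDot k (x i - x j)) := fun i =>
        (Summable.tsum_finsetSum fun j _ => hsum _).symm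
      simp only [e2]
      rw [← Summable.tsum_finsetSum (fun i _ => summable_sum fun j _ => hsum _),
        ← Summable.tsum_finsetSum (fun i _ => hs), ← Summable.tsum_sub]
      · refine tsum_congr fun k => ?_
        rw [normSq_rho, mul_sub, Finset.mul_sum]
        simp [Finset.mul_sum, mul_comm]
      · exact summable_sum fun i _ => summable_sum fun j _ => hsum _
      · exact summable_sum fun i _ => hs
    rw [h1]
    unfold potential
    simp only [sub_self, h0, mul_one, ← Finset.mul_sum]
    ring
  · intro i j
    unfold potential
    congr 2
    ext k
    rw [modeDot_sub, modeDot_sub, ← Real.cos_neg, neg_sub]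

theorem norm_rho_le {n : ℕ} (k : Mode) (x : Fin n → Fin 2 → ℝ) : ‖rho k x‖ ≤ n := by
  unfold rho
  refine (norm_sum_le _ _).trans ?_
  have : ∀ l : Fin n, ‖Complex.exp (-(Complex.I * (modeDot k (x l) : ℂ)))‖ = 1 := by
    intro l
    have : -(Complex.I * (modeDot k (x l) : ℂ)) = ((-(modeDot k (x l)) : ℝ) : ℂ) * Complex.I := by
      push_cast; ring
    rw [this, Complex.norm_exp_ofReal_mul_I]
  simp [this]

theorem abs_normSq_rho_sub_le {n : ℕ} (k : Mode) (x : Fin n → Fin 2 → ℝ) :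
    |Complex.normSq (rho k x) - n| ≤ (n : ℝ) ^ 2 + n := by
  have h := norm_rho_le k x
  have h1 : Complex.normSq (rho k x) ≤ (n : ℝ) ^ 2 := by
    rw [Complex.normSq_eq_norm_sq]; gcongr
  have h2 := Complex.normSq_nonneg (rho k x)
  have h3 : (0 : ℝ) ≤ n := Nat.cast_nonneg n
  rw [abs_le]; constructor <;> nlinarith

theorem hamDiff_slater {Vhat : Mode → ℝ} (hV : ∀ k, 0 ≤ Vhat k) (hs : Summable Vhat) {n : ℕ}
    (T : NConf n) (x : Fin n → Fin 2 → ℝ) :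
    hamDiff (potential Vhat) n (slater n T) x
      = ((hbar n ^ 2 * ∑ p ∈ T.1, normSq p : ℝ) : ℂ) * slater n T x
        + ((1 / (2 * (2 * Real.pi) ^ 2 * n) : ℝ) : ℂ) *
          ∑' k, ((Vhat k * (Complex.normSq (rho k x) - n) : ℝ) : ℂ) * slater n T x := by
  unfold hamDiff
  rw [laplace_slater]
  have h1 : ∑ i : Fin n, ∑ j : Fin n, (if i < j then (potential Vhat (x i - x j) : ℂ) * slater n T x else 0)
      = ((∑ i : Fin n, ∑ j : Fin n, (if i < j then potential Vhat (x i - x j) else 0) : ℝ) : ℂ)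
        * slater n T x := by
    rw [Complex.ofReal_sum, Finset.sum_mul]
    refine Finset.sum_congr rfl fun i _ => ?_
    rw [Complex.ofReal_sum, Finset.sum_mul]
    refine Finset.sum_congr rfl fun j _ => ?_
    split_ifs <;> simp
  rw [h1, pair_potential_eq hV hs, tsum_mul_right, ← Complex.ofReal_tsum]
  have h2 : (1 / (2 * (2 * Real.pi) ^ 2 * n) : ℝ) = (1 / (n : ℝ)) * (1 / (2 * (2 * Real.pi) ^ 2)) := by
    rw [one_div_mul_one_div]; ring
  rw [h2]
  push_cast
  ring

theorem exists_norm_slater_le {n : ℕ} (T : NConf n) : ∃ D : ℝ, ∀ x ∈ torusBox n, ‖slater n T x‖ ≤ D :=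
  isCompact_Icc.exists_bound_of_continuousOn (continuous_slater T).continuousOn

instance : Countable Mode := ofLex.injective.countable

/-- Integration commutes with the sum over `k` because `|ρ_k|² ≤ n²` and Slater determinants are
bounded on the box, so the integrands are dominated by multiples of the summable `V̂`. -/
theorem hamMatrix_eq {Vhat : Mode → ℝ} (hV : ∀ k, 0 ≤ Vhat k) (hs : Summable Vhat) {n : ℕ}
    (S T : NConf n) :
    Summable (fun k => (Vhat k : ℂ) * (boxInner n (fun x => rho k x * slater n S x)
          (fun x => rho k x * slater n T x) - n * (if S = T then 1 else 0))) ∧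
    hamMatrix (potential Vhat) n S T
      = ((hbar n ^ 2 * ∑ p ∈ T.1, normSq p : ℝ) : ℂ) * (if S = T then 1 else 0)
        + ((1 / (2 * (2 * Real.pi) ^ 2 * n) : ℝ) : ℂ) *
          ∑' k, (Vhat k : ℂ) * (boxInner n (fun x => rho k x * slater n S x)
            (fun x => rho k x * slater n T x) - n * (if S = T then 1 else 0)) := by
  obtain ⟨DS, hDS⟩ := exists_norm_slater_le S
  obtain ⟨DT, hDT⟩ := exists_norm_slater_le T
  have hcS := continuous_slater S
  have hcT := continuous_slater T
  set F : Mode → (Fin n → Fin 2 → ℝ) → ℂ := fun k x => starRingEnd ℂ (slater n S x) *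
    (((Vhat k * (Complex.normSq (rho k x) - n) : ℝ) : ℂ) * slater n T x) with hF
  have hcF : ∀ k, Continuous (F k) := fun k => by
    have := continuous_rho (n := n) k
    have h2 : Continuous (fun x : Fin n → Fin 2 → ℝ => Complex.normSq (rho k x)) :=
      Complex.continuous_normSq.comp this
    simp only [hF]
    fun_prop
  have hbound : ∀ k, ∀ x ∈ torusBox n, ‖F k x‖ ≤ Vhat k * (((n : ℝ) ^ 2 + n) * (DS * DT)) := by
    intro k x hx
    simp only [hF]
    rw [norm_mul, norm_mul, RCLike.norm_conj, Complex.norm_real, Real.norm_eq_abs, abs_mul,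
      abs_of_nonneg (hV k)]
    have h1 := abs_normSq_rho_sub_le k x
    have h2 := hDS x hx
    have h3 := hDT x hx
    have h4 : 0 ≤ DS := (norm_nonneg _).trans h2
    have h5 := hV k
    calc _ ≤ DS * (Vhat k * ((n : ℝ) ^ 2 + n) * DT) := by gcongr
      _ = _ := by ring
  have hmeas : MeasurableSet (torusBox n) := measurableSet_Icc
  have hfin : volume (torusBox n) < ⊤ := isCompact_Icc.measure_lt_top
  have hsumF : Summable (fun k => ∫ x in torusBox n, ‖F k x‖) := by
    refine Summable.of_nonneg_of_le (fun k => integral_nonneg fun x => norm_nonneg _) (fun k => ?_)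
      ((hs.mul_right (((n : ℝ) ^ 2 + n) * (DS * DT))).mul_right (volume (torusBox n)).toReal)
    have := norm_setIntegral_le_of_norm_le_const (f := fun x => ‖F k x‖) hfin
      (fun x hx => by rw [norm_norm]; exact hbound k x hx)
    exact (le_abs_self _).trans this
  have hF1 : ∀ k, ∫ x in torusBox n, F k x = (Vhat k : ℂ) * (boxInner n (fun x => rho k x * slater n S x)
          (fun x => rho k x * slater n T x) - n * (if S = T then 1 else 0)) := by
    intro k
    rw [← boxInner_slater, mul_sub, mul_left_comm]
    unfold boxInner
    rw [← integral_const_mul, ← integral_const_mul, ← integral_const_mul, ← integral_sub]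
    · congr 1
      ext x
      simp only [hF, Complex.ofReal_mul, Complex.ofReal_sub, Complex.normSq_eq_conj_mul_self, map_mul]
      push_cast
      ring
    · refine integrable_box ?_
      have := continuous_rho (n := n) k
      fun_prop
    · refine integrable_box ?_
      fun_prop
  have hint := hasSum_integral_of_summable_integral_norm (μ := volume.restrict (torusBox n))
    (fun k => integrable_box (hcF k)) hsumF
  simp only [hF1] at hint
  refine ⟨hint.summable, ?_⟩
  rw [hint.tsum_eq, ← boxInner_slater S T]
  unfold hamMatrix boxInner
  rw [← integral_const_mul, ← integral_const_mul, ← integral_add]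
  · change ∫ x in torusBox n, _ = ∫ x in torusBox n, _
    refine setIntegral_congr_fun hmeas fun x _ => ?_
    simp only [hamDiff_slater hV hs, mul_add, hF, tsum_mul_left]
    ring
  · refine integrable_box ?_
    fun_prop
  · refine Integrable.const_mul ?_ _
    have hct : Continuous (fun x : Fin n → Fin 2 → ℝ =>
        ∑' k, ((Vhat k * (Complex.normSq (rho k x) - n) : ℝ) : ℂ)) := by
      refine continuous_tsum (fun k => ?_) (hs.mul_right ((n : ℝ) ^ 2 + n)) (fun k x => ?_)
      · have h2 : Continuous (fun x : Fin n → Fin 2 → ℝ => Complex.normSq (rho k x)) :=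
          Complex.continuous_normSq.comp (continuous_rho k)
        fun_prop
      · rw [Complex.norm_real, Real.norm_eq_abs, abs_mul, abs_of_nonneg (hV k)]
        exact mul_le_mul_of_nonneg_left (abs_normSq_rho_sub_le k x) (hV k)
    have e : (fun x => ∑' k, F k x) = fun x => starRingEnd ℂ (slater n S x) *
        ((∑' k, ((Vhat k * (Complex.normSq (rho k x) - n) : ℝ) : ℂ)) * slater n T x) := by
      ext x
      simp only [hF, tsum_mul_left, tsum_mul_right]
    rw [e]
    refine integrable_box ?_
    fun_prop

end FermiGas

namespace FermiGas
open MeasureTheory Complex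
open scoped ENNReal

/-! ### Energy identities -/

/-- Non-zero momenta. -/
abbrev NZMode := {k : Mode // k ≠ 0}

theorem boxInner_rho_zero {n : ℕ} (S T : NConf n) :
    boxInner n (fun x => rho 0 x * slater n S x) (fun x => rho 0 x * slater n T x)
      = (n : ℂ) ^ 2 * (if S = T then 1 else 0) := by
  have h : ∀ x : Fin n → Fin 2 → ℝ, rho 0 x = n := fun x => by
    simp [rho, modeDot]
  rw [← boxInner_slater]
  unfold boxInner
  rw [← integral_const_mul]
  congr 1
  ext x
  simp only [h, map_mul, Complex.conj_natCast]
  ring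

/-- The coupling constant `(2 (2π)² n)⁻¹`. -/
noncomputable def coupling (n : ℕ) : ℝ := 1 / (2 * (2 * Real.pi) ^ 2 * n)

theorem coupling_nonneg (n : ℕ) : 0 ≤ coupling n := by unfold coupling; positivity

/-- The zero mode and the self-interaction are constants in a sector and go into `κ`, which cancels
in energy differences. What remains of the interaction is the manifestly non-negative `∑ V̂(k) ρ_k*
ρ_k`. -/
theorem exists_hamMatrix_eq {Vhat : Mode → ℝ} (hV : ∀ k, 0 ≤ Vhat k) (hs : Summable Vhat) (n : ℕ) :
    ∃ κ : ℝ, ∀ S T : NConf n, 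
      hamMatrix (potential Vhat) n S T
        = ((hbar n ^ 2 * ∑ p ∈ T.1, normSq p + κ : ℝ) : ℂ) * (if S = T then 1 else 0)
          + (coupling n : ℂ) * ∑' k : NZMode, (Vhat k : ℂ) *
            ∑' U : NConf n, starRingEnd ℂ (hopCoeff k.1 U S) * hopCoeff k.1 U T := by
  -- The first term comes from `ρ_0 = n`, the second from the diagonal of the pair sum.
  refine ⟨coupling n * (Vhat 0 * n ^ 2 - n * ∑' k, Vhat k), fun S T => ?_⟩
  obtain ⟨h1, h2⟩ := hamMatrix_eq hV hs S T
  set G : Mode → ℂ := fun k => boxInner n (fun x => rho k x * slater n S x)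
          (fun x => rho k x * slater n T x) with hG
  set δ : ℂ := if S = T then 1 else 0 with hδ
  have hVc : Summable (fun k => (Vhat k : ℂ) * (n * δ)) :=
    (Complex.ofRealCLM.summable hs).mul_right _
  have h3 : Summable (fun k => (Vhat k : ℂ) * G k) := by
    refine (h1.add hVc).congr fun k => ?_
    simp only [hG]; ring
  have h4 : ∑' k, (Vhat k : ℂ) * (G k - n * δ) = ∑' k, (Vhat k : ℂ) * G k
      - ((∑' k, Vhat k : ℝ) : ℂ) * (n * δ) := by
    rw [Complex.ofReal_tsum, ← tsum_mul_right, ← h3.tsum_sub hVc]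
    refine tsum_congr fun k => by ring
  have h5 : ∑' k, (Vhat k : ℂ) * G k = (Vhat 0 : ℂ) * G 0
      + ∑' k : NZMode, (Vhat k : ℂ) * G k.1 := by
    rw [← h3.tsum_subtype_add_tsum_subtype_compl {0}, tsum_singleton (0 : Mode) (fun k => (Vhat k : ℂ) * G k)]
    congr 1
  have h6 : ∀ k : NZMode, G k.1
      = ∑' U : NConf n, starRingEnd ℂ (hopCoeff k.1 U S) * hopCoeff k.1 U T :=
    fun k => boxInner_rho_slater k.2 S T
  rw [h2, h4, h5]
  simp only [h6]
  have h7 : G 0 = (n : ℂ) ^ 2 * δ := boxInner_rho_zero S T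
  rw [h7]
  unfold coupling
  push_cast
  ring

theorem tsum_enorm_hopCoeff_mul_le {n : ℕ} {k : Mode} (hk : k ≠ 0) (U : NConf n)
    (a : Finset Mode → ℝ≥0∞) :
    ∑' T : NConf n, ‖hopCoeff k U T‖ₑ * a T.1
      ≤ ∑ q ∈ U.1.filter (fun q => q + k ∉ U.1), a (insert (q + k) (U.1.erase q)) := by
  classical
  calc _ ≤ ∑' T : NConf n, ∑ q ∈ U.1.filter (fun q => q + k ∉ U.1),
        (if T.1 = insert (q + k) (U.1.erase q) then a (insert (q + k) (U.1.erase q)) else 0) := by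
        refine ENNReal.tsum_le_tsum fun T => ?_
        by_cases h : hopCoeff k U T = 0
        · simp [h]
        · obtain ⟨q, hq, hqk, hT⟩ := exists_of_hopCoeff_ne_zero' hk h
          have h1 : ‖hopCoeff k U T‖ₑ ≤ 1 := by
            rw [← ofReal_norm, ← ENNReal.ofReal_one]
            exact ENNReal.ofReal_le_ofReal (norm_hopCoeff_le hk U T)
          calc _ ≤ 1 * a T.1 := by gcongr
            _ = (if T.1 = insert (q + k) (U.1.erase q) then a (insert (q + k) (U.1.erase q)) else 0) := by
                rw [if_pos hT, one_mul, ← hT]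
            _ ≤ _ := Finset.single_le_sum (f := fun q => if T.1 = insert (q + k) (U.1.erase q)
                then a (insert (q + k) (U.1.erase q)) else 0) (fun _ _ => zero_le)
                (Finset.mem_filter.2 ⟨hq, hqk⟩)
    _ = ∑ q ∈ U.1.filter (fun q => q + k ∉ U.1), ∑' T : NConf n,
        (if T.1 = insert (q + k) (U.1.erase q) then a (insert (q + k) (U.1.erase q)) else 0) :=
        Summable.tsum_finsetSum fun _ _ => ENNReal.summable
    _ ≤ _ := by
        refine Finset.sum_le_sum fun q _ => ?_
        refine (ENNReal.tsum_comp_le_tsum_of_injective (f := fun T : NConf n => T.1)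
          Subtype.val_injective (fun S => if S = insert (q + k) (U.1.erase q)
            then a (insert (q + k) (U.1.erase q)) else 0)).trans ?_
        rw [tsum_ite_eq]

theorem tsum_enorm_hopCoeff_le_hop {n : ℕ} {k : Mode} (hk : k ≠ 0) (U : NConf n)
    (a : Finset Mode → ℝ≥0∞) :
    ∑' T : NConf n, ‖hopCoeff k U T‖ₑ * a T.1 ≤ hop (fun _ => True) k a U.1 := by
  refine (tsum_enorm_hopCoeff_mul_le hk U a).trans (le_of_eq ?_)
  unfold hop
  simp

/-- Even with absolute values inside, `ρ_k` has norm at most `n` on the sector. This uniform bound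
gives the absolute convergence behind the energy identity. -/
theorem tsum_sq_enorm_hopCoeff_le {n : ℕ} {k : Mode} (hk : k ≠ 0) (a : Finset Mode → ℝ≥0∞)
    (ha : ∀ S : Finset Mode, S.card ≠ n → a S = 0) :
    ∑' U : NConf n, (∑' T : NConf n, ‖hopCoeff k U T‖ₑ * a T.1) ^ 2
      ≤ (n : ℝ≥0∞) ^ 2 * ∑' S, a S ^ 2 := by
  calc _ ≤ ∑' U : NConf n, hop (fun _ => True) k a U.1 ^ 2 :=
        ENNReal.tsum_le_tsum fun U => by gcongr; exact tsum_enorm_hopCoeff_le_hop hk U a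
    _ ≤ ∑' S, hop (fun _ => True) k a S ^ 2 :=
        ENNReal.tsum_comp_le_tsum_of_injective Subtype.val_injective _
    _ ≤ ∑' T : Finset Mode, (T.card : ℝ≥0∞) ^ 2 * a T ^ 2 := tsum_hop_sq_le_card _ _ _
    _ = _ := by
        rw [← ENNReal.tsum_mul_left]
        refine tsum_congr fun T => ?_
        by_cases h : T.card = n
        · rw [h]
        · simp [ha T h]

/-- `ρ_k` acting on amplitudes. -/
noncomputable def rhoAct {n : ℕ} (k : Mode) (φ : Finset Mode → ℂ) (U : NConf n) : ℂ :=
  ∑' T : NConf n, hopCoeff k U T * φ T.1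

theorem summable_of_tsum_enorm_ne_top {ι : Type*} {f : ι → ℂ} (h : ∑' i, ‖f i‖ₑ ≠ ∞) : Summable f := by
  refine Summable.of_norm ?_
  have := ENNReal.summable_toReal h
  simpa using this

/-- Multiply the row `S` of the eigenvalue equation by the conjugate of `f S * ψ S` and sum over
`S`. The interaction is an absolutely convergent series over `S`, `T`, `k`, `U`, so it may be
regrouped into inner products of `ρ_k f ψ` with `ρ_k ψ`. It is applied with `f = 1` and with `f` the
number of excitations. -/
theorem energy_identity {Vhat : Mode → ℝ} (hV : ∀ k, 0 ≤ Vhat k) (hs : Summable Vhat) (n : ℕ)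
    (κ : ℝ) (hκ : ∀ S T : NConf n, hamMatrix (potential Vhat) n S T
        = ((hbar n ^ 2 * ∑ p ∈ T.1, normSq p + κ : ℝ) : ℂ) * (if S = T then 1 else 0)
          + (coupling n : ℂ) * ∑' k : NZMode, (Vhat k : ℂ) *
            ∑' U : NConf n, starRingEnd ℂ (hopCoeff k.1 U S) * hopCoeff k.1 U T)
    (ψ : Finset Mode → ℂ) (hψn : ∀ S : Finset Mode, S.card ≠ n → ψ S = 0)
    (hψ : ∑' S, ‖ψ S‖ₑ ^ 2 ≠ ∞) (E : ℝ)
    (hE : ∀ S : NConf n, HasSum (fun T : NConf n => hamMatrix (potential Vhat) n S T * ψ T.1) (E * ψ S.1))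
    (f : Finset Mode → ℝ) (D : ℝ) (hf : ∀ S : Finset Mode, S.card = n → |f S| ≤ D) :
    Summable (fun S : NConf n => ((f S.1 * (hbar n ^ 2 * ∑ p ∈ S.1, normSq p + κ) * ‖ψ S.1‖ ^ 2 : ℝ) : ℂ)) ∧
    Summable (fun k : NZMode => (Vhat k : ℂ) *
      ∑' U : NConf n, starRingEnd ℂ (rhoAct k.1 (fun S => f S * ψ S) U) * rhoAct k.1 ψ U) ∧
    ∑' S : NConf n, ((f S.1 * E * ‖ψ S.1‖ ^ 2 : ℝ) : ℂ)
      = ∑' S : NConf n, ((f S.1 * (hbar n ^ 2 * ∑ p ∈ S.1, normSq p + κ) * ‖ψ S.1‖ ^ 2 : ℝ) : ℂ)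
        + coupling n * ∑' k : NZMode, (Vhat k : ℂ) *
      ∑' U : NConf n, starRingEnd ℂ (rhoAct k.1 (fun S => f S * ψ S) U) * rhoAct k.1 ψ U := by
  set F : (NConf n × NConf n) × (NZMode × NConf n) → ℂ := fun z =>
    (Vhat z.2.1 : ℂ) * (starRingEnd ℂ (hopCoeff z.2.1.1 z.2.2 z.1.1 * (f z.1.1.1 * ψ z.1.1.1))
      * (hopCoeff z.2.1.1 z.2.2 z.1.2 * ψ z.1.2.1)) with hF
  have he : ∀ r : ℝ, ‖(r : ℂ)‖ₑ = ENNReal.ofReal |r| := fun r => by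
    rw [← ofReal_norm, Complex.norm_real, Real.norm_eq_abs]
  have hec : ∀ z : ℂ, ‖starRingEnd ℂ z‖ₑ = ‖z‖ₑ := fun z => by
    rw [← ofReal_norm, RCLike.norm_conj, ofReal_norm]
  have hfD : ∀ S : NConf n, ‖(f S.1 : ℂ)‖ₑ ≤ ENNReal.ofReal D := fun S => by
    rw [he]; exact ENNReal.ofReal_le_ofReal (hf S.1 S.2)
  have hQ : ∀ k : NZMode, ∑' U : NConf n, (∑' T : NConf n, ‖hopCoeff k.1 U T‖ₑ * ‖ψ T.1‖ₑ) ^ 2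
      ≤ (n : ℝ≥0∞) ^ 2 * ∑' S, ‖ψ S‖ₑ ^ 2 := fun k =>
    tsum_sq_enorm_hopCoeff_le k.2 (fun S => ‖ψ S‖ₑ) (fun S hS => by simp [hψn S hS])
  have hQ0 : (n : ℝ≥0∞) ^ 2 * ∑' S, ‖ψ S‖ₑ ^ 2 ≠ ∞ :=
    ENNReal.mul_ne_top (ENNReal.pow_ne_top (ENNReal.natCast_ne_top n)) hψ
  have hFsum : Summable F := by
    refine summable_of_tsum_enorm_ne_top ?_
    have h1 : ∑' z, ‖F z‖ₑ ≤ ∑' k : NZMode, ENNReal.ofReal (Vhat k) *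
        (ENNReal.ofReal D * ((n : ℝ≥0∞) ^ 2 * ∑' S, ‖ψ S‖ₑ ^ 2)) := by
      rw [ENNReal.tsum_prod', ENNReal.tsum_comm, ENNReal.tsum_prod']
      refine ENNReal.tsum_le_tsum fun k => ?_
      calc _ ≤ ∑' U : NConf n, ∑' z : NConf n × NConf n, ENNReal.ofReal (Vhat k) * ENNReal.ofReal D *
            ((‖hopCoeff k.1 U z.1‖ₑ * ‖ψ z.1.1‖ₑ) * (‖hopCoeff k.1 U z.2‖ₑ * ‖ψ z.2.1‖ₑ)) := by
            refine ENNReal.tsum_le_tsum fun U => ENNReal.tsum_le_tsum fun z => ?_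
            simp only [hF]
            rw [enorm_mul, enorm_mul, hec, enorm_mul, enorm_mul, enorm_mul, he, abs_of_nonneg (hV _)]
            calc _ ≤ ENNReal.ofReal (Vhat k) * (‖hopCoeff k.1 U z.1‖ₑ * (ENNReal.ofReal D * ‖ψ z.1.1‖ₑ)
                  * (‖hopCoeff k.1 U z.2‖ₑ * ‖ψ z.2.1‖ₑ)) := by gcongr; exact hfD _
              _ = _ := by ring
        _ = ENNReal.ofReal (Vhat k) * ENNReal.ofReal D *
            ∑' U : NConf n, (∑' T : NConf n, ‖hopCoeff k.1 U T‖ₑ * ‖ψ T.1‖ₑ) ^ 2 := by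
            simp only [ENNReal.tsum_mul_left, ENNReal.tsum_prod', ENNReal.tsum_mul_right, sq]
        _ ≤ _ := by
            rw [mul_assoc]
            gcongr
            exact hQ k
    refine ne_top_of_le_ne_top ?_ h1
    rw [ENNReal.tsum_mul_right]
    refine ENNReal.mul_ne_top ?_ (ENNReal.mul_ne_top ENNReal.ofReal_ne_top hQ0)
    have hsK : Summable (fun k : NZMode => Vhat k) := hs.subtype _
    rw [← ENNReal.ofReal_tsum_of_nonneg (fun k : NZMode => hV k) hsK]
    exact ENNReal.ofReal_ne_top
  have hψsq : Summable (fun S : NConf n => ‖ψ S.1‖ ^ 2) := by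
    have h1 : ∑' S : NConf n, ‖ψ S.1‖ₑ ^ 2 ≠ ∞ := ne_top_of_le_ne_top hψ
      (ENNReal.tsum_comp_le_tsum_of_injective Subtype.val_injective (fun S => ‖ψ S‖ₑ ^ 2))
    have := ENNReal.summable_toReal h1
    simpa using this
  have hrho : ∀ (k : NZMode) (U : NConf n) (g : Finset Mode → ℝ) (D : ℝ),
      (∀ S : Finset Mode, S.card = n → |g S| ≤ D) →
      Summable (fun T : NConf n => ‖hopCoeff k.1 U T * (g T.1 * ψ T.1)‖) := by
    intro k U g D hg
    have h0 : ∑' T : NConf n, ‖hopCoeff k.1 U T‖ₑ * ‖ψ T.1‖ₑ ≠ ∞ := by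
      intro htop
      have h1 := (ENNReal.le_tsum U).trans (hQ k)
      rw [htop] at h1
      exact hQ0 (top_le_iff.1 (by simpa using h1))
    have h2 : ∑' T : NConf n, ‖hopCoeff k.1 U T * (g T.1 * ψ T.1)‖ₑ ≠ ∞ := by
      refine ne_top_of_le_ne_top (ENNReal.mul_ne_top (ENNReal.ofReal_ne_top (r := D)) h0) ?_
      rw [← ENNReal.tsum_mul_left]
      refine ENNReal.tsum_le_tsum fun T => ?_
      rw [enorm_mul, enorm_mul, he, mul_left_comm]
      gcongr
      exact hg T.1 T.2
    have := ENNReal.summable_toReal h2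
    simpa using this
  -- the interaction part, summed in the two orders
  have hinner : ∀ (k : NZMode) (U : NConf n), ∑' z : NConf n × NConf n, F (z, (k, U))
      = (Vhat k : ℂ) * (starRingEnd ℂ (rhoAct k.1 (fun S => f S * ψ S) U) * rhoAct k.1 ψ U) := by
    intro k U
    simp only [hF]
    rw [tsum_mul_left]
    congr 1
    unfold rhoAct
    rw [conj_tsum]
    have e1 := hrho k U f D hf
    have e2 := hrho k U (fun _ => 1) 1 (fun _ _ => by simp)
    simp only [Complex.ofReal_one, one_mul] at e2
    rw [tsum_mul_tsum_of_summable_norm (f := fun T : NConf n =>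
      starRingEnd ℂ (hopCoeff k.1 U T * (f T.1 * ψ T.1))) (by simpa using e1) e2]
  have hswap : ∑' y : NZMode × NConf n, ∑' z : NConf n × NConf n, F (z, y)
      = ∑' z : NConf n × NConf n, ∑' y : NZMode × NConf n, F (z, y) :=
    Summable.tsum_comm (f := fun z y => F (z, y)) hFsum
  have hFsw : Summable (fun y : NZMode × NConf n => ∑' z : NConf n × NConf n, F (z, y)) :=
    (hFsum.prod_symm).prod
  have hk1 : ∑' y : NZMode × NConf n, ∑' z : NConf n × NConf n, F (z, y)
      = ∑' k : NZMode, (Vhat k : ℂ) *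
      ∑' U : NConf n, starRingEnd ℂ (rhoAct k.1 (fun S => f S * ψ S) U) * rhoAct k.1 ψ U := by
    rw [hFsw.tsum_prod]
    simp only [hinner, tsum_mul_left]
  have hk2 : Summable (fun k : NZMode => (Vhat k : ℂ) *
      ∑' U : NConf n, starRingEnd ℂ (rhoAct k.1 (fun S => f S * ψ S) U) * rhoAct k.1 ψ U) := by
    have := hFsw.prod
    simpa only [hinner, tsum_mul_left] using this
  have hST : Summable (fun z : NConf n × NConf n => ∑' y : NZMode × NConf n, F (z, y)) := hFsum.prod
  -- the value of the interaction part at fixed `S`, `T`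
  have hSTval : ∀ S T : NConf n, ∑' y : NZMode × NConf n, F ((S, T), y)
      = (starRingEnd ℂ (f S.1 * ψ S.1) * ψ T.1) * ∑' k : NZMode, (Vhat k : ℂ) *
            ∑' U : NConf n, starRingEnd ℂ (hopCoeff k.1 U S) * hopCoeff k.1 U T := by
    intro S T
    rw [(hFsum.prod_factor (S, T)).tsum_prod, ← tsum_mul_left]
    refine tsum_congr fun k => ?_
    rw [mul_left_comm, ← tsum_mul_left, ← tsum_mul_left]
    refine tsum_congr fun U => ?_
    simp only [hF, map_mul]
    ring
  have hrow : ∀ S : NConf n, ((f S.1 * E * ‖ψ S.1‖ ^ 2 : ℝ) : ℂ)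
      = ((f S.1 * (hbar n ^ 2 * ∑ p ∈ S.1, normSq p + κ) * ‖ψ S.1‖ ^ 2 : ℝ) : ℂ)
        + coupling n * ∑' T : NConf n, ∑' y : NZMode × NConf n, F ((S, T), y) := by
    intro S
    have h1 := (hE S).mul_left (starRingEnd ℂ (f S.1 * ψ S.1))
    have h2 : HasSum (fun T : NConf n => if T = S then starRingEnd ℂ (f S.1 * ψ S.1) *
        (((hbar n ^ 2 * ∑ p ∈ S.1, normSq p + κ : ℝ) : ℂ) * ψ S.1) else 0)
        (starRingEnd ℂ (f S.1 * ψ S.1) *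
        (((hbar n ^ 2 * ∑ p ∈ S.1, normSq p + κ : ℝ) : ℂ) * ψ S.1)) := hasSum_ite_eq S _
    have h3 : HasSum (fun T : NConf n => (coupling n : ℂ) * ∑' y : NZMode × NConf n, F ((S, T), y))
        (coupling n * ∑' T : NConf n, ∑' y : NZMode × NConf n, F ((S, T), y)) :=
      ((hST.prod_factor S).hasSum).mul_left _
    have h4 := h2.add h3
    have h5 : ∀ T : NConf n, starRingEnd ℂ (f S.1 * ψ S.1) * (hamMatrix (potential Vhat) n S T * ψ T.1)
        = (if T = S then starRingEnd ℂ (f S.1 * ψ S.1) *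
        (((hbar n ^ 2 * ∑ p ∈ S.1, normSq p + κ : ℝ) : ℂ) * ψ S.1) else 0)
          + (coupling n : ℂ) * ∑' y : NZMode × NConf n, F ((S, T), y) := by
      intro T
      rw [hκ, hSTval]
      by_cases h : S = T
      · subst h
        simp only [if_true]
        ring
      · rw [if_neg h, if_neg (Ne.symm h)]
        ring
    have h6 := h1.unique (by simpa only [h5] using h4)
    have hn : ((‖ψ S.1‖ : ℝ) : ℂ) ^ 2 = starRingEnd ℂ (ψ S.1) * ψ S.1 := (Complex.conj_mul' _).symm
    rw [map_mul, Complex.conj_ofReal] at h6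
    push_cast
    rw [hn]
    push_cast at h6
    linear_combination h6
  have hSsum : Summable (fun S : NConf n => ∑' T : NConf n, ∑' y : NZMode × NConf n, F ((S, T), y)) :=
    hST.prod
  have hEsum : Summable (fun S : NConf n => ((f S.1 * E * ‖ψ S.1‖ ^ 2 : ℝ) : ℂ)) := by
    refine Complex.ofRealCLM.summable ?_
    refine Summable.of_norm_bounded (hψsq.mul_left (D * |E|)) fun S => ?_
    change |f S.1 * E * ‖ψ S.1‖ ^ 2| ≤ _
    rw [abs_mul, abs_mul, abs_of_nonneg (sq_nonneg ‖ψ S.1‖)]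
    gcongr
    exact hf S.1 S.2
  -- Finite kinetic energy is not assumed: by the row equation it is the difference of two summable
  -- families.
  have hhsum : Summable (fun S : NConf n =>
      ((f S.1 * (hbar n ^ 2 * ∑ p ∈ S.1, normSq p + κ) * ‖ψ S.1‖ ^ 2 : ℝ) : ℂ)) := by
    refine (hEsum.sub (hSsum.mul_left (coupling n : ℂ))).congr fun S => ?_
    rw [hrow S]; ring
  refine ⟨hhsum, hk2, ?_⟩
  rw [tsum_congr hrow, hhsum.tsum_add (hSsum.mul_left _), tsum_mul_left, ← hk1, hswap, hST.tsum_prod]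

end FermiGas

namespace FermiGas
open scoped ENNReal

/-! ### Weighted hopping bounds -/

theorem card_symmDiff_pair_le (X : Finset Mode) (x y : Mode) :
    (symmDiff X {x, y}).card ≤ X.card + 2 := by
  have h : symmDiff X {x, y} ⊆ X ∪ {x, y} := symmDiff_le_sup
  calc _ ≤ _ := Finset.card_le_card h
    _ ≤ _ := Finset.card_union_le _ _
    _ ≤ _ := Nat.add_le_add_left Finset.card_le_two _

theorem symmDiff_hop {U B : Finset Mode} {q p : Mode} (hq : q ∈ U) (hp : p ∉ U) :
    symmDiff (insert p (U.erase q)) B = symmDiff (symmDiff U B) {q, p} := by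
  rw [← symmDiff_pair_eq hq hp, symmDiff_right_comm]

theorem card_symmDiff_hop_le {U B : Finset Mode} {q p : Mode} (hq : q ∈ U) (hp : p ∉ U) :
    (symmDiff (insert p (U.erase q)) B).card ≤ (symmDiff U B).card + 2 := by
  rw [symmDiff_hop hq hp]; exact card_symmDiff_pair_le _ _ _

theorem card_symmDiff_le_hop {U B : Finset Mode} {q p : Mode} (hq : q ∈ U) (hp : p ∉ U) :
    (symmDiff U B).card ≤ (symmDiff (insert p (U.erase q)) B).card + 2 := by
  rw [symmDiff_hop hq hp]
  have := card_symmDiff_pair_le (symmDiff (symmDiff U B) {q, p}) q p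
  rwa [symmDiff_symmDiff_cancel_right] at this

theorem card_symmDiff_hop_eq {U B : Finset Mode} {q p : Mode} (hq : q ∈ U) (hp : p ∉ U)
    (h : q ∈ B ↔ p ∈ B) : (symmDiff (insert p (U.erase q)) B).card = (symmDiff U B).card := by
  rw [symmDiff_hop hq hp]
  by_cases hb : q ∈ B
  · have h1 : q ∉ symmDiff U B := by simp [Finset.mem_symmDiff, hq, hb]
    have h2 : p ∈ symmDiff U B := by simp [Finset.mem_symmDiff, hp, h.1 hb]
    rw [Finset.pair_comm, symmDiff_pair_eq h2 h1, card_hop h2 h1]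
  · have h1 : q ∈ symmDiff U B := by simp [Finset.mem_symmDiff, hq, hb]
    have h2 : p ∉ symmDiff U B := by simp [Finset.mem_symmDiff, hp, mt h.2 hb]
    rw [symmDiff_pair_eq h1 h2, card_hop h1 h2]

theorem card_le_card_symmDiff {T B F : Finset Mode} (h : ∀ p ∈ F, p ∈ T ∧ p ∉ B) :
    (F.card : ℝ≥0∞) ≤ ((symmDiff T B).card : ℝ≥0∞) := by
  exact_mod_cast Finset.card_le_card fun p hp => Finset.mem_symmDiff.2 (Or.inl (h p hp))

theorem card_le_exitCount {B F : Finset Mode} {k : Mode} (h : ∀ q ∈ F, q ∈ B ∧ q + k ∉ B) :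
    (F.card : ℝ≥0∞) ≤ (exitCount B k : ℝ≥0∞) := by
  unfold exitCount
  exact_mod_cast Finset.card_le_card fun q hq => Finset.mem_filter.2 (h q hq)

/-- For hops out of the ball, the starting points are counted by the Fermi surface, and the arrivals
by the excitations outside the ball. The product `|k| √N · n` is much smaller than the crude `N²`.
-/
theorem tsum_hop_exit_sq_le (B : Finset Mode) (k : Mode) (a : Finset Mode → ℝ≥0∞) :
    ∑' S, hop (fun q => q ∈ B ∧ q + k ∉ B) k a S ^ 2
      ≤ ∑' T : Finset Mode, (exitCount B k : ℝ≥0∞) * ((symmDiff T B).card : ℝ≥0∞) * a T ^ 2 := by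
  refine tsum_hop_sq_le _ k a (fun _ => exitCount B k) (fun _ => exitCount B k)
    (fun T => (symmDiff T B).card) (fun S F h => ?_) (fun _ _ _ _ _ => le_rfl) (fun T F h => ?_)
  · exact card_le_exitCount fun q hq => (h q hq).2.2
  · exact card_le_card_symmDiff fun p hp => ⟨(h p hp).1, by simpa using (h p hp).2.2.2⟩

/-- The two counts exchange roles for hops into the ball. The `+ 2` appears because the excitation
count is read off at the other end of the hop. -/
theorem tsum_hop_enter_sq_le (B : Finset Mode) (k : Mode) (a : Finset Mode → ℝ≥0∞) :
    ∑' S, hop (fun q => q ∉ B ∧ q + k ∈ B) k a S ^ 2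
      ≤ ∑' T : Finset Mode,
        (((symmDiff T B).card : ℝ≥0∞) + 2) * (exitCount B (-k) : ℝ≥0∞) * a T ^ 2 := by
  refine tsum_hop_sq_le _ k a (fun S => (symmDiff S B).card) (fun S => (symmDiff S B).card + 2)
    (fun _ => exitCount B (-k)) (fun S F h => ?_) (fun T p hp hpk _ => ?_) (fun T F h => ?_)
  · exact card_le_card_symmDiff fun q hq => ⟨(h q hq).1, (h q hq).2.2.1⟩
  · exact_mod_cast card_symmDiff_hop_le hp hpk
  · refine card_le_exitCount fun p hp => ⟨by simpa using (h p hp).2.2.2, ?_⟩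
    rw [← sub_eq_add_neg]
    exact (h p hp).2.2.1

/-- The commutator of `ρ_k` with the number of excitations, acting on amplitudes. -/
noncomputable def rhoComm {n : ℕ} (B : Finset Mode) (k : Mode) (φ : Finset Mode → ℂ) (U : NConf n) : ℂ :=
  ∑' T : NConf n, hopCoeff k U T *
    ((((symmDiff U.1 B).card : ℝ) - ((symmDiff T.1 B).card : ℝ) : ℝ) * φ T.1)

/-- A hop staying inside or outside the ball leaves the number of excitations unchanged, so its
weight vanishes; a hop across the Fermi surface changes that number by at most two. -/
theorem enorm_rhoComm_le {n : ℕ} (B : Finset Mode) {k : Mode} (hk : k ≠ 0) (φ : Finset Mode → ℂ)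
    (U : NConf n) :
    ∑' T : NConf n, ‖hopCoeff k U T *
      ((((symmDiff U.1 B).card : ℝ) - ((symmDiff T.1 B).card : ℝ) : ℝ) * φ T.1)‖ₑ
      ≤ 2 * (hop (fun q => q ∈ B ∧ q + k ∉ B) k (fun T => ‖φ T‖ₑ) U.1
        + hop (fun q => q ∉ B ∧ q + k ∈ B) k (fun T => ‖φ T‖ₑ) U.1) := by
  classical
  set w : Finset Mode → ℝ≥0∞ := fun T =>
    ‖((((symmDiff U.1 B).card : ℝ) - ((symmDiff T B).card : ℝ) : ℝ) : ℂ)‖ₑ with hw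
  have h1 := tsum_enorm_hopCoeff_mul_le hk U (fun T => w T * ‖φ T‖ₑ)
  simp only [enorm_mul]
  refine h1.trans ?_
  unfold hop
  rw [Finset.sum_filter, Finset.sum_filter, Finset.sum_filter, ← Finset.sum_add_distrib, Finset.mul_sum]
  refine Finset.sum_le_sum fun q hq => ?_
  by_cases hqk : q + k ∉ U.1
  · have hw2 : w (insert (q + k) (U.1.erase q)) ≤ 2 := by
      simp only [hw]
      rw [← ofReal_norm, Complex.norm_real, Real.norm_eq_abs]
      have e1 : ((symmDiff (insert (q + k) (U.1.erase q)) B).card : ℝ) ≤ (symmDiff U.1 B).card + 2 := by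
        exact_mod_cast card_symmDiff_hop_le (B := B) hq hqk
      have e2 : ((symmDiff U.1 B).card : ℝ) ≤ (symmDiff (insert (q + k) (U.1.erase q)) B).card + 2 := by
        exact_mod_cast card_symmDiff_le_hop (B := B) hq hqk
      calc _ ≤ ENNReal.ofReal 2 := ENNReal.ofReal_le_ofReal (by rw [abs_le]; constructor <;> linarith)
        _ = 2 := by simp
    rw [if_pos hqk]
    by_cases hB : q ∈ B <;> by_cases hkB : q + k ∈ B
    · have : w (insert (q + k) (U.1.erase q)) = 0 := by
        simp only [hw]
        rw [card_symmDiff_hop_eq hq hqk (by tauto)]; simp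
      rw [this]; simp
    · rw [if_pos ⟨hqk, hB, hkB⟩, if_neg (by tauto), add_zero]
      gcongr
    · rw [if_neg (by tauto), if_pos ⟨hqk, hB, hkB⟩, zero_add]
      gcongr
    · have : w (insert (q + k) (U.1.erase q)) = 0 := by
        simp only [hw]
        rw [card_symmDiff_hop_eq hq hqk (by tauto)]; simp
      rw [this]; simp
  · rw [if_neg hqk]; exact zero_le

theorem tsum_rhoComm_sq_le {n : ℕ} (B : Finset Mode) {k : Mode} (hk : k ≠ 0) (φ : Finset Mode → ℂ)
    (x : ℝ≥0∞) (hx1 : (exitCount B k : ℝ≥0∞) ≤ x) (hx2 : (exitCount B (-k) : ℝ≥0∞) ≤ x) :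
    ∑' U : NConf n, (∑' T : NConf n, ‖hopCoeff k U T *
      ((((symmDiff U.1 B).card : ℝ) - ((symmDiff T.1 B).card : ℝ) : ℝ) * φ T.1)‖ₑ) ^ 2
      ≤ 16 * x * ∑' T : Finset Mode, (((symmDiff T B).card : ℝ≥0∞) + 1) * ‖φ T‖ₑ ^ 2 := by
  set a : Finset Mode → ℝ≥0∞ := fun T => ‖φ T‖ₑ
  calc _ ≤ ∑' U : NConf n, 8 * (hop (fun q => q ∈ B ∧ q + k ∉ B) k a U.1 ^ 2
        + hop (fun q => q ∉ B ∧ q + k ∈ B) k a U.1 ^ 2) := by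
        refine ENNReal.tsum_le_tsum fun U => ?_
        calc _ ≤ (2 * (hop (fun q => q ∈ B ∧ q + k ∉ B) k a U.1
              + hop (fun q => q ∉ B ∧ q + k ∈ B) k a U.1)) ^ 2 := by
              gcongr; exact enorm_rhoComm_le B hk φ U
          _ = 4 * (hop (fun q => q ∈ B ∧ q + k ∉ B) k a U.1
              + hop (fun q => q ∉ B ∧ q + k ∈ B) k a U.1) ^ 2 := by rw [mul_pow]; norm_num
          _ ≤ 4 * (2 * (hop (fun q => q ∈ B ∧ q + k ∉ B) k a U.1 ^ 2
              + hop (fun q => q ∉ B ∧ q + k ∈ B) k a U.1 ^ 2)) := by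
              gcongr; exact ENNReal_add_sq_le _ _
          _ = _ := by ring
    _ ≤ ∑' U : Finset Mode, 8 * (hop (fun q => q ∈ B ∧ q + k ∉ B) k a U ^ 2
        + hop (fun q => q ∉ B ∧ q + k ∈ B) k a U ^ 2) :=
        ENNReal.tsum_comp_le_tsum_of_injective Subtype.val_injective (fun U : Finset Mode =>
          8 * (hop (fun q => q ∈ B ∧ q + k ∉ B) k a U ^ 2 + hop (fun q => q ∉ B ∧ q + k ∈ B) k a U ^ 2))
    _ ≤ 8 * (∑' T : Finset Mode, (exitCount B k : ℝ≥0∞) * ((symmDiff T B).card : ℝ≥0∞) * a T ^ 2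
        + ∑' T : Finset Mode, (((symmDiff T B).card : ℝ≥0∞) + 2) * (exitCount B (-k) : ℝ≥0∞) * a T ^ 2) := by
        rw [ENNReal.tsum_mul_left, ENNReal.tsum_add]
        exact mul_le_mul' le_rfl (add_le_add (tsum_hop_exit_sq_le B k a) (tsum_hop_enter_sq_le B k a))
    _ ≤ _ := by
        rw [← ENNReal.tsum_add, ← ENNReal.tsum_mul_left, ← ENNReal.tsum_mul_left]
        refine ENNReal.tsum_le_tsum fun T => ?_
        calc _ ≤ 8 * (x * ((symmDiff T B).card : ℝ≥0∞) * a T ^ 2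
              + (((symmDiff T B).card : ℝ≥0∞) + 2) * x * a T ^ 2) := by gcongr
          _ = _ := by ring

/-- The number of momenta of `S` in `H`. -/
noncomputable def countIn (H : Set Mode) (S : Finset Mode) : ℕ := by
  classical exact (S.filter (· ∈ H)).card

theorem countIn_hop_le (H : Set Mode) (T : Finset Mode) (p q : Mode) :
    countIn H (insert q (T.erase p)) ≤ countIn H T + 1 := by
  classical
  unfold countIn
  have : (insert q (T.erase p)).filter (· ∈ H) ⊆ insert q (T.filter (· ∈ H)) := by
    intro x hx
    simp only [Finset.mem_filter, Finset.mem_insert, Finset.mem_erase] at hx ⊢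
    tauto
  exact (Finset.card_le_card this).trans (Finset.card_insert_le _ _)

theorem card_le_countIn {H : Set Mode} {S F : Finset Mode} (h : ∀ p ∈ F, p ∈ S ∧ p ∈ H) :
    (F.card : ℝ≥0∞) ≤ (countIn H S : ℝ≥0∞) := by
  classical
  unfold countIn
  refine Nat.cast_le.2 (Finset.card_le_card fun p hp => ?_)
  simp only [Finset.mem_filter]
  exact h p hp

/-- Split the hops by whether one of the two ends lies in `H`. If so, one of the two Schur counts is
the number of momenta in `H`; if not, both counts are at most `M`. -/
theorem tsum_hop_sq_le_of_high (P : Mode → Prop) {k : Mode} (H : Set Mode) (M : ℝ≥0∞)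
    (hM : ∀ F : Finset Mode, (∀ q ∈ F, q ∉ H ∧ q + k ∉ H) → (F.card : ℝ≥0∞) ≤ M)
    (a : Finset Mode → ℝ≥0∞) :
    ∑' S, hop P k a S ^ 2 ≤ 3 * ∑' T : Finset Mode,
      (2 * ((T.card : ℝ≥0∞) * countIn H T) + T.card + M ^ 2) * a T ^ 2 := by
  have h1 : ∑' S, hop (fun q => q + k ∈ H) k a S ^ 2
      ≤ ∑' T : Finset Mode, (T.card : ℝ≥0∞) * countIn H T * a T ^ 2 := by
    refine tsum_hop_sq_le _ k a (fun S => S.card) (fun S => S.card) (fun S => countIn H S)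
      (fun S F h => by exact_mod_cast Finset.card_le_card fun q hq => (h q hq).1)
      (fun T p hp hk _ => ?_) (fun S F h => ?_)
    · rw [card_hop hp hk]
    · exact card_le_countIn fun p hp => ⟨(h p hp).1, by simpa using (h p hp).2.2⟩
  have h2 : ∑' S, hop (fun q => q ∈ H) k a S ^ 2
      ≤ ∑' T : Finset Mode, ((countIn H T : ℝ≥0∞) + 1) * T.card * a T ^ 2 := by
    refine tsum_hop_sq_le _ k a (fun S => countIn H S) (fun S => countIn H S + 1) (fun S => S.card)
      (fun S F h => ?_) (fun T p hp hk _ => ?_)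
      (fun S F h => by exact_mod_cast Finset.card_le_card fun q hq => (h q hq).1)
    · exact card_le_countIn fun p hp => ⟨(h p hp).1, (h p hp).2.2⟩
    · exact_mod_cast countIn_hop_le H T p _
  have h3 : ∑' S, hop (fun q => q ∉ H ∧ q + k ∉ H) k a S ^ 2
      ≤ ∑' T : Finset Mode, M * M * a T ^ 2 := by
    refine tsum_hop_sq_le _ k a (fun _ => M) (fun _ => M) (fun _ => M)
      (fun S F h => hM _ fun q hq => (h q hq).2.2) (fun _ _ _ _ _ => le_rfl) (fun S F h => ?_)
    -- Arrivals are counted by their starting points, which satisfy the hypothesis on `M`.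
    have := hM (F.image (fun p => p - k)) ?_
    · rwa [Finset.card_image_of_injective _ (sub_left_injective)] at this
    · intro q hq
      obtain ⟨p, hp, rfl⟩ := Finset.mem_image.1 hq
      exact (h p hp).2.2
  have hsq : ∀ x y z : ℝ≥0∞, (x + y + z) ^ 2 ≤ 3 * (x ^ 2 + y ^ 2 + z ^ 2) := by
    intro x y z
    have := ENNReal_sq_sum_le (Finset.univ : Finset (Fin 3)) ![x, y, z]
    simpa [Fin.sum_univ_three] using this
  calc _ ≤ ∑' S, 3 * (hop (fun q => q + k ∈ H) k a S ^ 2 + hop (fun q => q ∈ H) k a S ^ 2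
        + hop (fun q => q ∉ H ∧ q + k ∉ H) k a S ^ 2) := by
        refine ENNReal.tsum_le_tsum fun S => le_trans ?_ (hsq _ _ _)
        gcongr
        exact hop_le_add_add P _ _ _ k a S (fun q _ => by tauto)
    _ ≤ 3 * (∑' T : Finset Mode, (T.card : ℝ≥0∞) * countIn H T * a T ^ 2
        + ∑' T : Finset Mode, ((countIn H T : ℝ≥0∞) + 1) * T.card * a T ^ 2
        + ∑' T : Finset Mode, M * M * a T ^ 2) := by
        rw [ENNReal.tsum_mul_left, ENNReal.tsum_add, ENNReal.tsum_add]
        exact mul_le_mul' le_rfl (add_le_add (add_le_add h1 h2) h3)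
    _ = _ := by
        rw [← ENNReal.tsum_add, ← ENNReal.tsum_add]
        congr 1
        refine tsum_congr fun T => ?_
        ring

theorem tsum_dAbs_sq_le_of_high (B : Finset Mode) {k : Mode} (H : Set Mode) (M : ℝ≥0∞)
    (hM : ∀ F : Finset Mode, (∀ q ∈ F, q ∉ H ∧ q + k ∉ H) → (F.card : ℝ≥0∞) ≤ M)
    (hM' : ∀ F : Finset Mode, (∀ q ∈ F, q ∉ H ∧ q + -k ∉ H) → (F.card : ℝ≥0∞) ≤ M)
    (a : Finset Mode → ℝ≥0∞) :
    ∑' S, dAbs B k a S ^ 2 ≤ 12 * ∑' T : Finset Mode,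
      (2 * ((T.card : ℝ≥0∞) * countIn H T) + T.card + M ^ 2) * a T ^ 2 := by
  calc _ ≤ ∑' S, 2 * (hop (fun q => q ∉ B ∧ q + k ∉ B) k a S ^ 2
        + hop (fun q => q ∈ B ∧ q + -k ∈ B) (-k) a S ^ 2) :=
        ENNReal.tsum_le_tsum fun S => ENNReal_add_sq_le _ _
    _ ≤ 2 * (3 * ∑' T : Finset Mode, (2 * ((T.card : ℝ≥0∞) * countIn H T) + T.card + M ^ 2) * a T ^ 2
        + 3 * ∑' T : Finset Mode, (2 * ((T.card : ℝ≥0∞) * countIn H T) + T.card + M ^ 2) * a T ^ 2) := by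
        rw [ENNReal.tsum_mul_left, ENNReal.tsum_add]
        exact mul_le_mul' le_rfl (add_le_add (tsum_hop_sq_le_of_high _ H M hM a)
          (tsum_hop_sq_le_of_high _ H M hM' a))
    _ = _ := by ring

/-! ### Further facts on `d(k)` -/

theorem cre_ann_self (h : Mode) (ξ : Finset Mode → ℂ) (S : Finset Mode) :
    cre h (ann h ξ) S = if h ∈ S then ξ S else 0 := by
  unfold cre ann
  by_cases hS : h ∈ S
  · have hj : jwSign h S * jwSign h (S.erase h) = 1 := by
      have : jwSign h (S.erase h) = jwSign h S := by
        unfold jwSign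
        congr 2
        ext x
        simp only [Finset.mem_filter, Finset.mem_erase]
        constructor
        · exact fun hx => ⟨hx.1.2, hx.2⟩
        · exact fun hx => ⟨⟨hx.2.ne, hx.1⟩, hx.2⟩
      rw [this]
      simp [jwSign, ← mul_pow]
    simp only [hS, if_true, Finset.notMem_erase, if_false, Finset.insert_erase hS]
    rw [← mul_assoc, hj, one_mul]
  · simp [hS]

/-- `d(0)` is the number of particles outside the ball minus the number of holes, and these agree
when `Rξ` has `|B|` particles. The case `k = 0` needs this separate argument because it involves no
hop. -/
theorem dOp_zero (B : Finset Mode) (ξ : Finset Mode → ℂ)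
    (hξ : ∀ S, (symmDiff S B).card ≠ B.card → ξ S = 0) (S : Finset Mode) : dOp B 0 ξ S = 0 := by
  classical
  unfold dOp
  have h1 : ∑ᶠ (p : Mode) (_ : p ∉ B ∧ p - 0 ∉ B), cre (p - 0) (ann p ξ) S
      = ((S \ B).card : ℂ) * ξ S := by
    have := finsum_cre_ann (k := 0) 0 (fun p => p ∉ B ∧ p - 0 ∉ B) (fun p => p ∉ B)
      (fun q => by simp) ξ S
    simp only [add_zero] at this
    simp only [sub_zero] at this ⊢
    rw [this]
    have e : S \ B = S.filter (fun p => p ∉ B) := by ext x; simp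
    rw [e, Finset.sum_congr rfl (fun q hq => by
      rw [cre_ann_self, if_pos (Finset.mem_filter.1 hq).1]), Finset.sum_const, nsmul_eq_mul]
  have h2 : ∑ h ∈ B.filter (fun h => h + 0 ∈ B), cre (h + 0) (ann h ξ) S
      = ((B ∩ S).card : ℂ) * ξ S := by
    simp only [add_zero, cre_ann_self]
    have e : (B.filter (fun h => h ∈ B)).filter (fun h => h ∈ S) = B ∩ S := by
      ext x; simp
    rw [← Finset.sum_filter, e, Finset.sum_const, nsmul_eq_mul]
  rw [h1, h2]
  by_cases h : (symmDiff S B).card = B.card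
  · have e1 : (symmDiff S B).card = (S \ B).card + (B \ S).card := by
      rw [symmDiff_def, Finset.sup_eq_union, Finset.card_union_of_disjoint disjoint_sdiff_sdiff]
    have e2 := Finset.card_sdiff_add_card_inter B S
    have e3 : (S \ B).card = (B ∩ S).card := by omega
    rw [e3, sub_self]
  · rw [hξ S h]; simp

theorem hop_le_of_bound (P : Mode → Prop) (k : Mode) (a : Finset Mode → ℝ≥0∞) (m : ℕ) (b : ℝ≥0∞)
    (ha : ∀ T : Finset Mode, T.card = m → a T ≤ b) (S : Finset Mode) (hS : S.card = m) :
    hop P k a S ≤ m * b := by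
  classical
  unfold hop
  calc _ ≤ ∑ q ∈ S.filter (fun q => q + k ∉ S ∧ P q), b := by
        refine Finset.sum_le_sum fun q hq => ?_
        rw [Finset.mem_filter] at hq
        exact ha _ (by rw [card_hop hq.1 hq.2.1, hS])
    _ = ((S.filter (fun q => q + k ∉ S ∧ P q)).card : ℝ≥0∞) * b := by rw [Finset.sum_const, nsmul_eq_mul]
    _ ≤ _ := by
        gcongr
        rw [← hS]
        exact Finset.card_filter_le _ _

/-- A pointwise bound uniform in `k`, which makes the series defining `𝓔₁ξ` converge absolutely at
every `S`. -/
theorem enorm_dStar_dOp_le (B : Finset Mode) {k : Mode} (hk : k ≠ 0) (ξ : Finset Mode → ℂ)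
    (hξ : ∀ S, ‖ξ S‖ₑ ≤ 1) (S : Finset Mode) :
    ‖dStar B k (dOp B k ξ) S‖ₑ ≤ 4 * (S.card : ℝ≥0∞) ^ 2 := by
  have h1 : ∀ T : Finset Mode, T.card = S.card → dAbs B k (fun T => ‖ξ T‖ₑ) T ≤ 2 * S.card := by
    intro T hT
    unfold dAbs
    calc _ ≤ (S.card : ℝ≥0∞) * 1 + (S.card : ℝ≥0∞) * 1 :=
          add_le_add (hop_le_of_bound _ _ _ _ _ (fun T _ => hξ T) T hT)
            (hop_le_of_bound _ _ _ _ _ (fun T _ => hξ T) T hT)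
      _ = _ := by ring
  calc _ ≤ dStarAbs B k (dAbs B k (fun T => ‖ξ T‖ₑ)) S :=
        (enorm_dStar_le B hk _ S).trans (dStarAbs_mono (fun T => enorm_dOp_le B hk ξ T) S)
    _ ≤ (S.card : ℝ≥0∞) * (2 * S.card) + (S.card : ℝ≥0∞) * (2 * S.card) := by
        unfold dStarAbs
        exact add_le_add (hop_le_of_bound _ _ _ _ _ h1 S rfl) (hop_le_of_bound _ _ _ _ _ h1 S rfl)
    _ = _ := by ring

theorem summable_dStar_dOp {Vhat : Mode → ℝ} (hV : ∀ k, 0 ≤ Vhat k) (hs : Summable Vhat)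
    (B : Finset Mode) (ξ : Finset Mode → ℂ) (hξ : ∀ S, ‖ξ S‖ₑ ≤ 1) (S : Finset Mode) :
    Summable (fun k : NZMode => (Vhat k : ℂ) * dStar B k (dOp B k ξ) S) := by
  have hsK : Summable (fun k : NZMode => Vhat k) := hs.subtype _
  refine Summable.of_norm_bounded (hsK.mul_right (4 * (S.card : ℝ) ^ 2)) fun k => ?_
  rw [norm_mul, Complex.norm_real, Real.norm_of_nonneg (hV _)]
  refine mul_le_mul_of_nonneg_left ?_ (hV _)
  have := enorm_dStar_dOp_le B k.2 ξ hξ S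
  rw [← ofReal_norm] at this
  have h2 : (4 * (S.card : ℝ≥0∞) ^ 2) = ENNReal.ofReal (4 * (S.card : ℝ) ^ 2) := by
    rw [ENNReal.ofReal_mul (by norm_num), ENNReal.ofReal_pow (by positivity), ENNReal.ofReal_natCast]
    norm_num
  rw [h2] at this
  exact (ENNReal.ofReal_le_ofReal_iff (by positivity)).1 this

end FermiGas

namespace FermiGas
open Complex
open scoped ENNReal

/-! ### Excitation energies and the energy of the Fermi sea -/

theorem hbar_eq (n : ℕ) : hbar n = 1 / Real.sqrt n := by
  unfold hbar
  rw [Real.rpow_neg (Nat.cast_nonneg n), Real.sqrt_eq_rpow, one_div, one_div]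

theorem hbar_nonneg (n : ℕ) : 0 ≤ hbar n := by rw [hbar_eq]; positivity

theorem hbar_sq (n : ℕ) : hbar n ^ 2 = 1 / n := by
  rw [hbar_eq, div_pow, one_pow, Real.sq_sqrt (Nat.cast_nonneg n)]

theorem coupling_mul_sqrt_le (n : ℕ) : coupling n * Real.sqrt n ≤ hbar n := by
  rcases Nat.eq_zero_or_pos n with rfl | hn
  · simp [coupling, hbar_nonneg]
  · have hn' : (0 : ℝ) < n := by exact_mod_cast hn
    have hs : 0 < Real.sqrt n := Real.sqrt_pos.2 hn'
    have hpi : (1 : ℝ) ≤ 2 * (2 * Real.pi) ^ 2 := by nlinarith [Real.pi_gt_three]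
    have h1 : coupling n ≤ 1 / n := by
      unfold coupling
      exact one_div_le_one_div_of_le hn' (by nlinarith)
    calc coupling n * Real.sqrt n ≤ 1 / n * Real.sqrt n := by gcongr
      _ = hbar n := by
          rw [hbar_eq]
          nth_rewrite 1 [← Real.sq_sqrt hn'.le]
          field_simp

/-- The kinetic energy of a set of excitations, relative to the Fermi energy. -/
noncomputable def excEnergy (kF c : ℝ) (X : Finset Mode) : ℝ := c * ∑ p ∈ X, |normSq p - kF ^ 2|

theorem excEnergy_nonneg {kF c : ℝ} (hc : 0 ≤ c) (X : Finset Mode) : 0 ≤ excEnergy kF c X :=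
  mul_nonneg hc (Finset.sum_nonneg fun _ _ => abs_nonneg _)

/-- Particles and holes are equally many, so `kF²` may be subtracted from every energy; particles
then contribute non-negative terms and holes non-positive ones, which enter with a minus sign. -/
theorem sum_normSq_eq {kF : ℝ} (h0 : 0 < kF) {S : Finset Mode} (hS : S.card = (fermiBall kF).card) :
    ∑ p ∈ S, normSq p = ∑ p ∈ fermiBall kF, normSq p
      + ∑ p ∈ symmDiff S (fermiBall kF), |normSq p - kF ^ 2| := by
  set B := fermiBall kF with hB
  have hu : symmDiff S B = (S \ B) ∪ (B \ S) := rfl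
  have h1 : ∑ p ∈ S \ B, |normSq p - kF ^ 2| = ∑ p ∈ S \ B, (normSq p - kF ^ 2) := by
    refine Finset.sum_congr rfl fun p hp => abs_of_nonneg ?_
    have := mt (mem_fermiBall_iff_normSq h0).2 (Finset.mem_sdiff.1 hp).2
    linarith [not_lt.1 this]
  have h2 : ∑ p ∈ B \ S, |normSq p - kF ^ 2| = -∑ p ∈ B \ S, (normSq p - kF ^ 2) := by
    rw [← Finset.sum_neg_distrib]
    refine Finset.sum_congr rfl fun p hp => abs_of_nonpos ?_
    have := (mem_fermiBall_iff_normSq h0).1 (Finset.mem_sdiff.1 hp).1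
    linarith
  rw [hu, Finset.sum_union disjoint_sdiff_sdiff, h1, h2, Finset.sum_sub_distrib,
    Finset.sum_sub_distrib, Finset.sum_const, Finset.sum_const, nsmul_eq_mul, nsmul_eq_mul]
  have e1 := Finset.sum_inter_add_sum_sdiff S B normSq
  have e2 := Finset.sum_inter_add_sum_sdiff B S normSq
  have e3 := Finset.card_sdiff_add_card_inter S B
  have e4 := Finset.card_sdiff_add_card_inter B S
  rw [Finset.inter_comm] at e2 e4
  have e5 : ((S \ B).card : ℝ) = (B \ S).card := by
    have : (S \ B).card = (B \ S).card := by omega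
    exact_mod_cast this
  rw [e5]
  linarith

theorem norm_tsum_conj_hopCoeff_mul_le {n : ℕ} {k : Mode} (hk : k ≠ 0) (T : NConf n) :
    ‖∑' U : NConf n, starRingEnd ℂ (hopCoeff k U T) * hopCoeff k U T‖ ≤ exitCount T.1 (-k) := by
  classical
  set I : Finset (NConf n) :=
    (T.1.filter (fun p => p - k ∉ T.1)).image (fun p => moveConf T p (p - k)) with hI
  obtain ⟨s, -, -, -, h⟩ := hopCoeff_moveConf hk T
  rw [tsum_eq_sum (s := I) fun U hU => by
    rw [h U fun p hp hpU => hU (Finset.mem_image.2 ⟨p, hp, hpU⟩), mul_zero]]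
  calc _ ≤ ∑ U ∈ I, (1 : ℝ) := by
        refine norm_sum_le_of_le _ fun U _ => ?_
        rw [norm_mul, RCLike.norm_conj]
        exact mul_le_one₀ (norm_hopCoeff_le hk U T) (norm_nonneg _) (norm_hopCoeff_le hk U T)
    _ = I.card := by simp
    _ ≤ _ := by
        have h1 : I.card ≤ (T.1.filter (fun p => p - k ∉ T.1)).card := Finset.card_image_le
        unfold exitCount
        simp only [← sub_eq_add_neg]
        exact_mod_cast h1

/-- In the Fermi sea `ρ_k* ρ_k` has expectation at most the number of exits, which is `O(|k| √N)`.
The coupling is `O(1/N)`, so the interaction beyond `κ` is only `O(ħ)`. -/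
theorem fermiSeaEnergy_le {Vhat : Mode → ℝ} (hV : ∀ k, 0 ≤ Vhat k)
    (hs : Summable (fun k => modeNorm k * Vhat k)) {kF : ℝ} (h0 : 0 < kF) (κ : ℝ)
    (hκ : ∀ S T : NConf (particleNumber kF), hamMatrix (potential Vhat) (particleNumber kF) S T
        = ((hbar (particleNumber kF) ^ 2 * ∑ p ∈ T.1, normSq p + κ : ℝ) : ℂ) * (if S = T then 1 else 0)
          + (coupling (particleNumber kF) : ℂ) * ∑' k : NZMode, (Vhat k : ℂ) *
            ∑' U : NConf (particleNumber kF),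
              starRingEnd ℂ (hopCoeff k.1 U S) * hopCoeff k.1 U T) :
    fermiSeaEnergy (potential Vhat) kF
      ≤ hbar (particleNumber kF) ^ 2 * ∑ p ∈ fermiBall kF, normSq p + κ
        + 10 * (∑' k, modeNorm k * Vhat k) * hbar (particleNumber kF) := by
  set n := particleNumber kF with hn
  set T : NConf n := ⟨fermiBall kF, rfl⟩ with hT
  set W := ∑' k, modeNorm k * Vhat k with hW
  have hsK : Summable (fun k : NZMode => modeNorm k.1 * Vhat k) := hs.subtype _
  have hWK : ∑' k : NZMode, modeNorm k.1 * Vhat k ≤ W :=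
    Summable.tsum_subtype_le (fun k => modeNorm k * Vhat k) {k | k ≠ 0}
      (fun k => mul_nonneg (modeNorm_nonneg k) (hV k)) hs
  have h1 : ‖∑' k : NZMode, (Vhat k : ℂ) *
            ∑' U : NConf n, starRingEnd ℂ (hopCoeff k.1 U T) * hopCoeff k.1 U T‖
      ≤ (∑' k : NZMode, modeNorm k.1 * Vhat k) * (10 * Real.sqrt n) := by
    refine tsum_of_norm_bounded (hsK.hasSum.mul_right (10 * Real.sqrt n)) fun k => ?_
    rw [norm_mul, Complex.norm_real, Real.norm_of_nonneg (hV _)]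
    have h2 := exitCount_le h0 (-k.1)
    rw [modeNorm_neg] at h2
    have h3 := (norm_tsum_conj_hopCoeff_mul_le k.2 T).trans h2
    calc _ ≤ Vhat k * (10 * modeNorm k.1 * Real.sqrt n) := mul_le_mul_of_nonneg_left h3 (hV _)
      _ = _ := by ring
  unfold fermiSeaEnergy
  change (hamMatrix (potential Vhat) n T T).re ≤ _
  rw [hκ T T, if_pos rfl, mul_one, Complex.add_re, Complex.ofReal_re, Complex.re_ofReal_mul]
  have h4 := (Complex.re_le_norm _).trans h1
  have h5 : coupling n * (∑' k : NZMode, (Vhat k : ℂ) *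
            ∑' U : NConf n, starRingEnd ℂ (hopCoeff k.1 U T) * hopCoeff k.1 U T).re
      ≤ 10 * W * hbar n := by
    calc _ ≤ coupling n * (W * (10 * Real.sqrt n)) :=
          mul_le_mul_of_nonneg_left (h4.trans (by gcongr)) (coupling_nonneg n)
      _ = 10 * W * (coupling n * Real.sqrt n) := by ring
      _ ≤ _ := by
          have : 0 ≤ W := tsum_nonneg fun k => mul_nonneg (modeNorm_nonneg k) (hV k)
          gcongr
          exact coupling_mul_sqrt_le n
  linarith

/-! ### Sums over a sector -/

theorem tsum_nconf_eq_tsum {n : ℕ} (g : Finset Mode → ℝ≥0∞) (hg : ∀ S : Finset Mode, S.card ≠ n → g S = 0) :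
    ∑' S : NConf n, g S.1 = ∑' S, g S := by
  refine tsum_subtype_eq_of_support_subset (s := {S : Finset Mode | S.card = n}) fun S hS => ?_
  by_contra h
  exact hS (hg S h)

theorem tsum_ofReal_mul_enorm_sq {n : ℕ} {ψ : Finset Mode → ℂ}
    (hψ : ∀ S : Finset Mode, S.card ≠ n → ψ S = 0) {g : Finset Mode → ℝ} (hg : ∀ S, 0 ≤ g S)
    (hs : Summable (fun S : NConf n => g S.1 * ‖ψ S.1‖ ^ 2)) :
    ∑' S, ENNReal.ofReal (g S) * ‖ψ S‖ₑ ^ 2 = ENNReal.ofReal (∑' S : NConf n, g S.1 * ‖ψ S.1‖ ^ 2) := by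
  rw [ENNReal.ofReal_tsum_of_nonneg (fun S => mul_nonneg (hg _) (sq_nonneg _)) hs,
    ← tsum_nconf_eq_tsum (n := n) _ (fun S hS => by simp [hψ S hS])]
  refine tsum_congr fun S => ?_
  rw [ENNReal.ofReal_mul (hg _), ENNReal.ofReal_pow (norm_nonneg _), ofReal_norm]

theorem summable_norm_sq_of_tsum_enorm {ι : Type*} {f : ι → ℂ} (h : ∑' i, ‖f i‖ₑ ^ 2 ≠ ∞) :
    Summable (fun i => ‖f i‖ ^ 2) := by
  have := ENNReal.summable_toReal h
  simpa using this

theorem tsum_norm_sq_le_of_tsum_enorm {ι : Type*} {f : ι → ℂ} {r : ℝ} (hr : 0 ≤ r)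
    (h : ∑' i, ‖f i‖ₑ ^ 2 ≤ ENNReal.ofReal r) : ∑' i, ‖f i‖ ^ 2 ≤ r := by
  have hs := summable_norm_sq_of_tsum_enorm (ne_top_of_le_ne_top ENNReal.ofReal_ne_top h)
  rw [← ENNReal.ofReal_le_ofReal_iff hr, ENNReal.ofReal_tsum_of_nonneg (fun _ => sq_nonneg _) hs]
  refine le_trans (le_of_eq (tsum_congr fun i => ?_)) h
  rw [ENNReal.ofReal_pow (norm_nonneg _), ofReal_norm]

theorem rhoAct_mul_eq {n : ℕ} (B : Finset Mode) {k : Mode} (φ : Finset Mode → ℂ) (U : NConf n)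
    (h1 : Summable (fun T : NConf n => hopCoeff k U T * φ T.1))
    (h2 : Summable (fun T : NConf n => hopCoeff k U T *
      ((((symmDiff U.1 B).card : ℝ) - ((symmDiff T.1 B).card : ℝ) : ℝ) * φ T.1))) :
    rhoAct k (fun S => (((symmDiff S B).card : ℝ) : ℂ) * φ S) U
      = (((symmDiff U.1 B).card : ℝ) : ℂ) * rhoAct k φ U - rhoComm B k φ U := by
  unfold rhoAct rhoComm
  rw [← tsum_mul_left, ← (h1.mul_left _).tsum_sub h2]
  refine tsum_congr fun T => ?_
  push_cast
  ring

theorem neg_le_re_conj_sub_mul (f : ℝ) (hf : 0 ≤ f) (y z : ℂ) :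
    -((‖z‖ ^ 2 + ‖y‖ ^ 2) / 2) ≤ (starRingEnd ℂ (f * y - z) * y).re := by
  have h1 : starRingEnd ℂ (f * y - z) * y = ((f * ‖y‖ ^ 2 : ℝ) : ℂ) - starRingEnd ℂ z * y := by
    push_cast
    rw [← Complex.conj_mul' y, map_sub, map_mul, Complex.conj_ofReal]
    ring
  have h2 : (starRingEnd ℂ z * y).re ≤ ‖z‖ * ‖y‖ := by
    refine (Complex.re_le_norm _).trans ?_
    rw [norm_mul, RCLike.norm_conj]
  rw [h1, Complex.sub_re, Complex.ofReal_re]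
  nlinarith [sq_nonneg (‖z‖ - ‖y‖), mul_nonneg hf (sq_nonneg ‖y‖)]

end FermiGas

namespace FermiGas
open Complex
open scoped ENNReal

/-! ### Excitation energy of eigenvectors -/

theorem summable_of_summable_modeNorm_mul {Vhat : Mode → ℝ} (hV : ∀ k, 0 ≤ Vhat k)
    (hs : Summable (fun k => modeNorm k * Vhat k)) : Summable Vhat := by
  have h : Summable (fun k : Mode => modeNorm k * Vhat k + if k = 0 then Vhat 0 else 0) :=
    hs.add ((hasSum_ite_eq (0 : Mode) (Vhat 0)).summable)
  refine Summable.of_nonneg_of_le hV (fun k => ?_) h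
  by_cases hk : k = 0
  · subst hk
    simp [mul_nonneg (modeNorm_nonneg 0) (hV 0)]
  · rw [if_neg hk, add_zero]
    exact le_mul_of_one_le_left (hV k) (one_le_modeNorm hk)

/-- The data of a normalized eigenvector in the sector of the Fermi ball. -/
structure EigenState (Vhat : Mode → ℝ) (kF E : ℝ) (ψ : Finset Mode → ℂ) : Prop where
  sector : ∀ S : Finset Mode, S.card ≠ particleNumber kF → ψ S = 0
  norm_sq : ∑' S, ‖ψ S‖ₑ ^ 2 = 1
  hasSum : ∀ S : NConf (particleNumber kF),
    HasSum (fun T : NConf (particleNumber kF) =>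
      hamMatrix (potential Vhat) (particleNumber kF) S T * ψ T.1) (E * ψ S.1)

namespace EigenState

variable {Vhat : Mode → ℝ} {kF E : ℝ} {ψ : Finset Mode → ℂ}

theorem summable_norm_sq (h : EigenState Vhat kF E ψ) :
    Summable (fun S : NConf (particleNumber kF) => ‖ψ S.1‖ ^ 2) := by
  refine summable_norm_sq_of_tsum_enorm (f := fun S : NConf (particleNumber kF) => ψ S.1) ?_
  rw [tsum_nconf_eq_tsum (fun S => ‖ψ S‖ₑ ^ 2) (fun S hS => by simp [h.sector S hS]), h.norm_sq]
  exact ENNReal.one_ne_top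

theorem tsum_norm_sq (h : EigenState Vhat kF E ψ) :
    ∑' S : NConf (particleNumber kF), ‖ψ S.1‖ ^ 2 = 1 := by
  have h1 := tsum_ofReal_mul_enorm_sq (g := fun _ => 1) h.sector (fun _ => zero_le_one)
    (by simpa using h.summable_norm_sq)
  simp only [ENNReal.ofReal_one, one_mul] at h1
  rw [h.norm_sq, eq_comm, ENNReal.ofReal_eq_one] at h1
  exact h1

theorem card_symmDiff_le (S : NConf (particleNumber kF)) :
    ((symmDiff S.1 (fermiBall kF)).card : ℝ) ≤ 2 * particleNumber kF := by
  have h1 : (symmDiff S.1 (fermiBall kF)).card ≤ S.1.card + (fermiBall kF).card :=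
    (Finset.card_le_card (symmDiff_le_sup (a := S.1))).trans (Finset.card_union_le _ _)
  rw [S.2] at h1
  have h2 : (symmDiff S.1 (fermiBall kF)).card ≤ 2 * particleNumber kF := by
    unfold particleNumber at h1 ⊢
    omega
  exact_mod_cast h2

theorem summable_card_mul (h : EigenState Vhat kF E ψ) :
    Summable (fun S : NConf (particleNumber kF) =>
      ((symmDiff S.1 (fermiBall kF)).card : ℝ) * ‖ψ S.1‖ ^ 2) := by
  refine Summable.of_nonneg_of_le (fun S => by positivity) (fun S => ?_)
    (h.summable_norm_sq.mul_left (2 * (particleNumber kF : ℝ)))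
  gcongr
  exact card_symmDiff_le S

theorem tsum_rhoAct_sq_le (h : EigenState Vhat kF E ψ) {k : Mode} (hk : k ≠ 0) :
    ∑' U : NConf (particleNumber kF), ‖rhoAct k ψ U‖ₑ ^ 2 ≤ (particleNumber kF : ℝ≥0∞) ^ 2 := by
  have h1 := tsum_sq_enorm_hopCoeff_le (n := particleNumber kF) hk (fun S => ‖ψ S‖ₑ)
    (fun S hS => by simp [h.sector S hS])
  rw [h.norm_sq, mul_one] at h1
  refine le_trans (ENNReal.tsum_le_tsum fun U => ?_) h1
  gcongr
  unfold rhoAct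
  refine enorm_tsum_le_tsum_enorm.trans (le_of_eq ?_)
  simp only [enorm_mul]

theorem summable_hopCoeff_mul (h : EigenState Vhat kF E ψ) {k : Mode} (hk : k ≠ 0)
    (U : NConf (particleNumber kF)) :
    Summable (fun T : NConf (particleNumber kF) => hopCoeff k U T * ψ T.1) := by
  have h1 := tsum_sq_enorm_hopCoeff_le (n := particleNumber kF) hk (fun S => ‖ψ S‖ₑ)
    (fun S hS => by simp [h.sector S hS])
  rw [h.norm_sq, mul_one] at h1
  refine summable_of_tsum_enorm_ne_top fun htop => ?_
  simp only [enorm_mul] at htop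
  have h2 := (ENNReal.le_tsum U).trans h1
  rw [htop] at h2
  simp at h2

theorem tsum_rhoComm_sq_le (h : EigenState Vhat kF E ψ) (h0 : 0 < kF) {k : Mode} (hk : k ≠ 0) :
    ∑' U : NConf (particleNumber kF), (∑' T : NConf (particleNumber kF), ‖hopCoeff k U T *
      ((((symmDiff U.1 (fermiBall kF)).card : ℝ) - ((symmDiff T.1 (fermiBall kF)).card : ℝ) : ℝ) *
        ψ T.1)‖ₑ) ^ 2
      ≤ ENNReal.ofReal (160 * modeNorm k * Real.sqrt (particleNumber kF) *
        (∑' S : NConf (particleNumber kF),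
          ((symmDiff S.1 (fermiBall kF)).card : ℝ) * ‖ψ S.1‖ ^ 2 + 1)) := by
  have hx : ∀ k : Mode, (exitCount (fermiBall kF) k : ℝ≥0∞)
      ≤ ENNReal.ofReal (10 * modeNorm k * Real.sqrt (particleNumber kF)) := fun k => by
    rw [← ENNReal.ofReal_natCast]
    exact ENNReal.ofReal_le_ofReal (exitCount_le h0 k)
  have hx2 := hx (-k)
  rw [modeNorm_neg] at hx2
  refine (FermiGas.tsum_rhoComm_sq_le (fermiBall kF) hk ψ _ (hx k) hx2).trans (le_of_eq ?_)
  have h1 := tsum_ofReal_mul_enorm_sq (g := fun S => ((symmDiff S (fermiBall kF)).card : ℝ) + 1)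
    h.sector (fun S => by positivity) (by
      simpa only [add_mul, one_mul] using h.summable_card_mul.add h.summable_norm_sq)
  have h2 : ∑' S : NConf (particleNumber kF),
      (((symmDiff S.1 (fermiBall kF)).card : ℝ) + 1) * ‖ψ S.1‖ ^ 2
      = ∑' S : NConf (particleNumber kF),
          ((symmDiff S.1 (fermiBall kF)).card : ℝ) * ‖ψ S.1‖ ^ 2 + 1 := by
    simp only [add_mul, one_mul]
    rw [h.summable_card_mul.tsum_add h.summable_norm_sq, h.tsum_norm_sq]
  rw [h2] at h1
  have h3 : ∀ S : Finset Mode, ENNReal.ofReal (((symmDiff S (fermiBall kF)).card : ℝ) + 1)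
      = ((symmDiff S (fermiBall kF)).card : ℝ≥0∞) + 1 := fun S => by
    rw [ENNReal.ofReal_add (by positivity) zero_le_one, ENNReal.ofReal_natCast, ENNReal.ofReal_one]
  simp only [h3] at h1
  rw [h1, show (16 : ℝ≥0∞) = ENNReal.ofReal 16 by simp, ← ENNReal.ofReal_mul (by norm_num),
    ← ENNReal.ofReal_mul (by have := modeNorm_nonneg k; positivity)]
  congr 1
  ring

/-- With `n` the number of excitations, write `ρ_k n ψ = n ρ_k ψ - [n, ρ_k] ψ`. The first term pairs
non-negatively with `ρ_k ψ`, and the commutator is treated by the arithmetic–geometric mean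
inequality and its Fermi surface bound. -/
theorem re_tsum_conj_rhoAct_ge (h : EigenState Vhat kF E ψ) (h0 : 0 < kF) {k : Mode} (hk : k ≠ 0) :
    -((160 * modeNorm k * Real.sqrt (particleNumber kF) *
        (∑' S : NConf (particleNumber kF),
          ((symmDiff S.1 (fermiBall kF)).card : ℝ) * ‖ψ S.1‖ ^ 2 + 1) +
        ∑' U : NConf (particleNumber kF), ‖rhoAct k ψ U‖ ^ 2) / 2)
      ≤ (∑' U : NConf (particleNumber kF), starRingEnd ℂ
        (rhoAct k (fun S => (((symmDiff S (fermiBall kF)).card : ℝ) : ℂ) * ψ S) U) *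
          rhoAct k ψ U).re := by
  set B := fermiBall kF with hB
  set n := particleNumber kF with hn
  set m := ∑' S : NConf n, ((symmDiff S.1 B).card : ℝ) * ‖ψ S.1‖ ^ 2 with hm
  have hm0 : 0 ≤ m := tsum_nonneg fun S => by positivity
  have hkn := modeNorm_nonneg k
  have hzz := h.tsum_rhoComm_sq_le h0 hk
  have hz1 : ∑' U : NConf n, ‖rhoComm B k ψ U‖ₑ ^ 2
      ≤ ENNReal.ofReal (160 * modeNorm k * Real.sqrt n * (m + 1)) := by
    refine le_trans (ENNReal.tsum_le_tsum fun U => ?_) hzz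
    gcongr
    exact enorm_tsum_le_tsum_enorm
  have hzs : Summable (fun U : NConf n => ‖rhoComm B k ψ U‖ ^ 2) :=
    summable_norm_sq_of_tsum_enorm (ne_top_of_le_ne_top ENNReal.ofReal_ne_top hz1)
  have hz2 := tsum_norm_sq_le_of_tsum_enorm (by positivity) hz1
  have hys : Summable (fun U : NConf n => ‖rhoAct k ψ U‖ ^ 2) :=
    summable_norm_sq_of_tsum_enorm (ne_top_of_le_ne_top
      (ENNReal.pow_ne_top (ENNReal.natCast_ne_top n)) (h.tsum_rhoAct_sq_le hk))
  have hY0 : 0 ≤ ∑' U : NConf n, ‖rhoAct k ψ U‖ ^ 2 := tsum_nonneg fun U => sq_nonneg _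
  have hU : ∀ U : NConf n, rhoAct k (fun S => (((symmDiff S B).card : ℝ) : ℂ) * ψ S) U
      = (((symmDiff U.1 B).card : ℝ) : ℂ) * rhoAct k ψ U - rhoComm B k ψ U := by
    intro U
    refine rhoAct_mul_eq B ψ U (h.summable_hopCoeff_mul hk U) ?_
    refine summable_of_tsum_enorm_ne_top fun htop => ?_
    have h2 := (ENNReal.le_tsum U).trans hzz
    rw [htop] at h2
    simp at h2
  by_cases hsum : Summable (fun U : NConf n => starRingEnd ℂ
        (rhoAct k (fun S => (((symmDiff S B).card : ℝ) : ℂ) * ψ S) U) * rhoAct k ψ U)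
  · rw [Complex.re_tsum hsum]
    have h1 : ∑' U : NConf n, -((‖rhoComm B k ψ U‖ ^ 2 + ‖rhoAct k ψ U‖ ^ 2) / 2)
        ≤ ∑' U : NConf n, (starRingEnd ℂ
        (rhoAct k (fun S => (((symmDiff S B).card : ℝ) : ℂ) * ψ S) U) * rhoAct k ψ U).re := by
      refine Summable.tsum_le_tsum (fun U => ?_) ((hzs.add hys).div_const 2).neg
        (Complex.reCLM.summable hsum)
      rw [hU]
      exact neg_le_re_conj_sub_mul _ (Nat.cast_nonneg _) _ _
    rw [tsum_neg, tsum_div_const, hzs.tsum_add hys] at h1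
    linarith
  -- Without summability the sum is zero by convention, and the lower bound is non-positive.
  · rw [tsum_eq_zero_of_not_summable hsum, Complex.zero_re]
    have : 0 ≤ 160 * modeNorm k * Real.sqrt n * (m + 1) := by positivity
    linarith

/-- Here `F` is the kinetic energy of the Fermi sea plus `κ`, `m = ⟨n⟩`, `A = ⟨n T⟩`, `s = √N`, `Y`
is the interaction sum and `R` its version weighted by `n`. The constant is `90 = 10 + 160 / 2`. -/
theorem weighted_energy_arith {c s m W Y hb C E F A R : ℝ} (hc : 0 ≤ c) (hW : 0 ≤ W) (hm : 0 ≤ m)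
    (hb0 : 0 ≤ hb) (hC : 0 ≤ C) (hcs : c * s ≤ hb) (hE : E - F ≤ (C + 10 * W) * hb)
    (hY : c * Y ≤ (C + 10 * W) * hb) (hid : E * m = F * m + A + c * R)
    (hR : -((160 * s * (m + 1) * W + Y) / 2) ≤ R) : A ≤ (C + 90 * W) * hb * (m + 1) := by
  have h1 := mul_le_mul_of_nonneg_left hR hc
  have h2 : c * (160 * s * (m + 1) * W) ≤ 160 * (hb * ((m + 1) * W)) := by
    calc _ = 160 * (c * s * ((m + 1) * W)) := by ring
      _ ≤ _ := by gcongr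
  have h3 : (E - F) * m ≤ (C + 10 * W) * hb * m := mul_le_mul_of_nonneg_right hE hm
  have h4 : 0 ≤ (C + 10 * W) * hb := by positivity
  have h5 : A ≤ (C + 10 * W) * hb * m + (160 * (hb * ((m + 1) * W)) + (C + 10 * W) * hb) / 2 := by
    linarith
  refine h5.trans ?_
  linarith

-- The weight `1` gives `E = F + ⟨T⟩ + cY` with `⟨T⟩` and `cY` non-negative, so both are bounded by
-- `E - F = O(ħ)`. The weight `n` gives `E⟨n⟩ = F⟨n⟩ + ⟨n T⟩` plus an interaction term whose
-- negative part is controlled by the commutator bound and by the same `Y`.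
set_option maxHeartbeats 800000 in
theorem energy_bounds (h : EigenState Vhat kF E ψ) (hV : ∀ k, 0 ≤ Vhat k)
    (hs : Summable (fun k => modeNorm k * Vhat k)) (h0 : 0 < kF) {C₀ : ℝ}
    (hE : E - fermiSeaEnergy (potential Vhat) kF ≤ C₀ * hbar (particleNumber kF)) :
    Summable (fun S : NConf (particleNumber kF) =>
      excEnergy kF (hbar (particleNumber kF) ^ 2) (symmDiff S.1 (fermiBall kF)) * ‖ψ S.1‖ ^ 2) ∧
    ∑' S : NConf (particleNumber kF),
      excEnergy kF (hbar (particleNumber kF) ^ 2) (symmDiff S.1 (fermiBall kF)) * ‖ψ S.1‖ ^ 2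
        ≤ (|C₀| + 10 * ∑' k, modeNorm k * Vhat k) * hbar (particleNumber kF) ∧
    Summable (fun S : NConf (particleNumber kF) => ((symmDiff S.1 (fermiBall kF)).card : ℝ) *
      excEnergy kF (hbar (particleNumber kF) ^ 2) (symmDiff S.1 (fermiBall kF)) * ‖ψ S.1‖ ^ 2) ∧
    ∑' S : NConf (particleNumber kF), ((symmDiff S.1 (fermiBall kF)).card : ℝ) *
      excEnergy kF (hbar (particleNumber kF) ^ 2) (symmDiff S.1 (fermiBall kF)) * ‖ψ S.1‖ ^ 2
        ≤ (|C₀| + 90 * ∑' k, modeNorm k * Vhat k) * hbar (particleNumber kF) *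
          (∑' S : NConf (particleNumber kF),
            ((symmDiff S.1 (fermiBall kF)).card : ℝ) * ‖ψ S.1‖ ^ 2 + 1) := by
  have hsV := summable_of_summable_modeNorm_mul hV hs
  obtain ⟨κ, hκ⟩ := exists_hamMatrix_eq hV hsV (particleNumber kF)
  have hsea := fermiSeaEnergy_le hV hs h0 κ hκ
  have hψtop : ∑' S, ‖ψ S‖ₑ ^ 2 ≠ ∞ := by rw [h.norm_sq]; exact ENNReal.one_ne_top
  obtain ⟨a1, a2, a3⟩ := energy_identity hV hsV (particleNumber kF) κ hκ ψ h.sector hψtop E h.hasSum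
    (fun _ => 1) 1 (fun _ _ => by simp)
  obtain ⟨b1, b2, b3⟩ := energy_identity hV hsV (particleNumber kF) κ hκ ψ h.sector hψtop E h.hasSum
    (fun S => ((symmDiff S (fermiBall kF)).card : ℝ)) (2 * particleNumber kF)
    (fun S hS => by rw [abs_of_nonneg (Nat.cast_nonneg _)]; exact card_symmDiff_le ⟨S, hS⟩)
  have hexp : ∀ S : NConf (particleNumber kF), hbar (particleNumber kF) ^ 2 * ∑ p ∈ S.1, normSq p + κ
      = (hbar (particleNumber kF) ^ 2 * ∑ p ∈ fermiBall kF, normSq p + κ)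
        + excEnergy kF (hbar (particleNumber kF) ^ 2) (symmDiff S.1 (fermiBall kF)) := fun S => by
    rw [sum_normSq_eq h0 S.2, excEnergy]; ring
  have hk1 := fun k : NZMode => h.re_tsum_conj_rhoAct_ge h0 k.2
  have hw1 := h.tsum_norm_sq
  have hws := h.summable_norm_sq
  have hns := h.summable_card_mul
  simp only [hexp] at a1 a3 b1 b3
  set n := particleNumber kF with hn
  set B := fermiBall kF with hB
  set hb := hbar n with hhb
  set hB0 := hb ^ 2 * ∑ p ∈ B, normSq p + κ with hhB
  set e : Finset Mode → ℝ := fun X => excEnergy kF (hb ^ 2) X with he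
  set W := ∑' k, modeNorm k * Vhat k with hW
  set m := ∑' S : NConf n, ((symmDiff S.1 B).card : ℝ) * ‖ψ S.1‖ ^ 2 with hm
  have hm0 : 0 ≤ m := tsum_nonneg fun S => by positivity
  have hb0 : 0 ≤ hb := hbar_nonneg n
  have hW0 : 0 ≤ W := tsum_nonneg fun k => mul_nonneg (modeNorm_nonneg k) (hV k)
  have hc0 := coupling_nonneg n
  have he0 : ∀ X, 0 ≤ e X := fun X => excEnergy_nonneg (sq_nonneg _) X
  -- the case of the constant weight
  have hY : ∀ k : NZMode, ∑' U : NConf n, starRingEnd ℂ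
      (rhoAct k.1 (fun S => ((1 : ℝ) : ℂ) * ψ S) U) * rhoAct k.1 ψ U
      = ((∑' U : NConf n, ‖rhoAct k.1 ψ U‖ ^ 2 : ℝ) : ℂ) := fun k => by
    rw [Complex.ofReal_tsum]
    refine tsum_congr fun U => ?_
    simp only [Complex.ofReal_one, one_mul]
    rw [Complex.conj_mul', Complex.ofReal_pow]
  simp only [hY, ← Complex.ofReal_mul] at a2 a3
  have a2' : Summable (fun k : NZMode => Vhat k * ∑' U : NConf n, ‖rhoAct k.1 ψ U‖ ^ 2) := by
    exact Complex.summable_ofReal.1 a2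
  have a1' : Summable (fun S : NConf n => 1 * (hB0 + e (symmDiff S.1 B)) * ‖ψ S.1‖ ^ 2) := by
    exact Complex.summable_ofReal.1 a1
  rw [← Complex.ofReal_tsum, ← Complex.ofReal_tsum, ← Complex.ofReal_tsum, ← Complex.ofReal_mul,
    ← Complex.ofReal_add] at a3
  have a3' := Complex.ofReal_injective a3
  have hes : Summable (fun S : NConf n => e (symmDiff S.1 B) * ‖ψ S.1‖ ^ 2) :=
    (a1'.sub (hws.mul_left hB0)).congr fun S => by ring
  have a4 : ∑' S : NConf n, 1 * E * ‖ψ S.1‖ ^ 2 = E := by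
    rw [tsum_mul_left, hw1]; ring
  have a5 : ∑' S : NConf n, 1 * (hB0 + e (symmDiff S.1 B)) * ‖ψ S.1‖ ^ 2
      = hB0 + ∑' S : NConf n, e (symmDiff S.1 B) * ‖ψ S.1‖ ^ 2 := by
    simp only [one_mul, add_mul]
    rw [(hws.mul_left hB0).tsum_add hes, tsum_mul_left, hw1, mul_one]
  rw [a4, a5] at a3'
  set Y := ∑' k : NZMode, Vhat k * ∑' U : NConf n, ‖rhoAct k.1 ψ U‖ ^ 2 with hYdef
  set A := ∑' S : NConf n, e (symmDiff S.1 B) * ‖ψ S.1‖ ^ 2 with hA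
  have hY0 : 0 ≤ Y := tsum_nonneg fun k => mul_nonneg (hV _) (tsum_nonneg fun _ => sq_nonneg _)
  have hA0 : 0 ≤ A := tsum_nonneg fun S => mul_nonneg (he0 _) (sq_nonneg _)
  have hcY : 0 ≤ coupling n * Y := mul_nonneg hc0 hY0
  have hC0 : C₀ * hb ≤ |C₀| * hb := mul_le_mul_of_nonneg_right (le_abs_self _) hb0
  have hEB : E - hB0 ≤ (|C₀| + 10 * W) * hb := by nlinarith
  -- the case of the number of excitations
  have b1' : Summable (fun S : NConf n =>
      ((symmDiff S.1 B).card : ℝ) * (hB0 + e (symmDiff S.1 B)) * ‖ψ S.1‖ ^ 2) := by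
    exact Complex.summable_ofReal.1 b1
  have hnes : Summable (fun S : NConf n =>
      ((symmDiff S.1 B).card : ℝ) * e (symmDiff S.1 B) * ‖ψ S.1‖ ^ 2) :=
    (b1'.sub (hns.mul_left hB0)).congr fun S => by ring
  have b4 : ∑' S : NConf n, ((symmDiff S.1 B).card : ℝ) * E * ‖ψ S.1‖ ^ 2 = E * m := by
    rw [hm, ← tsum_mul_left]; exact tsum_congr fun S => by ring
  have b5 : ∑' S : NConf n, ((symmDiff S.1 B).card : ℝ) * (hB0 + e (symmDiff S.1 B)) * ‖ψ S.1‖ ^ 2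
      = hB0 * m + ∑' S : NConf n, ((symmDiff S.1 B).card : ℝ) * e (symmDiff S.1 B) * ‖ψ S.1‖ ^ 2 := by
    rw [hm, ← tsum_mul_left, ← (hns.mul_left hB0).tsum_add hnes]
    exact tsum_congr fun S => by ring
  rw [← Complex.ofReal_tsum, ← Complex.ofReal_tsum, b4, b5] at b3
  have b3' := congrArg Complex.re b3
  rw [Complex.add_re, Complex.ofReal_re, Complex.ofReal_re, Complex.re_ofReal_mul,
    Complex.re_tsum b2] at b3'
  have hsK : Summable (fun k : NZMode => modeNorm k.1 * Vhat k) := hs.subtype _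
  have hWK : ∑' k : NZMode, modeNorm k.1 * Vhat k ≤ W :=
    Summable.tsum_subtype_le (fun k => modeNorm k * Vhat k) {k | k ≠ 0}
      (fun k => mul_nonneg (modeNorm_nonneg k) (hV k)) hs
  have hlow : -((160 * Real.sqrt n * (m + 1) * W + Y) / 2)
      ≤ ∑' k : NZMode, ((Vhat k : ℂ) * ∑' U : NConf n, starRingEnd ℂ
        (rhoAct k.1 (fun S => (((symmDiff S B).card : ℝ) : ℂ) * ψ S) U) * rhoAct k.1 ψ U).re := by
    have l1 : ∑' k : NZMode, -((160 * Real.sqrt n * (m + 1) * (modeNorm k.1 * Vhat k)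
          + Vhat k * ∑' U : NConf n, ‖rhoAct k.1 ψ U‖ ^ 2) / 2)
        ≤ ∑' k : NZMode, ((Vhat k : ℂ) * ∑' U : NConf n, starRingEnd ℂ
        (rhoAct k.1 (fun S => (((symmDiff S B).card : ℝ) : ℂ) * ψ S) U) * rhoAct k.1 ψ U).re := by
      refine Summable.tsum_le_tsum (fun k => ?_)
        (((hsK.mul_left _).add a2').div_const 2).neg (Complex.reCLM.summable b2)
      rw [Complex.re_ofReal_mul]
      refine le_trans (le_of_eq ?_) (mul_le_mul_of_nonneg_left (hk1 k) (hV k))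
      ring
    rw [tsum_neg, tsum_div_const, (hsK.mul_left _).tsum_add a2', tsum_mul_left] at l1
    refine le_trans ?_ l1
    have : 160 * Real.sqrt n * (m + 1) * ∑' k : NZMode, modeNorm k.1 * Vhat k
        ≤ 160 * Real.sqrt n * (m + 1) * W := by gcongr
    linarith
  refine ⟨hes, by linarith, hnes, ?_⟩
  exact weighted_energy_arith hc0 hW0 hm0 hb0 (abs_nonneg C₀) (coupling_mul_sqrt_le n) hEB
    (by linarith) b3' hlow

end EigenState

end FermiGas

namespace FermiGas
open scoped ENNReal

/-! ### Moments of the number of excitations -/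

theorem mul_card_le_sum_abs {kF δ : ℝ} {F X : Finset Mode} (hFX : F ⊆ X)
    (hF : ∀ p ∈ F, δ ≤ |normSq p - kF ^ 2|) : F.card * δ ≤ ∑ p ∈ X, |normSq p - kF ^ 2| := by
  calc _ = ∑ p ∈ F, δ := by rw [Finset.sum_const, nsmul_eq_mul]
    _ ≤ ∑ p ∈ F, |normSq p - kF ^ 2| := Finset.sum_le_sum hF
    _ ≤ _ := Finset.sum_le_sum_of_subset_of_nonneg hFX fun _ _ _ => abs_nonneg _

/-- The shell of half-width `t^50 = N^{1/4}` around `kF²` holds `O(t^51)` points, the divisor bound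
with exponent `1/200` costing one factor `t`. Each excitation outside the shell has energy at least
`t^50 / t^200`. At energy `ħ = t^{-100}` the two contributions nearly balance. -/
theorem exists_card_le_excEnergy : ∃ C : ℝ, 1 ≤ C ∧ ∀ kF : ℝ, IsFermiMomentum kF → ∀ t : ℝ, 1 ≤ t →
    (particleNumber kF : ℝ) = t ^ 200 → ∀ X : Finset Mode,
      (X.card : ℝ) ≤ C * t ^ 51 + t ^ 150 * excEnergy kF (hbar (particleNumber kF) ^ 2) X := by
  classical
  obtain ⟨C, hC1, hC⟩ := card_shell_le (1 / 200) (by norm_num)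
  refine ⟨15 * C, by linarith, fun kF hkF t ht hN X => ?_⟩
  have ht0 : 0 < t := by linarith
  set F := X.filter (fun p => |normSq p - kF ^ 2| ≤ t ^ 50) with hF
  set G := X.filter (fun p => ¬ |normSq p - kF ^ 2| ≤ t ^ 50) with hG
  have hcard : (X.card : ℝ) = F.card + G.card := by
    rw [← Finset.card_filter_add_card_filter_not (fun p => |normSq p - kF ^ 2| ≤ t ^ 50)]
    push_cast
    rfl
  have h50 : 1 ≤ t ^ 50 := one_le_pow₀ ht
  have h1 := hC (kF ^ 2) (t ^ 50) (by positivity) (by nlinarith [sq_nonneg kF]) F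
    (fun p hp => (Finset.mem_filter.1 hp).2)
  have h2 : (kF ^ 2 + t ^ 50) ^ (1 / 200 : ℝ) ≤ 5 * t := by
    have h3 : kF ^ 2 + t ^ 50 ≤ (5 * t) ^ 200 := by
      have h4 := sq_le_particleNumber hkF.1
      have h5 : t ^ 50 ≤ t ^ 200 := pow_le_pow_right₀ ht (by norm_num)
      have h6 : (5 : ℝ) * t ^ 200 ≤ (5 * t) ^ 200 := by
        rw [mul_pow]
        have : (5 : ℝ) ≤ 5 ^ 200 := by norm_num
        gcongr
      rw [hN] at h4
      linarith
    calc _ ≤ ((5 * t) ^ 200) ^ (1 / 200 : ℝ) := by gcongr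
      _ = 5 * t := by
          rw [← Real.rpow_natCast, ← Real.rpow_mul (by positivity)]
          norm_num
  have h7 : (F.card : ℝ) ≤ 15 * C * t ^ 51 := by
    calc _ ≤ (2 * t ^ 50 + 1) * (C * (kF ^ 2 + t ^ 50) ^ (1 / 200 : ℝ)) := h1
      _ ≤ (3 * t ^ 50) * (C * (5 * t)) := by gcongr; linarith
      _ = _ := by ring
  have h8 := mul_card_le_sum_abs (kF := kF) (δ := t ^ 50) (Finset.filter_subset _ X : G ⊆ X)
    (fun p hp => (not_le.1 (Finset.mem_filter.1 hp).2).le)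
  have h9 : (G.card : ℝ) ≤ t ^ 150 * excEnergy kF (hbar (particleNumber kF) ^ 2) X := by
    unfold excEnergy
    rw [hbar_sq, hN]
    calc (G.card : ℝ) = t ^ 150 * (1 / t ^ 200 * (G.card * t ^ 50)) := by field_simp
      _ ≤ _ := by gcongr
  rw [hcard]
  linarith

theorem countIn_le_excEnergy {kF t : ℝ} (ht : 1 ≤ t) (hN : (particleNumber kF : ℝ) = t ^ 200)
    (X : Finset Mode) :
    (countIn {p | t ^ 54 < |normSq p - kF ^ 2|} X : ℝ)
      ≤ t ^ 146 * excEnergy kF (hbar (particleNumber kF) ^ 2) X := by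
  classical
  have ht0 : 0 < t := by linarith
  set G := X.filter (· ∈ {p | t ^ 54 < |normSq p - kF ^ 2|}) with hG
  have h8 := mul_card_le_sum_abs (kF := kF) (δ := t ^ 54) (Finset.filter_subset _ X : G ⊆ X)
    (fun p hp => le_of_lt (Finset.mem_filter.1 hp).2)
  have h0 : (countIn {p | t ^ 54 < |normSq p - kF ^ 2|} X : ℝ) = G.card := by
    unfold countIn
    congr!
  rw [h0]
  unfold excEnergy
  rw [hbar_sq, hN]
  calc (G.card : ℝ) = t ^ 146 * (1 / t ^ 200 * (G.card * t ^ 54)) := by field_simp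
    _ ≤ _ := by gcongr

/-- The exponents: `m = O(t^51)`, the high-energy part is `146 - 100 + 51 = 97`, and the part with
two low ends is `2 · 48 = 96`. -/
theorem moment_arith {t hb C₁ C₂ C₃ M A m An w : ℝ} (ht : 1 ≤ t) (hb1 : hb = 1 / t ^ 100)
    (hC1 : 0 ≤ C₁) (hC2 : 0 ≤ C₂) (hC3 : 0 ≤ C₃) (hA : A ≤ C₁ * hb)
    (hm : m ≤ C₃ * t ^ 51 + t ^ 150 * A) (hAn : An ≤ C₂ * hb * (m + 1)) (hw : w = 1) :
    2 * t ^ 146 * An + m + (M * t ^ 48) ^ 2 * w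
      ≤ (2 * C₂ * (C₃ + C₁ + 1) + (C₃ + C₁) + M ^ 2) * t ^ 97 := by
  have ht0 : 0 < t := by linarith
  have hb0 : 0 ≤ hb := by rw [hb1]; positivity
  have h1 : t ^ 150 * hb = t ^ 50 := by rw [hb1]; field_simp
  have h2 : t ^ 146 * hb = t ^ 46 := by rw [hb1]; field_simp
  have h50 : t ^ 50 ≤ t ^ 51 := pow_le_pow_right₀ ht (by norm_num)
  have h51 : 1 ≤ t ^ 51 := one_le_pow₀ ht
  have h97 : t ^ 51 ≤ t ^ 97 := pow_le_pow_right₀ ht (by norm_num)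
  have h96 : t ^ 96 ≤ t ^ 97 := pow_le_pow_right₀ ht (by norm_num)
  have hm' : m ≤ (C₃ + C₁) * t ^ 51 := by
    calc m ≤ C₃ * t ^ 51 + t ^ 150 * (C₁ * hb) := hm.trans (by gcongr)
      _ = C₃ * t ^ 51 + C₁ * (t ^ 150 * hb) := by ring
      _ ≤ C₃ * t ^ 51 + C₁ * t ^ 51 := by rw [h1]; gcongr
      _ = _ := by ring
  have hAn' : t ^ 146 * An ≤ C₂ * (C₃ + C₁ + 1) * t ^ 97 := by
    calc t ^ 146 * An ≤ t ^ 146 * (C₂ * hb * ((C₃ + C₁) * t ^ 51 + t ^ 51)) := by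
          gcongr
          refine hAn.trans ?_
          gcongr
      _ = C₂ * (C₃ + C₁ + 1) * (t ^ 146 * hb) * t ^ 51 := by ring
      _ = _ := by rw [h2]; ring
  have h3 : (C₃ + C₁) * t ^ 51 ≤ (C₃ + C₁) * t ^ 97 := by gcongr
  have h4 : (M * t ^ 48) ^ 2 * w ≤ M ^ 2 * t ^ 97 := by
    rw [hw, mul_one, mul_pow, ← pow_mul]
    gcongr
  linarith

theorem exists_tsum_dAbs_sq_le {Vhat : Mode → ℝ} (hV : ∀ k, 0 ≤ Vhat k)
    (hs : Summable (fun k => modeNorm k * Vhat k)) (C₀ : ℝ) :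
    ∃ D : ℝ, 0 < D ∧ ∀ kF : ℝ, IsFermiMomentum kF → ∀ (E : ℝ) (ψ : Finset Mode → ℂ),
      EigenState Vhat kF E ψ →
      E - fermiSeaEnergy (potential Vhat) kF ≤ C₀ * hbar (particleNumber kF) →
      ∀ a : Finset Mode → ℝ≥0∞, (∀ S, a S = ‖ψ (symmDiff S (fermiBall kF))‖ₑ) →
      ∀ k : Mode, k ≠ 0 → ∑' S, dAbs (fermiBall kF) k a S ^ 2
        ≤ ENNReal.ofReal (D * (particleNumber kF : ℝ) ^ (97 / 200 : ℝ)) := by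
  obtain ⟨C₃, hC3, hcard⟩ := exists_card_le_excEnergy
  obtain ⟨M, hM1, hpair⟩ := exists_card_pair_le
  set W := ∑' k, modeNorm k * Vhat k with hW
  have hW0 : 0 ≤ W := tsum_nonneg fun k => mul_nonneg (modeNorm_nonneg k) (hV k)
  have habs := abs_nonneg C₀
  set C₁ := |C₀| + 10 * W with hC1
  set C₂ := |C₀| + 90 * W with hC2
  have hC10 : 0 ≤ C₁ := by positivity
  have hC20 : 0 ≤ C₂ := by positivity
  refine ⟨12 * (2 * C₂ * (C₃ + C₁ + 1) + (C₃ + C₁) + M ^ 2), by positivity,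
    fun kF hkF E ψ h hE a ha k hk => ?_⟩
  have h0 := hkF.1
  obtain ⟨e1, e2, e3, e4⟩ := h.energy_bounds hV hs h0 hE
  have hN1 : (1 : ℝ) ≤ particleNumber kF := by exact_mod_cast one_le_particleNumber h0
  obtain ⟨t, ht1, hN, ht97⟩ : ∃ t : ℝ, 1 ≤ t ∧ (particleNumber kF : ℝ) = t ^ 200 ∧
      t ^ 97 = (particleNumber kF : ℝ) ^ (97 / 200 : ℝ) := by
    refine ⟨(particleNumber kF : ℝ) ^ (1 / 200 : ℝ), Real.one_le_rpow hN1 (by norm_num), ?_, ?_⟩ <;>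
    · rw [← Real.rpow_natCast, ← Real.rpow_mul (by linarith)]
      norm_num
  have hb1 : hbar (particleNumber kF) = 1 / t ^ 100 := by
    rw [hbar_eq, hN, show t ^ 200 = (t ^ 100) ^ 2 by ring, Real.sqrt_sq (by positivity)]
  set H : Set Mode := {p | t ^ 54 < |normSq p - kF ^ 2|} with hH
  have hpair' : ∀ k : Mode, k ≠ 0 → ∀ F : Finset Mode, (∀ q ∈ F, q ∉ H ∧ q + k ∉ H) →
      (F.card : ℝ≥0∞) ≤ ENNReal.ofReal (M * t ^ 48) := by
    intro k hk F hF
    rw [← ENNReal.ofReal_natCast]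
    exact ENNReal.ofReal_le_ofReal (hpair kF hkF t ht1 hN k hk F (fun p hp => not_lt.1 (hF p hp).1)
      (fun p hp => not_lt.1 (hF p hp).2))
  refine (tsum_dAbs_sq_le_of_high (fermiBall kF) H _ (hpair' k hk) (hpair' (-k) (neg_ne_zero.2 hk)) a).trans ?_
  have hinv : Function.Involutive (fun S : Finset Mode => symmDiff S (fermiBall kF)) :=
    fun S => symmDiff_symmDiff_cancel_right _ S
  -- Pass from sets of excitations, on which `d(k)` acts, to configurations of `ψ`, on which the
  -- energy bounds are stated.
  rw [← (hinv.toPerm _).tsum_eq]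
  simp only [Function.Involutive.coe_toPerm, ha, symmDiff_symmDiff_cancel_right]
  set B := fermiBall kF with hB
  set n := particleNumber kF with hn
  set e : Finset Mode → ℝ := fun X => excEnergy kF (hbar n ^ 2) X with he
  have hw := h.tsum_norm_sq
  have hws := h.summable_norm_sq
  have hns := h.summable_card_mul
  set g : Finset Mode → ℝ := fun S => 2 * ((symmDiff S B).card * countIn H (symmDiff S B))
    + (symmDiff S B).card + (M * t ^ 48) ^ 2 with hg
  have hg0 : ∀ S, 0 ≤ g S := fun S => by positivity
  have hgE : ∀ S, ENNReal.ofReal (g S) = 2 * (((symmDiff S B).card : ℝ≥0∞) * countIn H (symmDiff S B))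
    + (symmDiff S B).card + ENNReal.ofReal (M * t ^ 48) ^ 2 := by
    intro S
    simp only [hg]
    rw [ENNReal.ofReal_add (by positivity) (by positivity),
      ENNReal.ofReal_add (by positivity) (by positivity), ENNReal.ofReal_mul (by norm_num),
      ENNReal.ofReal_mul (by positivity), ENNReal.ofReal_natCast, ENNReal.ofReal_natCast,
      ENNReal.ofReal_pow (by positivity), ENNReal.ofReal_ofNat]
  simp only [← hgE]
  have hgle : ∀ S : NConf n, g S.1 * ‖ψ S.1‖ ^ 2
      ≤ 2 * t ^ 146 * (((symmDiff S.1 B).card : ℝ) * e (symmDiff S.1 B) * ‖ψ S.1‖ ^ 2)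
        + ((symmDiff S.1 B).card : ℝ) * ‖ψ S.1‖ ^ 2 + (M * t ^ 48) ^ 2 * ‖ψ S.1‖ ^ 2 := by
    intro S
    have h1 := countIn_le_excEnergy ht1 hN (symmDiff S.1 B)
    have h2 : g S.1 ≤ 2 * (((symmDiff S.1 B).card : ℝ) * (t ^ 146 * e (symmDiff S.1 B)))
      + (symmDiff S.1 B).card + (M * t ^ 48) ^ 2 := by
      simp only [hg]
      gcongr
    refine (mul_le_mul_of_nonneg_right h2 (sq_nonneg _)).trans (le_of_eq ?_)
    ring
  have s1 := ((e3.mul_left (2 * t ^ 146)).add hns).add (hws.mul_left ((M * t ^ 48) ^ 2))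
  have hgs : Summable (fun S : NConf n => g S.1 * ‖ψ S.1‖ ^ 2) :=
    Summable.of_nonneg_of_le (fun S => mul_nonneg (hg0 _) (sq_nonneg _)) hgle s1
  rw [tsum_ofReal_mul_enorm_sq h.sector hg0 hgs, show (12 : ℝ≥0∞) = ENNReal.ofReal 12 by simp,
    ← ENNReal.ofReal_mul (by norm_num), ← ht97]
  refine ENNReal.ofReal_le_ofReal ?_
  rw [mul_assoc]
  refine mul_le_mul_of_nonneg_left ?_ (by norm_num)
  refine (Summable.tsum_le_tsum hgle hgs s1).trans ?_
  rw [((e3.mul_left (2 * t ^ 146)).add hns).tsum_add (hws.mul_left ((M * t ^ 48) ^ 2)),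
    (e3.mul_left (2 * t ^ 146)).tsum_add hns, tsum_mul_left, tsum_mul_left]
  refine moment_arith ht1 hb1 hC10 hC20 (by linarith) e2 ?_ e4 hw
  have s2 := (hws.mul_left (C₃ * t ^ 51)).add (e1.mul_left (t ^ 150))
  have h3 : ∑' S : NConf n, ((symmDiff S.1 B).card : ℝ) * ‖ψ S.1‖ ^ 2
      ≤ ∑' S : NConf n, (C₃ * t ^ 51 * ‖ψ S.1‖ ^ 2 + t ^ 150 * (e (symmDiff S.1 B) * ‖ψ S.1‖ ^ 2)) := by
    refine Summable.tsum_le_tsum (fun S => ?_) hns s2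
    refine (mul_le_mul_of_nonneg_right (hcard kF hkF t ht1 hN (symmDiff S.1 B))
      (sq_nonneg _)).trans (le_of_eq ?_)
    ring
  rw [(hws.mul_left (C₃ * t ^ 51)).tsum_add (e1.mul_left (t ^ 150)), tsum_mul_left, tsum_mul_left,
    hw, mul_one] at h3
  exact h3

end FermiGas

namespace FermiGas
open scoped ENNReal

/-! ### Eigenvectors that are approximate ground states -/

theorem tsum_enorm_sq_eq (ξ : Fock) : ∑' S, ‖ξ S‖ₑ ^ 2 = ENNReal.ofReal (‖ξ‖ ^ 2) := by
  have h := lp.hasSum_norm (p := 2) (by norm_num) ξ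
  norm_num at h
  rw [← h.tsum_eq, ENNReal.ofReal_tsum_of_nonneg (fun _ => sq_nonneg _) h.summable]
  refine tsum_congr fun S => ?_
  rw [ENNReal.ofReal_pow (norm_nonneg _), ofReal_norm]

theorem enorm_particleHole (B : Finset Mode) (ξ : Fock) (S : Finset Mode) :
    ‖particleHole B ξ S‖ₑ = ‖ξ (symmDiff S B)‖ₑ := by
  change ‖phSign B (symmDiff S B) * ξ (symmDiff S B)‖ₑ = _
  rw [enorm_mul, ← ofReal_norm (phSign B _), norm_phSign, ENNReal.ofReal_one, one_mul]

theorem norm_particleHole (B : Finset Mode) (ξ : Fock) : ‖particleHole B ξ‖ = ‖ξ‖ := by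
  have hinv : Function.Involutive (fun S : Finset Mode => symmDiff S B) :=
    fun S => symmDiff_symmDiff_cancel_right _ S
  have h1 := tsum_enorm_sq_eq (particleHole B ξ)
  rw [← (hinv.toPerm _).tsum_eq] at h1
  simp only [Function.Involutive.coe_toPerm, enorm_particleHole,
    symmDiff_symmDiff_cancel_right] at h1
  rw [tsum_enorm_sq_eq, ENNReal.ofReal_eq_ofReal_iff (sq_nonneg _) (sq_nonneg _)] at h1
  exact ((sq_eq_sq₀ (norm_nonneg _) (norm_nonneg _)).1 h1).symm

/-- The image of a vector under `H_N` is unique, so the `η` in the energy condition is `E ψ`, and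
the energy expectation is the eigenvalue itself. -/
theorem exists_eigenState {Vhat : Mode → ℝ} {kF C₀ : ℝ} {ξ : Fock}
    (h1 : BelongsToApproxGroundState (potential Vhat) kF C₀ ξ)
    (h2 : IsEigenvector (potential Vhat) (particleNumber kF) (particleHole (fermiBall kF) ξ)) :
    ∃ E : ℝ, EigenState Vhat kF E (particleHole (fermiBall kF) ξ) ∧
      E - fermiSeaEnergy (potential Vhat) kF ≤ C₀ * hbar (particleNumber kF) := by
  obtain ⟨hsec, hnorm, η, ⟨-, hη, hηs⟩, hle⟩ := h1
  obtain ⟨-, E, -, -, hE⟩ := h2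
  set ψ := particleHole (fermiBall kF) ξ with hψ
  have hψn : ‖ψ‖ = 1 := by rw [hψ, norm_particleHole, hnorm]
  have hEη : η = (E : ℂ) • ψ := by
    ext S
    by_cases hS : S.card = particleNumber kF
    · exact (hηs ⟨S, hS⟩).unique (hE ⟨S, hS⟩)
    · rw [hη S hS]
      change 0 = (E : ℂ) * ψ S
      rw [hsec S hS, mul_zero]
  refine ⟨E, ⟨hsec, ?_, fun S => ?_⟩, ?_⟩
  · rw [tsum_enorm_sq_eq, hψn]; simp
  · exact hE S
  · rw [hEη, inner_smul_right, inner_self_eq_norm_sq_to_K, hψn] at hle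
    simpa using hle

theorem exists_eigenvector_bounds {Vhat : Mode → ℝ} (hV : ∀ k, 0 ≤ Vhat k)
    (hs : Summable (fun k => modeNorm k * Vhat k)) (C₀ ε : ℝ) (hε : 0 < ε) :
    ∃ C : ℝ, 0 < C ∧ ∀ kF : ℝ, IsFermiMomentum kF → ∀ ξ : Fock,
      BelongsToApproxGroundState (potential Vhat) kF C₀ ξ →
      IsEigenvector (potential Vhat) (particleNumber kF) (particleHole (fermiBall kF) ξ) →
      (∀ k : Mode, Summable (fun S => ‖dOp (fermiBall kF) k ξ S‖ ^ 2) ∧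
        ∑' S, ‖dOp (fermiBall kF) k ξ S‖ ^ 2
          ≤ C * (particleNumber kF : ℝ) ^ ((1 / 2 : ℝ) - 1 / 68 + ε)) ∧
      (∀ S, Summable (fun k : {k : Mode // k ≠ 0} => (Vhat k : ℂ) *
        dStar (fermiBall kF) k (dOp (fermiBall kF) k ξ) S)) ∧
      Summable (fun S : Finset Mode => starRingEnd ℂ (ξ S) * opE1 Vhat kF ξ S) ∧
      ‖expect (opE1 Vhat kF) ξ‖
        ≤ C * hbar (particleNumber kF) * (particleNumber kF : ℝ) ^ (-(1 / 68 : ℝ) + ε) := by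
  obtain ⟨D, hD0, hD⟩ := exists_tsum_dAbs_sq_le hV hs C₀
  have hsV := summable_of_summable_modeNorm_mul hV hs
  set V1 := ∑' k : ({k | k ≠ 0} : Set Mode), Vhat k with hV1
  have hV10 : 0 ≤ V1 := tsum_nonneg fun k => hV _
  refine ⟨(V1 + 1) * D, by positivity, fun kF hkF ξ h1 h2 => ?_⟩
  obtain ⟨E, hψ, hE⟩ := exists_eigenState h1 h2
  have hN1 : (1 : ℝ) ≤ particleNumber kF := by exact_mod_cast one_le_particleNumber hkF.1
  have hN0 : (0 : ℝ) < particleNumber kF := by linarith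
  set n := particleNumber kF with hn
  set P : ℝ := (n : ℝ) ^ (97 / 200 : ℝ) with hP
  have hP0 : 0 < P := by positivity
  have hd := hD kF hkF E _ hψ hE (fun S => ‖ξ S‖ₑ) (fun S => by
    rw [enorm_particleHole, symmDiff_symmDiff_cancel_right])
  have hξ1 : ∀ S, ‖ξ S‖ₑ ≤ 1 := fun S => by
    rw [← ofReal_norm, ← ENNReal.ofReal_one]
    exact ENNReal.ofReal_le_ofReal ((lp.norm_apply_le_norm (by norm_num) ξ S).trans h1.2.1.le)
  have hexpect := expect_opE1On_le Vhat hV kF {k | k ≠ 0} (fun k hk => hk) (hsV.subtype _) ξ (D * P)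
    (by positivity) (fun k hk => hd k hk)
  have hDV : D ≤ (V1 + 1) * D := by nlinarith
  refine ⟨fun k => ?_, fun S => summable_dStar_dOp hV hsV _ ξ hξ1 S, hexpect.1, hexpect.2.trans ?_⟩
  · by_cases hk : k = 0
    · subst hk
      have hz : ∀ S, dOp (fermiBall kF) 0 ξ S = 0 := dOp_zero _ _ fun S hS => by
        have h3 := hψ.sector (symmDiff S (fermiBall kF)) hS
        rw [← enorm_eq_zero, enorm_particleHole, symmDiff_symmDiff_cancel_right,
          enorm_eq_zero] at h3
        exact h3
      simp only [hz]
      refine ⟨by simp, ?_⟩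
      simp only [norm_zero, ne_eq, OfNat.ofNat_ne_zero, not_false_eq_true, zero_pow, tsum_zero]
      positivity
    · have h3 : ∑' S, ‖dOp (fermiBall kF) k ξ S‖ₑ ^ 2 ≤ ENNReal.ofReal (D * P) :=
        (ENNReal.tsum_le_tsum fun S => by gcongr; exact enorm_dOp_le _ hk ξ S).trans (hd k hk)
      refine ⟨summable_norm_sq_of_tsum_enorm (ne_top_of_le_ne_top ENNReal.ofReal_ne_top h3),
        (tsum_norm_sq_le_of_tsum_enorm (by positivity) h3).trans ?_⟩
      refine mul_le_mul hDV ?_ hP0.le (by positivity)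
      -- `97/200 = 1/2 - 3/200`, and `3/200 > 1/68`.
      exact Real.rpow_le_rpow_of_exponent_le hN1 (by norm_num; linarith)
  · have h4 : 1 / (2 * (2 * Real.pi) ^ 2 * (n : ℝ)) * (V1 * (D * P))
        ≤ hbar n * (V1 * D) * (n : ℝ) ^ (-(3 / 200) : ℝ) := by
      have h5 : P = Real.sqrt n * (n : ℝ) ^ (-(3 / 200) : ℝ) := by
        rw [hP, Real.sqrt_eq_rpow, ← Real.rpow_add hN0]
        norm_num
      calc _ = coupling n * Real.sqrt n * (V1 * D) * (n : ℝ) ^ (-(3 / 200) : ℝ) := by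
            rw [h5, coupling]; ring
        _ ≤ _ := by gcongr; exact coupling_mul_sqrt_le n
    refine h4.trans ?_
    have h6 : (n : ℝ) ^ (-(3 / 200) : ℝ) ≤ (n : ℝ) ^ (-(1 / 68 : ℝ) + ε) :=
      Real.rpow_le_rpow_of_exponent_le hN1 (by linarith)
    have h7 := hbar_nonneg n
    calc _ ≤ hbar n * ((V1 + 1) * D) * (n : ℝ) ^ (-(1 / 68 : ℝ) + ε) := by gcongr; linarith
      _ = _ := by ring

end FermiGas

theorem mainTheorem3 (Vhat : FermiGas.Mode → ℝ) (hVsymm : ∀ k, Vhat (-k) = Vhat k)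
    (hVnonneg : ∀ k, 0 ≤ Vhat k) :
    -- bound on the truncated term
    (∀ b : ℝ, 0 < b → b < 1 →
      Summable (fun k : FermiGas.Mode => FermiGas.modeNorm k ^ (2 - b) * Vhat k ^ 2) →
      ∀ Λ : ℝ, 0 < Λ → ∃ C : ℝ, 0 < C ∧
        ∀ kF : ℝ, FermiGas.IsFermiMomentum kF → ∀ ξ : FermiGas.Fock,
          Summable (fun S : Finset FermiGas.Mode => (S.card : ℝ) ^ 2 * ‖ξ S‖ ^ 2) →
          Summable (fun S : Finset FermiGas.Mode =>
            starRingEnd ℂ (ξ S) * FermiGas.opE1Trunc Vhat kF Λ ξ S) ∧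
          ‖FermiGas.expect (FermiGas.opE1Trunc Vhat kF Λ) ξ‖ ≤
            C * (FermiGas.particleNumber kF : ℝ) ^ (-1 + b / 4) *
              ∑' S : Finset FermiGas.Mode, (S.card : ℝ) ^ 2 * ‖ξ S‖ ^ 2) ∧
    -- bounds for eigenvectors that are approximate ground states
    (Summable (fun k : FermiGas.Mode => FermiGas.modeNorm k * Vhat k) →
      ∀ C₀ ε : ℝ, 0 < ε → ∃ C : ℝ, 0 < C ∧
        ∀ kF : ℝ, FermiGas.IsFermiMomentum kF → ∀ ξ : FermiGas.Fock,
          FermiGas.BelongsToApproxGroundState (FermiGas.potential Vhat) kF C₀ ξ →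
          FermiGas.IsEigenvector (FermiGas.potential Vhat) (FermiGas.particleNumber kF)
            (FermiGas.particleHole (FermiGas.fermiBall kF) ξ) →
          (∀ k : FermiGas.Mode,
            Summable (fun S => ‖FermiGas.dOp (FermiGas.fermiBall kF) k ξ S‖ ^ 2) ∧
            ∑' S, ‖FermiGas.dOp (FermiGas.fermiBall kF) k ξ S‖ ^ 2 ≤
              C * (FermiGas.particleNumber kF : ℝ) ^ ((1 / 2 : ℝ) - 1 / 68 + ε)) ∧
          (∀ S, Summable (fun k : {k : FermiGas.Mode // k ≠ 0} => (Vhat k : ℂ) *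
            FermiGas.dStar (FermiGas.fermiBall kF) k
              (FermiGas.dOp (FermiGas.fermiBall kF) k ξ) S)) ∧
          Summable (fun S : Finset FermiGas.Mode =>
            starRingEnd ℂ (ξ S) * FermiGas.opE1 Vhat kF ξ S) ∧
          ‖FermiGas.expect (FermiGas.opE1 Vhat kF) ξ‖ ≤
            C * FermiGas.hbar (FermiGas.particleNumber kF) *
              (FermiGas.particleNumber kF : ℝ) ^ (-(1 / 68 : ℝ) + ε)) := by
  refine ⟨fun b hb0 hb1 hsum Λ hΛ => ?_, fun hs C₀ ε hε => ?_⟩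
  · exact FermiGas.exists_opE1Trunc_bound Vhat hVnonneg b hb0 hb1 hsum Λ hΛ
  · exact FermiGas.exists_eigenvector_bounds hVnonneg hs C₀ ε hε
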